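/- For $N\ge 0$ let $\Sigma_N=\{\pm1\}^N$, and for $\kappa>0$ and $X\in\mathbb R^N$ let $H_\kappa(X)=\{\sigma\in\Sigma_N:\ |\langle X,\sigma\rangle|\le\kappa\sqrt N\}$. For $\mathbf X=(X_1,\dots,X_m)\in(\mathbb R^N)^m$ let $S(\mathbf X)=\bigcap_{i=1}^m H_\kappa(X_i)$. Consider two laws on pairs $(\sigma^*,\mathbf X)\in\Sigma_N\times(\mathbb R^N)^m$. Random model, $\mathbb P_{\mathrm r}$: $X_1,\dots,X_m$ are i.i.d. standard Gaussian vectors in $\mathbb R^N$, conditioned on $S(\mathbf X)\ne\emptyset$; given $\mathbf X$, $\sigma^*$ is uniform on $S(\mathbf X)$. Planted model, $\mathbb P_{\mathrm{pl}}$: $\sigma^*$ is uniform on $\Sigma_N$; given $\sigma^*$, $X_1,\dots,X_m$ are independent, each a standard Gaussian vector in $\mathbb R^N$ conditioned on $\sigma^*\in H_\kappa(X_i)$. Let $p(\kappa)=\Pr(|Z|\le\kappa)$ for a standard Gaussian $Z$, and $\alpha_c(\kappa)=-\log 2/\log p(\kappa)$. For $\beta\in(0,1)$ let $q_\kappa(\beta)=\Pr(|Z_1|\le\kappa,\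 |Z_2|\le\kappa)$, where $(Z_1,Z_2)$ is a centred Gaussian vector with unit variances and covariance $2\beta-1$, and let $$F_\alpha(\beta)=-\beta\log\beta-(1-\beta)\log(1-\beta)+\alpha\log q_\kappa(\beta).$$ **Lemma.** Let $\kappa>0$ and $0<\alpha<\alpha_c(\kappa)$, and assume that, for these $\kappa$ and $\alpha$, if $F_\alpha''(1/2)<0$ then $F_\alpha$ has exactly one critical point in $(0,1/2)$. Consider both models with $m=\lfloor\alpha N\rfloor$. For every $N$ let $A_N\subseteq\{(\sigma,U):\ \sigma\in U\subseteq\Sigma_N\}$. If there is a real sequence $(m_N)$ with $m_N\to\infty$ such that $\mathbb P_{\mathrm{pl}}\big((\sigma^*,S(\mathbf X))\in A_N\big)\le N^{-m_N}$ for all sufficiently large $N$, then $$\mathbb P_{\mathrm r}\big((\sigma^*,S(\mathbf X))\in A_N\big)\to0\qquad\text{as }N\to\infty.$$ -/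

import Mathlib

open MeasureTheory ProbabilityTheory Filter Topology

namespace SymPerceptron

noncomputable section

/-- The Hamming cube `Σ_N = {±1}^N`; a coordinate is a unit of `ℤ`, that is `1` or `-1`. -/
abbrev Cube (N : ℕ) : Type := Fin N → ℤˣ

instance instMeasurableSingletonClassIntUnits : MeasurableSingletonClass ℤˣ where
  measurableSet_singleton u :=
    ⟨{(u : ℤ)}, measurableSet_singleton _, by ext v; simp [Units.ext_iff]⟩

/-- A point of the Hamming cube as a vector of Euclidean space. -/
def toVec {N : ℕ} (σ : Cube N) : EuclideanSpace ℝ (Fin N) :=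
  WithLp.toLp 2 (fun i => ((σ i : ℤ) : ℝ))

/-- `H_κ(X) = {σ ∈ Σ_N : |⟨X, σ⟩| ≤ κ √N}`. -/
def slab (κ : ℝ) {N : ℕ} (X : EuclideanSpace ℝ (Fin N)) : Set (Cube N) :=
  {σ | |inner ℝ X (toVec σ)| ≤ κ * √(N : ℝ)}

/-- Configurations `𝐗 = (X_1, …, X_m)` of `m` constraint vectors in `ℝ^N`. -/
abbrev Config (N m : ℕ) : Type := Fin m → EuclideanSpace ℝ (Fin N)

/-- The solution space `S(𝐗) = ⋂ i, H_κ(X_i)`. -/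
def sol (κ : ℝ) {N m : ℕ} (X : Config N m) : Set (Cube N) :=
  ⋂ i, slab κ (X i)

lemma measurableSet_mem_sol (κ : ℝ) {N m : ℕ} (σ : Cube N) :
    MeasurableSet {X : Config N m | σ ∈ sol κ X} := by
  have h : {X : Config N m | σ ∈ sol κ X} =
      ⋂ i, {X : Config N m | |inner ℝ (X i) (toVec σ)| ≤ κ * √(N : ℝ)} := by
    ext X
    simp [sol, slab]
  rw [h]
  refine MeasurableSet.iInter fun i => ?_
  refine measurableSet_le ?_ measurable_const
  fun_prop

lemma measurable_sol (κ : ℝ) (N m : ℕ) :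
    Measurable (fun X : Config N m => sol κ X) :=
  measurable_set_iff.2 fun σ => measurableSet_setOfPred.1 (measurableSet_mem_sol κ σ)

/-- The law of `m` independent standard Gaussian vectors in `ℝ^N`. -/
def disorder (N m : ℕ) : Measure (Config N m) :=
  Measure.pi fun _ => stdGaussian (EuclideanSpace ℝ (Fin N))

/-- Given `𝐗`, the uniform distribution on `S(𝐗)` (the zero measure if `S(𝐗)` is empty). -/
def uniformSol (κ : ℝ) (N m : ℕ) : Kernel (Config N m) (Cube N) where
  toFun X := uniformOn (sol κ X)
  measurable' :=
    (Measurable.of_discrete (f := fun U : Set (Cube N) => uniformOn U)).comp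
      (measurable_sol κ N m)

instance instIsFiniteKernelUniformSol (κ : ℝ) (N m : ℕ) : IsFiniteKernel (uniformSol κ N m) :=
  ⟨1, ENNReal.one_lt_top, fun X => prob_le_one (μ := uniformOn (sol κ X))⟩

/-- Given `σ`, the law of `m` independent vectors, each a standard Gaussian vector conditioned
on the event that `σ` belongs to its slab. -/
def plantedConfig (κ : ℝ) (N m : ℕ) : Kernel (Cube N) (Config N m) where
  toFun σ := Measure.pi fun _ =>
    (stdGaussian (EuclideanSpace ℝ (Fin N)))[|{x | σ ∈ slab κ x}]
  measurable' := Measurable.of_discrete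

instance instIsFiniteKernelPlantedConfig (κ : ℝ) (N m : ℕ) :
    IsFiniteKernel (plantedConfig κ N m) := by
  refine ⟨1, ENNReal.one_lt_top, fun σ => ?_⟩
  change Measure.pi _ Set.univ ≤ 1
  rw [Measure.pi_univ]
  exact Finset.prod_le_one' fun _ _ => prob_le_one

/-- The random model, a law on pairs `(σ*, 𝐗)`: first `𝐗` has i.i.d. standard Gaussian entries
conditioned on `S(𝐗) ≠ ∅`, then `σ*` is uniform on `S(𝐗)`. -/
def randomModel (κ : ℝ) (N m : ℕ) : Measure (Cube N × Config N m) :=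
  (((disorder N m)[|{X | (sol κ X).Nonempty}]) ⊗ₘ uniformSol κ N m).map Prod.swap

/-- The planted model, a law on pairs `(σ*, 𝐗)`: first `σ*` is uniform on `Σ_N`, then the `X_i`
are independent standard Gaussian vectors conditioned on `σ* ∈ H_κ(X_i)`. -/
def plantedModel (κ : ℝ) (N m : ℕ) : Measure (Cube N × Config N m) :=
  uniformOn Set.univ ⊗ₘ plantedConfig κ N m

/-- `p(κ) = P(|Z| ≤ κ)` for a standard Gaussian `Z`. -/
def p (κ : ℝ) : ℝ := (gaussianReal 0 1).real {z | |z| ≤ κ}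

/-- The critical capacity density `α_c(κ) = - log 2 / log p(κ)`. -/
def alphaC (κ : ℝ) : ℝ := -Real.log 2 / Real.log (p κ)

/-- `q_κ(β) = P(|Z_1| ≤ κ, |Z_2| ≤ κ)` for a centred Gaussian vector `(Z_1, Z_2)` with unit
variances and covariance `2 β - 1` (meaningful for `0 ≤ β ≤ 1`). -/
def q (κ β : ℝ) : ℝ :=
  (multivariateGaussian (0 : EuclideanSpace ℝ (Fin 2)) !![1, 2 * β - 1; 2 * β - 1, 1]).real
    {z | |z 0| ≤ κ ∧ |z 1| ≤ κ}

/-- `F_α(β) = H(β) + α log q_κ(β)`, with `H` the Shannon entropy in base `e`. -/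
def F (κ α β : ℝ) : ℝ := Real.binEntropy β + α * Real.log (q κ β)

/-- `F_α` has a single critical point in `(0, 1/2)` if `F_α''(1/2) < 0`. -/
def SingleCriticalPoint (κ α : ℝ) : Prop :=
  iteratedDeriv 2 (F κ α) (1 / 2) < 0 →
    ∃! β : ℝ, β ∈ Set.Ioo (0 : ℝ) (1 / 2) ∧ HasDerivAt (F κ α) 0 β

end

end SymPerceptron

/-! The mean number of `σ ∈ S(𝐗)` with `(σ, S(𝐗)) ∈ A_N` is `2^N p^m` times the planted probability
of `A_N` (`lintegral_count_eq`). Where `|S(𝐗)| > η 2^N p^m`, choosing `σ*` uniformly in `S(𝐗)`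
therefore costs only a factor `1/η` (`randomModel_le`). It remains to show that `|S(𝐗)| > N^(-s_N)
2^N p^m` with probability tending to one, for some `s_N → ∞` with `s_N ≤ m_N / 2`
(`tendsto_real_weight_le`). The second moment bound available here loses a factor `N + 1`, so
Paley–Zygmund alone would not suffice; the logarithm of the number of solutions is followed instead.

Add the constraints one at a time. The normalized count `w_k = |S_k| / (2^N p^k)` is a martingale,
and a new constraint raises the mean of `-log w` by about the relative variance of the fraction of
solutions kept, which is of the order of the mean square overlap `r` of two uniform solutions. By
Jensen, `exp(c N r) ≤ B / w²`, where `B` is an exponential moment of the square overlap over pairs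
of solutions (`pairMoment`), of mean at most `N + 1`. So one step costs `O((log N + E(-log w)) /
N)`, and a discrete Gronwall argument over `αN` steps gives `E(-log w) = O(log N)`
(`exists_potential_bound`); Markov's inequality concludes. As `-log w` may be infinite, it is
truncated at level `η` (`potential`). Constraints that destroy almost all solutions are handled by
Gaussian concentration: their probability is `O(r²)` (`exists_frac_small_le`).

The bound on `B` rests on `F_α(β) ≤ F_α(1/2) - c (2β - 1)²` (`exists_F_le`). Strict concavity at
`1/2` is not assumed: it follows from `α < α_c` by an inequality between `log p` and the logarithmic
slope of `p` (`log_two_mul_slope_sq_le`). The hypothesis on critical points then excludes a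
competing maximum. -/

namespace SymPerceptron
noncomputable section

/-! ### Gaussian concentration by rotation -/

section Concentration

set_option linter.unusedSectionVars false

variable {E : Type*} [NormedAddCommGroup E] [InnerProductSpace ℝ E] [FiniteDimensional ℝ E]
  [MeasurableSpace E] [BorelSpace E]

lemma lintegral_exp_strongDual_le (T : StrongDual ℝ E) (c : ℝ) :
    ∫⁻ y, ENNReal.ofReal (Real.exp (c * T y)) ∂(stdGaussian E)
      = ENNReal.ofReal (Real.exp (c ^ 2 * ‖T‖ ^ 2 / 2)) := by
  have hmap := IsGaussian.map_eq_gaussianReal (μ := stdGaussian E) T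
  rw [integral_strongDual_stdGaussian, variance_dual_stdGaussian] at hmap
  have h1 : ∫⁻ y, ENNReal.ofReal (Real.exp (c * T y)) ∂(stdGaussian E)
      = ∫⁻ z, ENNReal.ofReal (Real.exp (c * z)) ∂((stdGaussian E).map T) := by
    rw [lintegral_map (by fun_prop) (by fun_prop)]
  rw [h1, hmap, ← ofReal_integral_eq_lintegral_ofReal]
  · have h2 := congrFun (mgf_id_gaussianReal (μ := 0) (v := (‖T‖ ^ 2).toNNReal)) c
    rw [mgf] at h2
    simp only [id_eq] at h2
    rw [h2, Real.coe_toNNReal _ (by positivity)]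
    congr 2
    ring
  · exact integrable_exp_mul_gaussianReal c
  · exact ae_of_all _ fun _ => (Real.exp_pos _).le

variable {F : E → ℝ} {F' : E → StrongDual ℝ E}

/-- Integrate the derivative of `F` along the quarter circle `cos θ • x + sin θ • y`, then apply
Jensen's inequality for `exp` to the average over the angle. -/
lemma exp_sub_le_lintegral_rotation (hF : ∀ x, HasFDerivAt F (F' x) x) (hF' : Continuous F')
    (x y : E) :
    ENNReal.ofReal (Real.exp (F y - F x)) ≤ ENNReal.ofReal (2 / Real.pi) *
      ∫⁻ θ in Set.Ioc 0 (Real.pi / 2), ENNReal.ofReal (Real.exp (Real.pi / 2 *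
        F' (ContinuousLinearMap.rotation θ (x, y)).1
          (ContinuousLinearMap.rotation θ (x, y)).2)) := by
  have hpi := Real.pi_pos
  set g : ℝ → ℝ := fun θ => F' (ContinuousLinearMap.rotation θ (x, y)).1
          (ContinuousLinearMap.rotation θ (x, y)).2 with hg
  have hgc : Continuous g := by
    simp only [hg, ContinuousLinearMap.rotation_apply]
    fun_prop
  have hd : ∀ θ : ℝ, HasDerivAt (fun θ : ℝ => F (Real.cos θ • x + Real.sin θ • y)) (g θ) θ := by
    intro θ
    have h1 : HasDerivAt (fun θ : ℝ => Real.cos θ • x + Real.sin θ • y)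
        (-Real.sin θ • x + Real.cos θ • y) θ :=
      ((Real.hasDerivAt_cos θ).smul_const x).add ((Real.hasDerivAt_sin θ).smul_const y)
    exact (hF _).comp_hasDerivAt θ h1
  have hint : F y - F x = ∫ θ in (0 : ℝ)..(Real.pi / 2), g θ := by
    rw [intervalIntegral.integral_eq_sub_of_hasDerivAt (fun θ _ => hd θ)
      (hgc.intervalIntegrable _ _)]
    simp
  have hvol : (volume (Set.Ioc (0:ℝ) (Real.pi / 2))) = ENNReal.ofReal (Real.pi / 2) := by
    simp
  have hvolr : volume.real (Set.Ioc (0:ℝ) (Real.pi / 2)) = Real.pi / 2 := by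
    rw [measureReal_def, hvol, ENNReal.toReal_ofReal (by positivity)]
  have hexpi : IntegrableOn (fun θ => Real.exp (Real.pi / 2 * g θ)) (Set.Ioc 0 (Real.pi / 2)) :=
    (Continuous.integrableOn_Icc (by fun_prop)).mono_set Set.Ioc_subset_Icc_self
  have hJ := ConvexOn.map_set_average_le (μ := volume) (t := Set.Ioc (0:ℝ) (Real.pi / 2))
    (f := fun θ => Real.pi / 2 * g θ) convexOn_exp
    Real.continuous_exp.continuousOn isClosed_univ (by rw [hvol]; simp [hpi])
    (by rw [hvol]; simp) (by simp)
    ((Continuous.integrableOn_Icc (by fun_prop)).mono_set Set.Ioc_subset_Icc_self)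
    hexpi
  rw [setAverage_eq, setAverage_eq, hvolr, smul_eq_mul, smul_eq_mul, integral_const_mul,
    ← mul_assoc, inv_mul_cancel₀ (by positivity), one_mul,
    ← intervalIntegral.integral_of_le (by positivity), ← hint] at hJ
  refine (ENNReal.ofReal_le_ofReal hJ).trans ?_
  rw [ENNReal.ofReal_mul (by positivity), inv_div, ofReal_integral_eq_lintegral_ofReal hexpi]
  exact ae_of_all _ fun _ => (Real.exp_pos _).le

/-- Rotations preserve the product Gaussian law, so for each angle the direction is Gaussian and
independent of the base point. Its exponential moment is at most `exp((π/2)² L² / 2)`. -/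
lemma lintegral_exp_sub_le (hF : ∀ x, HasFDerivAt F (F' x) x) (hF' : Continuous F') {L : ℝ}
    (hL : ∀ x, ‖F' x‖ ≤ L) :
    ∫⁻ z, ENNReal.ofReal (Real.exp (F z.2 - F z.1)) ∂((stdGaussian E).prod (stdGaussian E))
      ≤ ENNReal.ofReal (Real.exp (Real.pi ^ 2 * L ^ 2 / 8)) := by
  have hpi := Real.pi_pos
  have hmeas : Measurable fun w : E × E =>
      ENNReal.ofReal (Real.exp (Real.pi / 2 * F' w.1 w.2)) := by
    apply Measurable.ennreal_ofReal
    apply Continuous.measurable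
    fun_prop
  calc _ ≤ ∫⁻ z, (ENNReal.ofReal (2 / Real.pi) *
      ∫⁻ θ in Set.Ioc (0 : ℝ) (Real.pi / 2), ENNReal.ofReal (Real.exp (Real.pi / 2 *
        F' (ContinuousLinearMap.rotation θ z).1
          (ContinuousLinearMap.rotation θ z).2))) ∂((stdGaussian E).prod (stdGaussian E)) :=
        lintegral_mono fun z => exp_sub_le_lintegral_rotation hF hF' z.1 z.2
    _ = ENNReal.ofReal (2 / Real.pi) * ∫⁻ θ in Set.Ioc 0 (Real.pi / 2),
        ∫⁻ z, ENNReal.ofReal (Real.exp (Real.pi / 2 *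
        F' (ContinuousLinearMap.rotation θ z).1
          (ContinuousLinearMap.rotation θ z).2)) ∂((stdGaussian E).prod (stdGaussian E)) := by
        rw [lintegral_const_mul' _ _ ENNReal.ofReal_ne_top, lintegral_lintegral_swap]
        apply Measurable.aemeasurable
        apply Measurable.ennreal_ofReal
        apply Continuous.measurable
        simp only [ContinuousLinearMap.rotation_apply]
        fun_prop
    _ ≤ ENNReal.ofReal (2 / Real.pi) * ∫⁻ θ in Set.Ioc 0 (Real.pi / 2),
        ENNReal.ofReal (Real.exp (Real.pi ^ 2 * L ^ 2 / 8)) := by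
        gcongr with θ
        rw [← lintegral_map (f := fun w : E × E =>
          ENNReal.ofReal (Real.exp (Real.pi / 2 * F' w.1 w.2))) hmeas
          (ContinuousLinearMap.rotation θ).continuous.measurable,
          IsGaussian.map_rotation_eq_self (by simp), lintegral_prod _ hmeas.aemeasurable]
        simp_rw [lintegral_exp_strongDual_le]
        calc _ ≤ ∫⁻ _ : E, ENNReal.ofReal (Real.exp (Real.pi ^ 2 * L ^ 2 / 8)) ∂(stdGaussian E) := by
              refine lintegral_mono fun x => ENNReal.ofReal_le_ofReal (Real.exp_le_exp.2 ?_)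
              have : ‖F' x‖ ^ 2 ≤ L ^ 2 := by
                have := hL x
                gcongr
              nlinarith [sq_nonneg Real.pi]
          _ = _ := by simp
    _ = ENNReal.ofReal (Real.exp (Real.pi ^ 2 * L ^ 2 / 8)) := by
        rw [setLIntegral_const, Real.volume_Ioc, mul_comm, mul_assoc,
          ← ENNReal.ofReal_mul (by linarith), sub_zero]
        rw [show Real.pi / 2 * (2 / Real.pi) = 1 by field_simp]
        simp

/-- Lower tail of a bounded function with bounded gradient under the standard Gaussian measure. -/
lemma stdGaussian_lower_tail (hF : ∀ x, HasFDerivAt F (F' x) x) (hF' : Continuous F') {L C : ℝ}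
    (hL : ∀ x, ‖F' x‖ ≤ L) (hC : ∀ x, |F x| ≤ C) (s : ℝ) :
    (stdGaussian E).real {x | F x ≤ ∫ y, F y ∂(stdGaussian E) - s}
      ≤ Real.exp (Real.pi ^ 2 * L ^ 2 / 8 - s) := by
  have hFc : Continuous F := continuous_iff_continuousAt.2 fun x => (hF x).continuousAt
  have hFi : Integrable F (stdGaussian E) :=
    Integrable.of_bound hFc.aestronglyMeasurable C (ae_of_all _ fun x => hC x)
  have hm : Measurable fun z : E × E => ENNReal.ofReal (Real.exp (F z.2 - F z.1)) :=
    (Continuous.measurable (by fun_prop)).ennreal_ofReal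
  have h1 := lintegral_exp_sub_le hF hF' hL
  rw [lintegral_prod _ hm.aemeasurable] at h1
  -- Jensen in the independent copy `y` replaces `F y` by its mean; Markov's inequality in `x` then
  -- gives the tail.
  have h2 : ∀ x, ENNReal.ofReal (Real.exp (∫ y, F y ∂(stdGaussian E) - F x)) ≤
      ∫⁻ y, ENNReal.ofReal (Real.exp (F y - F x)) ∂(stdGaussian E) := by
    intro x
    have hint : Integrable (fun y => Real.exp (F y - F x)) (stdGaussian E) := by
      refine Integrable.of_bound (Continuous.aestronglyMeasurable (by fun_prop))
        (Real.exp (C + C)) (ae_of_all _ fun y => ?_)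
      rw [Real.norm_eq_abs, abs_of_pos (Real.exp_pos _), Real.exp_le_exp]
      have := abs_le.1 (hC x)
      have := abs_le.1 (hC y)
      linarith
    rw [← ofReal_integral_eq_lintegral_ofReal hint (ae_of_all _ fun _ => (Real.exp_pos _).le)]
    apply ENNReal.ofReal_le_ofReal
    have := ConvexOn.map_integral_le (μ := stdGaussian E) (f := fun y => F y - F x) convexOn_exp
      Real.continuous_exp.continuousOn isClosed_univ (by simp) (hFi.sub (integrable_const _)) hint
    rwa [integral_sub hFi (integrable_const _), integral_const, probReal_univ, one_smul] at this
  have h3 : ENNReal.ofReal (Real.exp s) *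
      (stdGaussian E) {x | F x ≤ ∫ y, F y ∂(stdGaussian E) - s} ≤
      ENNReal.ofReal (Real.exp (Real.pi ^ 2 * L ^ 2 / 8)) := by
    refine le_trans ?_ h1
    refine le_trans ?_ (mul_meas_ge_le_lintegral
      (hm.lintegral_prod_right' (ν := stdGaussian E)) (ENNReal.ofReal (Real.exp s)))
    gcongr with x
    intro hx
    refine le_trans (ENNReal.ofReal_le_ofReal (Real.exp_le_exp.2 ?_)) (h2 x)
    linarith
  rw [Real.exp_sub, measureReal_def]
  rw [le_div_iff₀ (Real.exp_pos _), mul_comm]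
  have h4 := ENNReal.toReal_mono ENNReal.ofReal_ne_top h3
  rwa [ENNReal.toReal_mul, ENNReal.toReal_ofReal (Real.exp_pos _).le,
    ENNReal.toReal_ofReal (Real.exp_pos _).le] at h4

end Concentration

/-! ### Pairs of Gaussian projections -/

lemma measurableSet_abs_le_and {α : Type*} [MeasurableSpace α] {f g : α → ℝ} (hf : Measurable f)
    (hg : Measurable g) (κ : ℝ) : MeasurableSet {z | |f z| ≤ κ ∧ |g z| ≤ κ} :=
  (measurableSet_le hf.abs measurable_const).inter (measurableSet_le hg.abs measurable_const)

lemma posSemidef_unit_covariance {ρ : ℝ} (h : ρ ^ 2 ≤ 1) :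
    (!![1, ρ; ρ, 1] : Matrix (Fin 2) (Fin 2) ℝ).PosSemidef := by
  refine Matrix.PosSemidef.of_dotProduct_mulVec_nonneg ?_ ?_
  · ext i j; fin_cases i <;> fin_cases j <;> simp
  · intro x
    simp [Matrix.mulVec, dotProduct, Fin.sum_univ_two]
    nlinarith [sq_nonneg (x 0 + ρ * x 1), sq_nonneg (x 1)]

section InnerProducts

variable {E : Type*} [NormedAddCommGroup E] [InnerProductSpace ℝ E] [FiniteDimensional ℝ E]
  [MeasurableSpace E] [BorelSpace E]

lemma map_inner_pair_stdGaussian {v w : E} (hv : ‖v‖ = 1) (hw : ‖w‖ = 1) {ρ : ℝ}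
    (hρ : inner ℝ v w = ρ) :
    (stdGaussian E).map (fun g => (!₂[inner ℝ g v, inner ℝ g w] : EuclideanSpace ℝ (Fin 2)))
      = multivariateGaussian 0 !![1, ρ; ρ, 1] := by
  have hm : Measurable fun g : E => (!₂[inner ℝ g v, inner ℝ g w] : EuclideanSpace ℝ (Fin 2)) := by
    apply Continuous.measurable
    fun_prop
  have hρ2 : ρ ^ 2 ≤ 1 := by
    have := abs_real_inner_le_norm v w
    rw [hρ, hv, hw, mul_one] at this
    exact (sq_le_one_iff_abs_le_one ρ).2 this
  have := Measure.isProbabilityMeasure_map (μ := stdGaussian E) hm.aemeasurable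
  apply Measure.ext_of_charFun
  ext t
  rw [charFun_multivariateGaussian (posSemidef_unit_covariance hρ2), charFun_apply,
    integral_map hm.aemeasurable (by fun_prop)]
  have h1 : ∀ g : E, inner ℝ (!₂[inner ℝ g v, inner ℝ g w] : EuclideanSpace ℝ (Fin 2)) t
      = inner ℝ g (t 0 • v + t 1 • w) := by
    intro g
    simp [PiLp.inner_apply, Fin.sum_univ_two, inner_add_right, inner_smul_right]
  simp_rw [h1]
  rw [← charFun_apply, charFun_stdGaussian]
  congr 1
  have h2 : ‖t 0 • v + t 1 • w‖ ^ 2 = t 0 ^ 2 + 2 * ρ * (t 0 * t 1) + t 1 ^ 2 := by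
    rw [norm_add_sq_real, norm_smul, norm_smul, hv, hw, inner_smul_left, inner_smul_right, hρ]
    simp
    ring
  rw [← Complex.ofReal_pow, h2]
  simp [Matrix.mulVec, dotProduct, Fin.sum_univ_two]
  ring

lemma q_eq_stdGaussian {v w : E} (hv : ‖v‖ = 1) (hw : ‖w‖ = 1) {ρ : ℝ}
    (hρ : inner ℝ v w = ρ) (κ : ℝ) :
    q κ ((1 + ρ) / 2) =
      (stdGaussian E).real {g | |inner ℝ g v| ≤ κ ∧ |inner ℝ g w| ≤ κ} := by
  have hm : Measurable fun g : E => (!₂[inner ℝ g v, inner ℝ g w] : EuclideanSpace ℝ (Fin 2)) := by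
    apply Continuous.measurable
    fun_prop
  rw [q, show 2 * ((1 + ρ) / 2) - 1 = ρ by ring, ← map_inner_pair_stdGaussian hv hw hρ,
    map_measureReal_apply hm]
  · simp
  · exact measurableSet_abs_le_and (by fun_prop) (by fun_prop) κ

lemma p_eq_stdGaussian {v : E} (hv : ‖v‖ = 1) (κ : ℝ) :
    p κ = (stdGaussian E).real {g | |inner ℝ g v| ≤ κ} := by
  have hmap := IsGaussian.map_eq_gaussianReal (μ := stdGaussian E) (innerSL ℝ v)
  rw [integral_strongDual_stdGaussian, variance_dual_stdGaussian, innerSL_apply_norm, hv] at hmap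
  have h1 : gaussianReal 0 1 = (stdGaussian E).map (innerSL ℝ v) := by
    rw [hmap]; simp
  rw [p, h1, map_measureReal_apply (by fun_prop) (measurableSet_le (by fun_prop) measurable_const)]
  simp [real_inner_comm]

end InnerProducts

/-- Realizes the pair as `(Z₁, ρ Z₁ + √(1 - ρ²) Z₂)` with independent `Z₁, Z₂`. The degenerate
values `ρ = ±1` are included; they give the value at `β = 0`. -/
lemma q_eq_gaussian_prod {ρ : ℝ} (hρ : ρ ^ 2 ≤ 1) (κ : ℝ) :
    q κ ((1 + ρ) / 2) = ((gaussianReal 0 1).prod (gaussianReal 0 1)).real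
      {z | |z.1| ≤ κ ∧ |ρ * z.1 + √(1 - ρ ^ 2) * z.2| ≤ κ} := by
  have hs : √(1 - ρ ^ 2) ^ 2 = 1 - ρ ^ 2 := Real.sq_sqrt (by linarith)
  rw [q_eq_stdGaussian (E := EuclideanSpace ℝ (Fin 2)) (v := !₂[1, 0]) (w := !₂[ρ, √(1 - ρ ^ 2)])
    (by simp [EuclideanSpace.norm_eq]) (by simp [EuclideanSpace.norm_eq, hs])
    (ρ := ρ) (by simp [PiLp.inner_apply, Fin.sum_univ_two])]
  have hms : MeasurableSet {z : ℝ × ℝ | |z.1| ≤ κ ∧ |ρ * z.1 + √(1 - ρ ^ 2) * z.2| ≤ κ} := by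
    exact measurableSet_abs_le_and (by fun_prop) (by fun_prop) κ
  rw [← map_pi_eq_stdGaussian, map_measureReal_apply (by fun_prop),
    ← (measurePreserving_finTwoArrow (gaussianReal 0 1)).measureReal_preimage
      hms.nullMeasurableSet]
  · congr 1
    ext z
    simp [PiLp.inner_apply, Fin.sum_univ_two, mul_comm]
  · exact measurableSet_abs_le_and (by fun_prop) (by fun_prop) κ

lemma q_le_p {β : ℝ} (h0 : 0 ≤ β) (h1 : β ≤ 1) (κ : ℝ) : q κ β ≤ p κ := by
  have hρ : (2 * β - 1) ^ 2 ≤ 1 := by nlinarith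
  have := q_eq_gaussian_prod hρ κ
  rw [show (1 + (2 * β - 1)) / 2 = β by ring] at this
  rw [this]
  calc _ ≤ ((gaussianReal 0 1).prod (gaussianReal 0 1)).real ({z | |z| ≤ κ} ×ˢ Set.univ) :=
        measureReal_mono (fun z hz => ⟨hz.1, trivial⟩)
    _ = p κ := by rw [measureReal_prod_prod]; simp [p]

/-- Negating one of the two unit vectors flips the correlation and preserves both symmetric
constraints. -/
lemma q_one_sub (κ β : ℝ) (h0 : 0 ≤ β) (h1 : β ≤ 1) : q κ (1 - β) = q κ β := by
  have key : ∀ ρ : ℝ, ρ ^ 2 ≤ 1 → q κ ((1 + ρ) / 2) = q κ ((1 + -ρ) / 2) := by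
    intro ρ hρ
    have hs : √(1 - ρ ^ 2) ^ 2 = 1 - ρ ^ 2 := Real.sq_sqrt (by linarith)
    rw [q_eq_stdGaussian (E := EuclideanSpace ℝ (Fin 2)) (v := !₂[1, 0])
      (w := !₂[ρ, √(1 - ρ ^ 2)])
      (by simp [EuclideanSpace.norm_eq]) (by simp [EuclideanSpace.norm_eq, hs])
      (ρ := ρ) (by simp [PiLp.inner_apply, Fin.sum_univ_two]),
      q_eq_stdGaussian (E := EuclideanSpace ℝ (Fin 2)) (v := !₂[1, 0])
      (w := -!₂[ρ, √(1 - ρ ^ 2)])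
      (by simp [EuclideanSpace.norm_eq]) (by simp [EuclideanSpace.norm_eq, hs])
      (ρ := -ρ) (by simp [PiLp.inner_apply, Fin.sum_univ_two])]
    simp only [inner_neg_right, abs_neg]
  have := key (2 * β - 1) (by nlinarith)
  rw [show (1 + (2 * β - 1)) / 2 = β by ring, show (1 + -(2 * β - 1)) / 2 = 1 - β by ring] at this
  exact this.symm

/-! ### The pair probability as a function of the correlation -/

/-- The standard Gaussian density. -/
def phi (x : ℝ) : ℝ := (√(2 * Real.pi))⁻¹ * Real.exp (-x ^ 2 / 2)

/-- The integral of the standard Gaussian density from `0`. -/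
def gint (z : ℝ) : ℝ := ∫ x in (0 : ℝ)..z, phi x

lemma gaussianPDFReal_zero_one : gaussianPDFReal 0 1 = phi := by
  ext x
  simp [gaussianPDFReal, phi]

@[fun_prop]
lemma continuous_phi : Continuous phi := by
  unfold phi
  fun_prop

lemma phi_pos (x : ℝ) : 0 < phi x := by
  unfold phi
  have := Real.pi_pos
  positivity

lemma phi_neg (x : ℝ) : phi (-x) = phi x := by simp [phi]

lemma phi_le_one (x : ℝ) : phi x ≤ 1 := by
  unfold phi
  have h1 : (√(2 * Real.pi))⁻¹ ≤ 1 := by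
    apply inv_le_one_of_one_le₀
    rw [Real.one_le_sqrt]
    linarith [Real.pi_gt_three]
  have h2 : Real.exp (-x ^ 2 / 2) ≤ 1 := Real.exp_le_one_iff.2 (by nlinarith [sq_nonneg x])
  have := Real.exp_pos (-x ^ 2 / 2)
  nlinarith

lemma phi_mul_phi (x y : ℝ) :
    phi x * phi y = (2 * Real.pi)⁻¹ * Real.exp (-(x ^ 2 + y ^ 2) / 2) := by
  unfold phi
  have hpi := Real.pi_pos
  rw [show -(x ^ 2 + y ^ 2) / 2 = -x ^ 2 / 2 + -y ^ 2 / 2 by ring, Real.exp_add]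
  have h : (√(2 * Real.pi))⁻¹ * (√(2 * Real.pi))⁻¹ = (2 * Real.pi)⁻¹ := by
    rw [← mul_inv, Real.mul_self_sqrt (by positivity)]
  rw [← h]
  ring

lemma hasDerivAt_phi (x : ℝ) : HasDerivAt phi (-x * phi x) x := by
  have h := (((hasDerivAt_pow 2 x).neg.div_const 2).exp).const_mul (√(2 * Real.pi))⁻¹
  refine h.congr_deriv ?_
  simp [phi]
  ring

lemma hasDerivAt_gint (z : ℝ) : HasDerivAt gint (phi z) z :=
  intervalIntegral.integral_hasDerivAt_right (continuous_phi.intervalIntegrable _ _)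
    (continuous_phi.stronglyMeasurableAtFilter _ _) continuous_phi.continuousAt

@[fun_prop]
lemma continuous_gint : Continuous gint :=
  continuous_iff_continuousAt.2 fun z => (hasDerivAt_gint z).continuousAt

lemma gint_neg (z : ℝ) : gint (-z) = -gint z := by
  have := intervalIntegral.integral_comp_neg (a := 0) (b := z) phi
  simp only [phi_neg, neg_zero] at this
  rw [gint, gint, this, intervalIntegral.integral_symm]

lemma gaussianReal_Icc {a b : ℝ} (hab : a ≤ b) :
    (gaussianReal 0 1).real (Set.Icc a b) = gint b - gint a := by
  rw [measureReal_def, gaussianReal_apply_eq_integral 0 one_ne_zero, gaussianPDFReal_zero_one,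
    ENNReal.toReal_ofReal (setIntegral_nonneg measurableSet_Icc fun x _ => (phi_pos x).le),
    integral_Icc_eq_integral_Ioc, ← intervalIntegral.integral_of_le hab]
  exact (intervalIntegral.integral_interval_sub_left (continuous_phi.intervalIntegrable _ _)
    (continuous_phi.intervalIntegrable _ _)).symm

lemma p_eq_gint {κ : ℝ} (hκ : 0 ≤ κ) : p κ = 2 * gint κ := by
  have : {z : ℝ | |z| ≤ κ} = Set.Icc (-κ) κ := by ext; simp [abs_le]
  rw [p, this, gaussianReal_Icc (by linarith), gint_neg]
  ring

lemma gaussianReal_abs_add_mul_le {κ s : ℝ} (hκ : 0 ≤ κ) (hs : 0 < s) (a : ℝ) :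
    (gaussianReal 0 1).real {y | |a + s * y| ≤ κ} = gint ((κ - a) / s) + gint ((κ + a) / s) := by
  have : {y : ℝ | |a + s * y| ≤ κ} = Set.Icc ((-κ - a) / s) ((κ - a) / s) := by
    ext y
    simp only [Set.mem_ofPred_eq, abs_le, Set.mem_Icc, div_le_iff₀ hs, le_div_iff₀ hs]
    constructor <;> rintro ⟨h1, h2⟩ <;> constructor <;> linarith
  rw [this, gaussianReal_Icc (by gcongr; linarith), show (-κ - a) / s = -((κ + a) / s) by ring,
    gint_neg]
  ring

/-- `q_κ` as an integral, as a function of the correlation. -/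
def qInt (κ ρ : ℝ) : ℝ :=
  ∫ x in (-κ)..κ, phi x *
    (gint ((κ - ρ * x) / √(1 - ρ ^ 2)) + gint ((κ + ρ * x) / √(1 - ρ ^ 2)))

lemma q_eq_qInt {κ ρ : ℝ} (hκ : 0 ≤ κ) (hρ : ρ ^ 2 < 1) : q κ ((1 + ρ) / 2) = qInt κ ρ := by
  have hs : 0 < √(1 - ρ ^ 2) := Real.sqrt_pos.2 (by linarith)
  have hms := measurableSet_abs_le_and (f := fun z : ℝ × ℝ => z.1)
    (g := fun z => ρ * z.1 + √(1 - ρ ^ 2) * z.2) (by fun_prop) (by fun_prop) κ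
  rw [q_eq_gaussian_prod hρ.le, measureReal_def, Measure.prod_apply hms]
  have h1 : ∀ x : ℝ, (gaussianReal 0 1) (Prod.mk x ⁻¹' {z : ℝ × ℝ | |z.1| ≤ κ ∧
      |ρ * z.1 + √(1 - ρ ^ 2) * z.2| ≤ κ}) = ENNReal.ofReal ((Set.Icc (-κ) κ).indicator
        (fun x => gint ((κ - ρ * x) / √(1 - ρ ^ 2)) + gint ((κ + ρ * x) / √(1 - ρ ^ 2))) x) := by
    intro x
    by_cases hx : |x| ≤ κ
    · rw [Set.indicator_of_mem (Set.mem_Icc.2 (abs_le.1 hx)), ← gaussianReal_abs_add_mul_le hκ hs, measureReal_def,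
        ENNReal.ofReal_toReal (measure_ne_top _ _)]
      congr 1
      ext y
      simp [hx]
    · rw [Set.indicator_of_notMem (fun h => hx (abs_le.2 (Set.mem_Icc.1 h)))]
      simp [hx]
  simp_rw [h1]
  have hnn : ∀ x : ℝ, 0 ≤ (Set.Icc (-κ) κ).indicator
        (fun x => gint ((κ - ρ * x) / √(1 - ρ ^ 2)) + gint ((κ + ρ * x) / √(1 - ρ ^ 2))) x := by
    intro x
    refine Set.indicator_nonneg (fun x _ => ?_) x
    rw [← gaussianReal_abs_add_mul_le hκ hs]
    exact measureReal_nonneg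
  rw [← integral_eq_lintegral_of_nonneg_ae (ae_of_all _ hnn)
    ((Continuous.measurable (by fun_prop)).indicator measurableSet_Icc).aestronglyMeasurable,
    integral_gaussianReal_eq_integral_smul one_ne_zero, gaussianPDFReal_zero_one, qInt,
    intervalIntegral.integral_of_le (by linarith), ← integral_Icc_eq_integral_Ioc,
    ← integral_indicator measurableSet_Icc]
  congr 1
  ext x
  by_cases hx : x ∈ Set.Icc (-κ) κ <;> simp [hx]

/-- The derivative of `q_κ` with respect to the correlation. -/
def qDer (κ ρ : ℝ) : ℝ :=
  (Real.pi * √(1 - ρ ^ 2))⁻¹ * (Real.exp (-κ ^ 2 / (1 + ρ)) - Real.exp (-κ ^ 2 / (1 - ρ)))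

lemma hasDerivAt_exp_quadratic (κ ρ s x : ℝ) (hs : s ≠ 0) :
    HasDerivAt (fun x => Real.exp (-(x ^ 2 - 2 * ρ * κ * x + κ ^ 2) / (2 * s ^ 2)))
      (Real.exp (-(x ^ 2 - 2 * ρ * κ * x + κ ^ 2) / (2 * s ^ 2)) * ((κ * ρ - x) / s ^ 2)) x := by
  have h := ((((hasDerivAt_pow 2 x).sub ((hasDerivAt_id x).const_mul (2 * ρ * κ))).add_const
    (κ ^ 2)).neg.div_const (2 * s ^ 2)).exp
  refine h.congr_deriv ?_
  simp
  field_simp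

lemma phi_mul_phi_div {κ ρ s x : ℝ} (hs : s ≠ 0) (hs2 : s ^ 2 = 1 - ρ ^ 2) :
    phi x * phi ((κ - ρ * x) / s) =
      (2 * Real.pi)⁻¹ * Real.exp (-(x ^ 2 - 2 * ρ * κ * x + κ ^ 2) / (2 * s ^ 2)) := by
  rw [phi_mul_phi]
  congr 2
  have : ρ ^ 2 = 1 - s ^ 2 := by linarith
  field_simp
  ring_nf
  rw [this]
  ring

/-- The integrand is an exact derivative in `x` of the exponential of the quadratic form, so only
the corner values at `x = ±κ` survive, as in Plackett's identity. -/
lemma integral_phi_mul_phi_div {κ ρ s : ℝ} (hs : 0 < s) (hs2 : s ^ 2 = 1 - ρ ^ 2) :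
    ∫ x in (-κ)..κ, phi x * (phi ((κ - ρ * x) / s) * ((κ * ρ - x) / s ^ 3)) =
      (2 * Real.pi * s)⁻¹ * (Real.exp (-κ ^ 2 / (1 + ρ)) - Real.exp (-κ ^ 2 / (1 - ρ))) := by
  have hd : ∀ x, HasDerivAt (fun x => (2 * Real.pi * s)⁻¹ *
      Real.exp (-(x ^ 2 - 2 * ρ * κ * x + κ ^ 2) / (2 * s ^ 2)))
      (phi x * (phi ((κ - ρ * x) / s) * ((κ * ρ - x) / s ^ 3))) x := by
    intro x
    refine ((hasDerivAt_exp_quadratic κ ρ s x hs.ne').const_mul _).congr_deriv ?_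
    rw [← mul_assoc (phi x), phi_mul_phi_div hs.ne' hs2]
    have := Real.pi_pos
    field_simp
  rw [intervalIntegral.integral_eq_sub_of_hasDerivAt (fun x _ => hd x)
    (Continuous.intervalIntegrable (by fun_prop) _ _)]
  have h1 : 1 + ρ ≠ 0 := by
    intro h
    have : ρ = -1 := by linarith
    rw [this] at hs2
    nlinarith
  have h2 : 1 - ρ ≠ 0 := by
    intro h
    have : ρ = 1 := by linarith
    rw [this] at hs2
    nlinarith
  rw [hs2, show (1 : ℝ) - ρ ^ 2 = (1 + ρ) * (1 - ρ) by ring]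
  have e1 : -(κ ^ 2 - 2 * ρ * κ * κ + κ ^ 2) / (2 * ((1 + ρ) * (1 - ρ))) = -κ ^ 2 / (1 + ρ) := by
    field_simp
    ring
  have e2 : -((-κ) ^ 2 - 2 * ρ * κ * -κ + κ ^ 2) / (2 * ((1 + ρ) * (1 - ρ))) =
      -κ ^ 2 / (1 - ρ) := by
    field_simp
    ring
  rw [e1, e2]
  ring

lemma hasDerivAt_gint_comp {κ ρ : ℝ} (hρ : ρ ^ 2 < 1) (x : ℝ) :
    HasDerivAt (fun ρ => gint ((κ - ρ * x) / √(1 - ρ ^ 2)))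
      (phi ((κ - ρ * x) / √(1 - ρ ^ 2)) * ((κ * ρ - x) / √(1 - ρ ^ 2) ^ 3)) ρ := by
  have hpos : 0 < 1 - ρ ^ 2 := by linarith
  have hs : 0 < √(1 - ρ ^ 2) := Real.sqrt_pos.2 hpos
  have hs2 : √(1 - ρ ^ 2) ^ 2 = 1 - ρ ^ 2 := Real.sq_sqrt hpos.le
  have h1 : HasDerivAt (fun ρ : ℝ => √(1 - ρ ^ 2)) (-ρ / √(1 - ρ ^ 2)) ρ := by
    refine (((hasDerivAt_pow 2 ρ).const_sub 1).sqrt hpos.ne').congr_deriv ?_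
    simp
    field_simp
  have h2 : HasDerivAt (fun ρ : ℝ => κ - ρ * x) (-x) ρ := by
    simpa using ((hasDerivAt_id ρ).mul_const x).const_sub κ
  refine ((hasDerivAt_gint _).comp ρ (h2.div h1 hs.ne')).congr_deriv ?_
  congr 1
  rw [div_eq_div_iff (by positivity) (by positivity)]
  field_simp
  rw [hs2]
  ring

/-- Differentiation under the integral. The two `gint` terms are exchanged by `x ↦ -x`, so each
contributes half of `qDer`. -/
lemma hasDerivAt_qInt {κ ρ : ℝ} (hκ : 0 ≤ κ) (hρ : ρ ^ 2 < 1) :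
    HasDerivAt (qInt κ) (qDer κ ρ) ρ := by
  have hpos : 0 < 1 - ρ ^ 2 := by linarith
  have hs : 0 < √(1 - ρ ^ 2) := Real.sqrt_pos.2 hpos
  have hs2 : √(1 - ρ ^ 2) ^ 2 = 1 - ρ ^ 2 := Real.sq_sqrt hpos.le
  -- On the neighbourhood `r² < 1 - d` of `ρ`, the denominators `√(1 - r²)` stay above `√d`, which
  -- gives a constant dominating function.
  set d : ℝ := (1 - ρ ^ 2) / 2 with hd
  have hdpos : 0 < √d := Real.sqrt_pos.2 (by linarith)
  have hnhds : {r : ℝ | r ^ 2 < 1 - d} ∈ 𝓝 ρ :=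
    (isOpen_lt (by fun_prop) continuous_const).mem_nhds (by simp only [Set.mem_ofPred_eq]; linarith)
  have hb : ∀ r ∈ {r : ℝ | r ^ 2 < 1 - d}, ∀ x, |x| ≤ κ → ∀ y,
      |phi y * ((κ * r - x) / √(1 - r ^ 2) ^ 3)| ≤ (κ + κ) / √d ^ 3 := by
    intro r hr x hx y
    have hr' : r ^ 2 < 1 - d := hr
    have hr1 : |r| ≤ 1 := (sq_le_one_iff_abs_le_one r).1 (by linarith)
    have hsd : √d ≤ √(1 - r ^ 2) := Real.sqrt_le_sqrt (by linarith)
    rw [abs_mul, abs_div, abs_of_pos (phi_pos _), abs_of_pos (a := √(1 - r ^ 2) ^ 3)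
      (pow_pos (hdpos.trans_le hsd) 3)]
    have h1 : |κ * r - x| ≤ κ + κ := by
      refine (abs_sub _ _).trans (add_le_add ?_ hx)
      rw [abs_mul, abs_of_nonneg hκ]
      exact mul_le_of_le_one_right hκ hr1
    have h2 : |κ * r - x| / √(1 - r ^ 2) ^ 3 ≤ (κ + κ) / √d ^ 3 := by gcongr
    calc _ ≤ 1 * (|κ * r - x| / √(1 - r ^ 2) ^ 3) := by
          gcongr
          exact phi_le_one _
      _ ≤ _ := by rw [one_mul]; exact h2
  have key := intervalIntegral.hasDerivAt_integral_of_dominated_loc_of_deriv_le (μ := volume)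
    (a := -κ) (b := κ) (x₀ := ρ) (s := {r : ℝ | r ^ 2 < 1 - d})
    (F := fun ρ x => phi x *
      (gint ((κ - ρ * x) / √(1 - ρ ^ 2)) + gint ((κ + ρ * x) / √(1 - ρ ^ 2))))
    (F' := fun ρ x => phi x * (phi ((κ - ρ * x) / √(1 - ρ ^ 2)) * ((κ * ρ - x) / √(1 - ρ ^ 2) ^ 3))
      + phi x * (phi ((κ + ρ * x) / √(1 - ρ ^ 2)) * ((κ * ρ + x) / √(1 - ρ ^ 2) ^ 3)))
    (bound := fun _ => (κ + κ) / √d ^ 3 + (κ + κ) / √d ^ 3) hnhds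
    (Eventually.of_forall fun r => Continuous.aestronglyMeasurable (by fun_prop))
    (Continuous.intervalIntegrable (by fun_prop) _ _)
    (Continuous.aestronglyMeasurable (by fun_prop))
    (ae_of_all _ fun x hx r hr => ?_) (by simp) (ae_of_all _ fun x hx r hr => ?_)
  · refine key.2.congr_deriv ?_
    rw [intervalIntegral.integral_add (Continuous.intervalIntegrable (by fun_prop) _ _)
      (Continuous.intervalIntegrable (by fun_prop) _ _), integral_phi_mul_phi_div hs hs2]
    have h2 := intervalIntegral.integral_comp_neg (a := -κ) (b := κ)
      (fun x => phi x * (phi ((κ + ρ * x) / √(1 - ρ ^ 2)) * ((κ * ρ + x) / √(1 - ρ ^ 2) ^ 3)))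
    rw [neg_neg] at h2
    rw [← h2]
    simp only [phi_neg, mul_neg, ← sub_eq_add_neg]
    rw [integral_phi_mul_phi_div hs hs2, qDer]
    have := Real.pi_pos
    field_simp
    ring
  · rw [Set.uIoc_of_le (by linarith)] at hx
    have hx' : |x| ≤ κ := abs_le.2 ⟨hx.1.le, hx.2⟩
    have h1 := hb r hr x hx' ((κ - r * x) / √(1 - r ^ 2))
    have h2 := hb r hr (-x) (by rwa [abs_neg]) ((κ + r * x) / √(1 - r ^ 2))
    rw [sub_neg_eq_add] at h2
    rw [← mul_add, norm_mul, Real.norm_eq_abs, Real.norm_eq_abs, abs_of_pos (phi_pos x)]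
    refine (mul_le_of_le_one_left (abs_nonneg _) (phi_le_one x)).trans ?_
    exact (abs_add_le _ _).trans (add_le_add h1 h2)
  · have hr' : r ^ 2 < 1 := lt_trans hr (by linarith)
    have h1 := hasDerivAt_gint_comp (κ := κ) hr' x
    have h2 := hasDerivAt_gint_comp (κ := κ) hr' (-x)
    simp only [mul_neg, sub_neg_eq_add] at h2
    refine ((h1.add h2).const_mul (phi x)).congr_deriv ?_
    ring

lemma qInt_zero {κ : ℝ} (hκ : 0 ≤ κ) : qInt κ 0 = p κ ^ 2 := by
  simp only [qInt, zero_mul, sub_zero, add_zero]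
  simp only [ne_eq, OfNat.ofNat_ne_zero, not_false_eq_true, zero_pow, sub_zero, Real.sqrt_one,
    div_one, intervalIntegral.integral_mul_const]
  have h := intervalIntegral.integral_interval_sub_left (a := 0) (b := κ) (c := -κ)
    (continuous_phi.intervalIntegrable (μ := volume) _ _) (continuous_phi.intervalIntegrable _ _)
  rw [← h]
  change (gint κ - gint (-κ)) * _ = _
  rw [gint_neg, p_eq_gint hκ]
  ring

/-! ### The logarithmic slope of `p` against `log p` -/

section SlopeInequality

lemma gint_zero : gint 0 = 0 := by simp [gint]

lemma monotone_gint : Monotone gint :=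
  monotone_of_hasDerivAt_nonneg hasDerivAt_gint fun x => (phi_pos x).le

lemma gint_pos {κ : ℝ} (hκ : 0 < κ) : 0 < gint κ := by
  have h := strictMono_of_hasDerivAt_pos hasDerivAt_gint phi_pos hκ
  rwa [gint_zero] at h

lemma hasDerivAt_mul_phi_mul {e : ℝ → ℝ} {e' x : ℝ} (he : HasDerivAt e e' x) :
    HasDerivAt (fun x => x * phi x * e x) (phi x * ((1 - x ^ 2) * e x + x * e')) x := by
  refine (((hasDerivAt_id x).mul (hasDerivAt_phi x)).mul he).congr_deriv ?_
  simp
  ring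

lemma hasDerivAt_even_poly (a b c d e f x : ℝ) :
    HasDerivAt (fun x : ℝ => 1 + a * x ^ 2 + b * x ^ 4 + c * x ^ 6 + d * x ^ 8 + e * x ^ 10
      + f * x ^ 12)
      (2 * a * x + 4 * b * x ^ 3 + 6 * c * x ^ 5 + 8 * d * x ^ 7 + 10 * e * x ^ 9
        + 12 * f * x ^ 11) x := by
  have h := (((((((hasDerivAt_pow 2 x).const_mul a).const_add 1).add
    ((hasDerivAt_pow 4 x).const_mul b)).add ((hasDerivAt_pow 6 x).const_mul c)).add
    ((hasDerivAt_pow 8 x).const_mul d)).add ((hasDerivAt_pow 10 x).const_mul e)).add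
    ((hasDerivAt_pow 12 x).const_mul f)
  refine h.congr_deriv ?_
  norm_num
  ring

/-- A truncation of the expansion `∫₀^x φ = x φ(x) ∑ x^(2n) / (2n+1)!!`. -/
lemma mul_phi_le_gint {x : ℝ} (hx : 0 ≤ x) :
    x * phi x * (1 + 1 / 3 * x ^ 2 + 1 / 15 * x ^ 4 + 1 / 105 * x ^ 6 + 1 / 945 * x ^ 8
      + 1 / 10395 * x ^ 10 + 0 * x ^ 12) ≤ gint x := by
  have hd := fun y => (hasDerivAt_gint y).sub (hasDerivAt_mul_phi_mul
    (hasDerivAt_even_poly (1 / 3) (1 / 15) (1 / 105) (1 / 945) (1 / 10395) 0 y))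
  have h := monotone_of_hasDerivAt_nonneg hd (fun y => by
    have := phi_pos y
    have h12 : 0 ≤ y ^ 12 := by positivity
    have : 0 ≤ phi y * (1 / 10395 * y ^ 12) := by positivity
    simp only [Pi.zero_apply]
    nlinarith) hx
  simpa [gint_zero] using h

/-- The last coefficient exceeds the true `1/135135` in order to absorb the tail of the series: the
difference has derivative `φ(y) y¹² ((13 - y²)/101400 - 1/10395)`, nonnegative as long as `y² ≤
81/25`. -/
lemma gint_le_mul_phi {x : ℝ} (hx : 0 ≤ x) (hx' : x ^ 2 ≤ 81 / 25) :
    gint x ≤ x * phi x * (1 + 1 / 3 * x ^ 2 + 1 / 15 * x ^ 4 + 1 / 105 * x ^ 6 + 1 / 945 * x ^ 8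
      + 1 / 10395 * x ^ 10 + 1 / 101400 * x ^ 12) := by
  have hd := fun y => (hasDerivAt_mul_phi_mul
    (hasDerivAt_even_poly (1 / 3) (1 / 15) (1 / 105) (1 / 945) (1 / 10395) (1 / 101400) y)).sub
    (hasDerivAt_gint y)
  have h := monotoneOn_of_deriv_nonneg (convex_Icc 0 x)
    (fun y _ => (hd y).continuousAt.continuousWithinAt)
    (fun y _ => (hd y).differentiableAt.differentiableWithinAt) (fun y hy => by
      rw [(hd y).deriv]
      rw [interior_Icc] at hy
      have := phi_pos y
      have h2 : y ^ 2 ≤ 81 / 25 := by nlinarith [hy.1, hy.2]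
      have h12 : 0 ≤ y ^ 12 := by positivity
      have : 0 ≤ phi y * (y ^ 12 * (1 / 101400 * (13 - y ^ 2) - 1 / 10395)) := by
        have : (0 : ℝ) ≤ 1 / 101400 * (13 - y ^ 2) - 1 / 10395 := by linarith
        positivity
      nlinarith) (Set.left_mem_Icc.2 hx) (Set.right_mem_Icc.2 hx) hx
  simp only [Pi.sub_apply, gint_zero, zero_mul, sub_zero] at h
  linarith

/-- The function `κ ↦ -log p(κ) - c (κ p'(κ) / p(κ))²`. -/
def slopeGap (c x : ℝ) : ℝ := -Real.log (2 * gint x) - c * (x * phi x / gint x) ^ 2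

lemma hasDerivAt_slopeGap (c : ℝ) {x : ℝ} (hx : 0 < x) :
    HasDerivAt (slopeGap c) (phi x / gint x * (x * phi x / gint x) ^ 2 *
      (2 * c * ((x ^ 2 - 1) * (gint x / (x * phi x)) + 1) - (gint x / (x * phi x)) ^ 2)) x := by
  have hg := gint_pos hx
  have hp := phi_pos x
  have h1 := ((hasDerivAt_gint x).const_mul 2).log (by positivity)
  have h2 := (((hasDerivAt_id x).mul (hasDerivAt_phi x)).div (hasDerivAt_gint x) hg.ne').pow 2
  refine (h1.neg.sub (h2.const_mul c)).congr_deriv ?_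
  simp
  field_simp
  ring

lemma pow_le_of_le {w b : ℝ} (hw : 0 ≤ w) (hb : w ≤ b) (n : ℕ) : w ^ (n + 1) ≤ b ^ n * w := by
  rw [pow_succ]
  gcongr

/-- Here `u` stands for `x²`, and `13863/10000` exceeds `2 log 2`. The inequality is nearly tight at
the right end, so it is recentred there; higher powers are then dropped or compared with the linear
term. -/
lemma slope_poly_left {u : ℝ} (h0 : 0 ≤ u) (h1 : u ≤ 188 / 100) :
    13863 / 10000 * ((u - 1) * (1 + u / 3 + u ^ 2 / 15 + u ^ 3 / 105 + u ^ 4 / 945) + 1) ≤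
      (1 + u / 3 + u ^ 2 / 15 + u ^ 3 / 105 + u ^ 4 / 945) ^ 2 := by
  obtain ⟨v, rfl⟩ : ∃ v, u = 188 / 100 - v := ⟨188 / 100 - u, by ring⟩
  have hv0 : 0 ≤ v := by linarith
  have hv1 : v ≤ 188 / 100 := by linarith
  have h2 := pow_le_of_le hv0 hv1 1
  have h3 := pow_le_of_le hv0 hv1 2
  have h5 := pow_le_of_le hv0 hv1 4
  have h7 := pow_le_of_le hv0 hv1 6
  have h4 : 0 ≤ v ^ 4 := by positivity
  have h6 : 0 ≤ v ^ 6 := by positivity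
  have h8 : 0 ≤ v ^ 8 := by positivity
  norm_num at h2 h3 h5 h7
  nlinarith only [h2, h3, h5, h7, h4, h6, h8, hv0]

/-- The reverse inequality with `14/10 = 2 · 7/10`, recentred at the left end of its range. -/
lemma slope_poly_right {u : ℝ} (h0 : 187 / 100 ≤ u) (h1 : u ≤ 81 / 25) :
    (1 + u / 3 + u ^ 2 / 15 + u ^ 3 / 105 + u ^ 4 / 945 + u ^ 5 / 10395 + u ^ 6 / 101400) ^ 2 ≤
    14 / 10 * ((u - 1) * (1 + u / 3 + u ^ 2 / 15 + u ^ 3 / 105 + u ^ 4 / 945 + u ^ 5 / 10395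
      + u ^ 6 / 101400) + 1) := by
  obtain ⟨w, rfl⟩ : ∃ w, u = 187 / 100 + w := ⟨u - 187 / 100, by ring⟩
  have hv0 : 0 ≤ w := by linarith
  have hv1 : w ≤ 137 / 100 := by linarith
  have h2 : 0 ≤ w ^ 2 := by positivity
  have h3 := pow_le_of_le hv0 hv1 2
  have h4 := pow_le_of_le hv0 hv1 3
  have h5 := pow_le_of_le hv0 hv1 4
  have h6 := pow_le_of_le hv0 hv1 5
  have h7 := pow_le_of_le hv0 hv1 6
  have h8 := pow_le_of_le hv0 hv1 7
  have h9 := pow_le_of_le hv0 hv1 8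
  have h10 := pow_le_of_le hv0 hv1 9
  have h11 := pow_le_of_le hv0 hv1 10
  have h12 := pow_le_of_le hv0 hv1 11
  norm_num at h3 h4 h5 h6 h7 h8 h9 h10 h11 h12
  nlinarith only [h2, h3, h4, h5, h6, h7, h8, h9, h10, h11, h12, hv0]

end SlopeInequality

/-- This is the sign-carrying factor of the derivative of `slopeGap (log 2)`. As a quadratic in `E =
gint x / (x φ(x)) ≥ 1` it is decreasing in this range of `x`, so the polynomial lower bound on `E`
suffices. -/
lemma slopeGap_deriv_nonpos {x : ℝ} (hx : 0 < x) (hx' : x ^ 2 ≤ 188 / 100) :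
    2 * Real.log 2 * ((x ^ 2 - 1) * (gint x / (x * phi x)) + 1) - (gint x / (x * phi x)) ^ 2
      ≤ 0 := by
  have hp := phi_pos x
  have hE := mul_phi_le_gint hx.le
  rw [mul_comm, ← le_div_iff₀ (by positivity)] at hE
  set E := gint x / (x * phi x) with hEdef
  have hq := slope_poly_left (sq_nonneg x) hx'
  set u := x ^ 2 with hu
  have hu0 : 0 ≤ u := sq_nonneg x
  set e := 1 + u / 3 + u ^ 2 / 15 + u ^ 3 / 105 + u ^ 4 / 945 with he
  have hEe : e ≤ E := by
    refine le_trans ?_ hE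
    have : 0 ≤ u ^ 5 := by positivity
    have h5 : x ^ 10 = u ^ 5 := by rw [hu]; ring
    have h4 : x ^ 8 = u ^ 4 := by rw [hu]; ring
    have h3 : x ^ 6 = u ^ 3 := by rw [hu]; ring
    have h2 : x ^ 4 = u ^ 2 := by rw [hu]; ring
    rw [h5, h4, h3, h2, he]
    linarith
  have hl1 := Real.log_two_lt_d9
  have hl0 := Real.log_two_gt_d9
  have hepos : 0 ≤ (u - 1) * e + 1 := by
    have : (u - 1) * e + 1 = 2 / 3 * u + 4 / 15 * u ^ 2 + 2 / 35 * u ^ 3 + 8 / 945 * u ^ 4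
      + u ^ 5 / 945 := by rw [he]; ring
    rw [this]; positivity
  have he1 : 1 ≤ e := by
    rw [he]
    have : 0 ≤ u / 3 + u ^ 2 / 15 + u ^ 3 / 105 + u ^ 4 / 945 := by positivity
    linarith
  have h1 : 2 * Real.log 2 * ((u - 1) * e + 1) ≤ e ^ 2 :=
    le_trans (mul_le_mul_of_nonneg_right (by linarith) hepos) hq
  have h2 : 0 ≤ E + e - 2 * Real.log 2 * (u - 1) := by
    have : 2 * Real.log 2 * (u - 1) ≤ 2 := by nlinarith
    linarith
  nlinarith [mul_nonneg (sub_nonneg.2 hEe) h2]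

/-- Equivalent to `E (E - (14/10)(x² - 1)) ≤ 14/10`. The product is either nonpositive or increasing
in `E`, so an upper bound on `E` suffices. -/
lemma slopeGap_deriv_nonneg {x : ℝ} (hx : 0 < x) (hx0 : 187 / 100 ≤ x ^ 2)
    (hx' : x ^ 2 ≤ 81 / 25) :
    0 ≤ 2 * (7 / 10) * ((x ^ 2 - 1) * (gint x / (x * phi x)) + 1)
      - (gint x / (x * phi x)) ^ 2 := by
  have hp := phi_pos x
  have hE := gint_le_mul_phi hx.le hx'
  rw [mul_comm, ← div_le_iff₀ (by positivity)] at hE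
  have hE0 : 0 < gint x / (x * phi x) := div_pos (gint_pos hx) (by positivity)
  set E := gint x / (x * phi x) with hEdef
  have hq := slope_poly_right hx0 hx'
  set u := x ^ 2 with hu
  set e := 1 + u / 3 + u ^ 2 / 15 + u ^ 3 / 105 + u ^ 4 / 945 + u ^ 5 / 10395
    + u ^ 6 / 101400 with he
  have hEe : E ≤ e := by
    refine le_trans hE (le_of_eq ?_)
    rw [he, hu]
    ring
  have h1 : E * (E - 14 / 10 * (u - 1)) ≤ 14 / 10 := by
    rcases le_or_gt (E - 14 / 10 * (u - 1)) 0 with h | h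
    · nlinarith
    · calc _ ≤ e * (e - 14 / 10 * (u - 1)) := by gcongr
        _ ≤ 14 / 10 := by nlinarith
  nlinarith

lemma sqrt_two_pi_bounds : 25066 / 10000 ≤ √(2 * Real.pi) ∧ √(2 * Real.pi) ≤ 25067 / 10000 := by
  have h1 := Real.pi_gt_d6
  have h2 := Real.pi_lt_d6
  constructor
  · apply Real.le_sqrt_of_sq_le
    norm_num at h1 ⊢
    linarith
  · apply Real.sqrt_le_iff.2
    norm_num at h2 ⊢
    linarith

/-- The junction of the two monotone ranges: `1.37² = 1.8769` lies in both. Since `7/10 > log 2`,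
nonnegativity here also gives nonnegativity of the gap with constant `log 2`. -/
lemma slopeGap_center : 0 ≤ slopeGap (7 / 10) (137 / 100) := by
  have hp := phi_pos (137 / 100)
  have hg := gint_pos (κ := 137 / 100) (by norm_num)
  have h1 := mul_phi_le_gint (x := 137 / 100) (by norm_num)
  have h2 := gint_le_mul_phi (x := 137 / 100) (by norm_num) (by norm_num)
  obtain ⟨hs1, hs2⟩ := sqrt_two_pi_bounds
  have hsl : (137 / 100 * phi (137 / 100) / gint (137 / 100)) ≤ 1000 / 1938 := by
    rw [div_le_div_iff₀ hg (by norm_num)]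
    norm_num at h1
    linarith
  have hsl0 : 0 ≤ (137 / 100 * phi (137 / 100) / gint (137 / 100)) := by positivity
  have hsq : (137 / 100 * phi (137 / 100) / gint (137 / 100)) ^ 2 ≤ (1000 / 1938) ^ 2 := by
    gcongr
  -- `0.18638` lies just above `0.7 · (1000/1938)²`. It equals `0.93845 - 0.75207` with `0.93845 =
  -- 1.37²/2`, so only `exp 0.75207` has to be estimated.
  have hlog : Real.log (2 * gint (137 / 100)) ≤ -(18638 / 100000) := by
    rw [Real.log_le_iff_le_exp (by positivity)]
    have hφ : phi (137 / 100) = (√(2 * Real.pi))⁻¹ * Real.exp (-(93845 / 100000)) := by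
      rw [phi]; norm_num
    have hexp := Real.sum_le_exp_of_nonneg (x := 75207 / 100000) (by norm_num) 8
    norm_num [Finset.sum_range_succ, Nat.factorial] at hexp
    have hinv : (√(2 * Real.pi))⁻¹ ≤ (25066 / 10000)⁻¹ := by gcongr
    have he : Real.exp (-(18638 / 100000)) =
        Real.exp (-(93845 / 100000)) * Real.exp (75207 / 100000) := by
      rw [← Real.exp_add]; norm_num
    have hep := Real.exp_pos (-(93845 / 100000))
    rw [he]
    calc 2 * gint (137 / 100) ≤ 5314 / 1000 * phi (137 / 100) := by
          norm_num at h2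
          nlinarith
      _ = Real.exp (-(93845 / 100000)) * (5314 / 1000 * (√(2 * Real.pi))⁻¹) := by rw [hφ]; ring
      _ ≤ _ := by
          gcongr
          norm_num at hinv ⊢
          linarith
  rw [slopeGap]
  norm_num at hsq ⊢
  linarith

/-- A Mills ratio bound: `gint y + y φ(y)/(y² + 1)` is increasing, and at `b` it exceeds `1/2` by at
most `1/b`, so it never exceeds `1/2`. -/
lemma mul_phi_div_le_one_sub {x : ℝ} (hx : 0 < x) :
    2 * (x * phi x / (x ^ 2 + 1)) ≤ 1 - 2 * gint x := by
  have hd : ∀ y, HasDerivAt (fun y => gint y + y * phi y / (y ^ 2 + 1))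
      (2 * phi y / (y ^ 2 + 1) ^ 2) y := by
    intro y
    have h0 : y ^ 2 + 1 ≠ 0 := by positivity
    refine ((hasDerivAt_gint y).add (((hasDerivAt_id y).mul (hasDerivAt_phi y)).div
      ((hasDerivAt_pow 2 y).add_const 1) h0)).congr_deriv ?_
    simp
    field_simp
    ring
  have hmono := monotone_of_hasDerivAt_nonneg hd fun y => by
    have := phi_pos y
    simp only [Pi.zero_apply]
    positivity
  have hb : ∀ b, x < b → x * phi x / (x ^ 2 + 1) + gint x - 1 / 2 ≤ b⁻¹ := by
    intro b hb
    have hb0 : 0 < b := hx.trans hb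
    have h1 := hmono hb.le
    have h2 : 2 * gint b ≤ 1 := by
      rw [← p_eq_gint hb0.le]
      exact measureReal_le_one
    have h3 : b * phi b / (b ^ 2 + 1) ≤ b⁻¹ := by
      rw [div_le_iff₀ (by positivity), inv_mul_eq_div, le_div_iff₀ hb0]
      nlinarith [phi_le_one b, sq_nonneg b, phi_pos b]
    simp only at h1
    linarith
  have := ge_of_tendsto tendsto_inv_atTop_zero ((eventually_gt_atTop x).mono hb)
  linarith

lemma exp_162_le : Real.exp (162 / 100) ≤ 51 / 10 := by
  have h1 := Real.exp_one_lt_d9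
  have h2 := Real.exp_bound' (x := 62 / 100) (by norm_num) (by norm_num) (n := 5) (by norm_num)
  norm_num [Finset.sum_range_succ, Nat.factorial] at h2
  rw [show (162 / 100 : ℝ) = 1 + 31 / 50 by norm_num, Real.exp_add]
  have := Real.exp_pos 1
  calc _ ≤ 2.7182818286 * _ := mul_le_mul h1.le h2 (Real.exp_pos _).le (by norm_num)
    _ ≤ _ := by norm_num

/-- By `-log p ≥ 1 - p` and the Mills bound it suffices that `2 log 2 · x φ(x)(x² + 1) ≤ 4 (gint
x)²`. Beyond `9/5` the left side decreases and the right side increases, so only `x = 9/5` is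
computed. -/
lemma log_two_mul_slope_sq_le_tail {x : ℝ} (hx : 9 / 5 ≤ x) :
    Real.log 2 * (x * phi x / gint x) ^ 2 ≤ -Real.log (2 * gint x) := by
  have hx0 : 0 < x := by linarith
  have hg := gint_pos hx0
  have hp := phi_pos x
  have hp0 := phi_pos (9 / 5)
  have hmills := mul_phi_div_le_one_sub hx0
  have hlog := Real.log_le_sub_one_of_pos (x := 2 * gint x) (by positivity)
  have hl2 := Real.log_two_lt_d9
  have hgm : gint (9 / 5) ≤ gint x := monotone_gint hx
  have hlow := mul_phi_le_gint (x := 9 / 5) (by norm_num)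
  have hφ : 771 / 10000 ≤ phi (9 / 5) := by
    have h1 : phi (9 / 5) = (√(2 * Real.pi) * Real.exp (162 / 100))⁻¹ := by
      rw [phi, mul_inv, ← Real.exp_neg]; norm_num
    rw [h1, le_inv_comm₀ (by norm_num) (by positivity)]
    calc _ ≤ 25067 / 10000 * (51 / 10) :=
          mul_le_mul sqrt_two_pi_bounds.2 exp_162_le (Real.exp_pos _).le (by norm_num)
      _ ≤ _ := by norm_num
  have hd : ∀ y, HasDerivAt (fun y : ℝ => y * phi y * (y ^ 2 + 1))
      (phi y * (1 + 2 * y ^ 2 - y ^ 4)) y := by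
    intro y
    refine (hasDerivAt_mul_phi_mul ((hasDerivAt_pow 2 y).add_const 1)).congr_deriv ?_
    simp only [Nat.cast_ofNat, Nat.add_one_sub_one, pow_one]
    ring
  have hanti := antitoneOn_of_deriv_nonpos (convex_Icc (9 / 5) x)
    (fun y _ => (hd y).continuousAt.continuousWithinAt)
    (fun y _ => (hd y).differentiableAt.differentiableWithinAt) (fun y hy => by
      rw [(hd y).deriv]
      rw [interior_Icc] at hy
      have h2 : 81 / 25 ≤ y ^ 2 := by nlinarith [hy.1]
      refine mul_nonpos_of_nonneg_of_nonpos (phi_pos y).le ?_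
      nlinarith) (Set.left_mem_Icc.2 hx) (Set.right_mem_Icc.2 hx) hx
  simp only at hanti
  have key : 2 * Real.log 2 * (x * phi x * (x ^ 2 + 1)) ≤ 4 * gint x ^ 2 := by
    norm_num at hlow hanti
    have h1 : 2929 / 1000 * (2 * phi (9 / 5)) ≤ gint (9 / 5) := by linarith
    have h2 : (2929 / 1000 * (2 * phi (9 / 5))) ^ 2 ≤ gint x ^ 2 := by
      have := h1.trans hgm
      gcongr
    have h3 : 0 ≤ x * phi x * (x ^ 2 + 1) := by positivity
    calc _ ≤ 13863 / 10000 * (9 / 5 * phi (9 / 5) * (106 / 25)) := by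
          refine mul_le_mul (by linarith) (by linarith) h3 (by norm_num)
      _ ≤ _ := by nlinarith
  have hfin : Real.log 2 * (x * phi x / gint x) ^ 2 ≤ 2 * (x * phi x / (x ^ 2 + 1)) := by
    rw [div_pow, mul_div_assoc', mul_div_assoc', div_le_div_iff₀ (by positivity) (by positivity)]
    have := mul_le_mul_of_nonneg_left key (mul_pos hx0 hp).le
    nlinarith
  linarith

/-- The logarithmic slope `κ p'(κ) / p(κ)` is controlled by `log p(κ)`. -/
lemma log_two_mul_slope_sq_le {x : ℝ} (hx : 0 < x) :
    Real.log 2 * (x * phi x / gint x) ^ 2 ≤ -Real.log (2 * gint x) := by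
  have hl2 := Real.log_two_lt_d9
  have hcenter := slopeGap_center
  -- The gap for `log 2` decreases up to `137/100`, the gap for `7/10` increases from there to
  -- `9/5`, and both are nonnegative at the junction; the rest is the tail.
  rcases le_or_gt x (137 / 100) with h1 | h1
  · have hpos : ∀ y ∈ Set.Icc x (137 / 100), 0 < y := fun y hy => hx.trans_le hy.1
    have hanti := antitoneOn_of_deriv_nonpos (f := slopeGap (Real.log 2))
      (convex_Icc x (137 / 100))
      (fun y hy => (hasDerivAt_slopeGap _ (hpos y hy)).continuousAt.continuousWithinAt)
      (fun y hy => (hasDerivAt_slopeGap _ (hpos y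
        (interior_subset hy))).differentiableAt.differentiableWithinAt) (fun y hy => by
        have hy' := interior_subset hy
        have h0 := hpos y hy'
        rw [(hasDerivAt_slopeGap _ h0).deriv]
        have := phi_pos y
        have := gint_pos h0
        exact mul_nonpos_of_nonneg_of_nonpos (by positivity)
          (slopeGap_deriv_nonpos h0 (by nlinarith [hy'.2])))
      (Set.left_mem_Icc.2 h1) (Set.right_mem_Icc.2 h1) h1
    simp only [slopeGap] at hanti hcenter
    have := mul_le_mul_of_nonneg_right (show Real.log 2 ≤ 7 / 10 by linarith)
      (sq_nonneg (137 / 100 * phi (137 / 100) / gint (137 / 100)))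
    linarith
  rcases le_or_gt x (9 / 5) with h2 | h2
  · have hpos : ∀ y ∈ Set.Icc (137 / 100) x, 0 < y := fun y hy =>
      lt_of_lt_of_le (by norm_num) hy.1
    have hmono := monotoneOn_of_deriv_nonneg (f := slopeGap (7 / 10))
      (convex_Icc (137 / 100) x)
      (fun y hy => (hasDerivAt_slopeGap _ (hpos y hy)).continuousAt.continuousWithinAt)
      (fun y hy => (hasDerivAt_slopeGap _ (hpos y
        (interior_subset hy))).differentiableAt.differentiableWithinAt) (fun y hy => by
        have hy' := interior_subset hy
        have h0 := hpos y hy'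
        rw [(hasDerivAt_slopeGap _ h0).deriv]
        have := phi_pos y
        have := gint_pos h0
        exact mul_nonneg (by positivity)
          (slopeGap_deriv_nonneg h0 (by nlinarith [hy'.1]) (by nlinarith [hy'.2])))
      (Set.left_mem_Icc.2 h1.le) (Set.right_mem_Icc.2 h1.le) h1.le
    simp only [slopeGap] at hmono hcenter
    have := mul_le_mul_of_nonneg_right (show Real.log 2 ≤ 7 / 10 by linarith)
      (sq_nonneg (x * phi x / gint x))
    linarith
  · exact log_two_mul_slope_sq_le_tail h2.le

/-! ### The function `F` and its maximum at `1/2` -/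

lemma p_pos {κ : ℝ} (hκ : 0 < κ) : 0 < p κ := by
  rw [p_eq_gint hκ.le]
  have := gint_pos hκ
  positivity

lemma p_le_one (κ : ℝ) : p κ ≤ 1 := measureReal_le_one

lemma qDer_nonneg (κ : ℝ) {ρ : ℝ} (h0 : 0 ≤ ρ) (h1 : ρ < 1) : 0 ≤ qDer κ ρ := by
  unfold qDer
  have hpi := Real.pi_pos
  refine mul_nonneg (by positivity) (sub_nonneg.2 (Real.exp_le_exp.2 ?_))
  rw [neg_div, neg_div, neg_le_neg_iff]
  exact div_le_div_of_nonneg_left (sq_nonneg κ) (by linarith) (by linarith)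

lemma qDer_le (κ : ℝ) {ρ : ℝ} (h0 : 0 ≤ ρ) (h1 : ρ ≤ 1 / 2) : qDer κ ρ ≤ 2 * κ ^ 2 * ρ := by
  have hpi := Real.pi_gt_three
  set a := -κ ^ 2 / (1 + ρ) with ha
  set b := -κ ^ 2 / (1 - ρ) with hb
  have hab : a - b ≤ 8 / 3 * κ ^ 2 * ρ := by
    have h1' : (0 : ℝ) < 1 - ρ := by linarith
    have h2' : (0 : ℝ) < 1 + ρ := by linarith
    have : a - b = κ ^ 2 * ρ * (2 / (1 - ρ ^ 2)) := by
      rw [ha, hb, show (1 : ℝ) - ρ ^ 2 = (1 - ρ) * (1 + ρ) by ring]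
      field_simp
      ring
    rw [this]
    have : 2 / (1 - ρ ^ 2) ≤ 8 / 3 := by
      rw [div_le_div_iff₀ (by nlinarith) (by norm_num)]
      nlinarith
    calc _ ≤ κ ^ 2 * ρ * (8 / 3) := by gcongr
      _ = _ := by ring
  have ha0 : a ≤ 0 := div_nonpos_of_nonpos_of_nonneg (by nlinarith [sq_nonneg κ]) (by linarith)
  have hexp : Real.exp a - Real.exp b ≤ 8 / 3 * κ ^ 2 * ρ := by
    have h2 : Real.exp b = Real.exp a * Real.exp (b - a) := by rw [← Real.exp_add]; ring_nf
    have h3 := Real.add_one_le_exp (b - a)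
    have h4 := Real.exp_le_one_iff.2 ha0
    have h5 := Real.exp_pos a
    have h6 : Real.exp a - Real.exp b ≤ Real.exp a * (a - b) := by rw [h2]; nlinarith
    have h7 : 0 ≤ 8 / 3 * κ ^ 2 * ρ := by positivity
    calc _ ≤ _ := h6
      _ ≤ Real.exp a * (8 / 3 * κ ^ 2 * ρ) := by gcongr
      _ ≤ _ := mul_le_of_le_one_left h7 h4
  have hs : 1 / 2 ≤ √(1 - ρ ^ 2) := Real.le_sqrt_of_sq_le (by nlinarith)
  have hinv : (Real.pi * √(1 - ρ ^ 2))⁻¹ ≤ 3 / 4 := by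
    rw [inv_le_comm₀ (by positivity) (by norm_num)]
    nlinarith
  unfold qDer
  calc _ ≤ (Real.pi * √(1 - ρ ^ 2))⁻¹ * (8 / 3 * κ ^ 2 * ρ) := by gcongr
    _ ≤ 3 / 4 * (8 / 3 * κ ^ 2 * ρ) := by gcongr
    _ = _ := by ring

lemma sq_p_le_qInt {κ ρ : ℝ} (hκ : 0 < κ) (h0 : 0 ≤ ρ) (h1 : ρ < 1) : p κ ^ 2 ≤ qInt κ ρ := by
  have hlt : ∀ y ∈ Set.Icc 0 ρ, y ^ 2 < 1 := fun y hy => by nlinarith [hy.1, hy.2]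
  rw [← qInt_zero hκ.le]
  exact monotoneOn_of_deriv_nonneg (convex_Icc 0 ρ)
    (fun y hy => (hasDerivAt_qInt hκ.le (hlt y hy)).continuousAt.continuousWithinAt)
    (fun y hy => (hasDerivAt_qInt hκ.le
      (hlt y (interior_subset hy))).differentiableAt.differentiableWithinAt)
    (fun y hy => by
      have hy' := interior_subset hy
      rw [(hasDerivAt_qInt hκ.le (hlt y hy')).deriv]
      exact qDer_nonneg κ hy'.1 (hy'.2.trans_lt h1))
    (Set.left_mem_Icc.2 h0) (Set.right_mem_Icc.2 h0) h0

lemma qInt_le {κ ρ : ℝ} (hκ : 0 < κ) (h0 : 0 ≤ ρ) (h1 : ρ ≤ 1 / 2) :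
    qInt κ ρ ≤ p κ ^ 2 + κ ^ 2 * ρ ^ 2 := by
  have hlt : ∀ y ∈ Set.Icc 0 ρ, y ^ 2 < 1 := fun y hy => by nlinarith [hy.1, hy.2]
  have hd : ∀ y ∈ Set.Icc 0 ρ, HasDerivAt (fun y => κ ^ 2 * y ^ 2 - qInt κ y)
      (2 * κ ^ 2 * y - qDer κ y) y := fun y hy =>
    (((hasDerivAt_pow 2 y).const_mul (κ ^ 2)).sub (hasDerivAt_qInt hκ.le (hlt y hy))).congr_deriv
      (by simp; ring)
  have := monotoneOn_of_deriv_nonneg (convex_Icc 0 ρ)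
    (fun y hy => (hd y hy).continuousAt.continuousWithinAt)
    (fun y hy => (hd y (interior_subset hy)).differentiableAt.differentiableWithinAt)
    (fun y hy => by
      have hy' := interior_subset hy
      rw [(hd y hy').deriv]
      exact sub_nonneg.2 (qDer_le κ hy'.1 (hy'.2.trans h1)))
    (Set.left_mem_Icc.2 h0) (Set.right_mem_Icc.2 h0) h0
  simp only [qInt_zero hκ.le] at this
  linarith

lemma q_eq_qInt' {κ β : ℝ} (hκ : 0 < κ) (h0 : 0 < β) (h1 : β < 1) : q κ β = qInt κ (2 * β - 1) := by
  rw [← q_eq_qInt hκ.le (by nlinarith)]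
  congr 1
  ring

lemma q_zero (κ : ℝ) : q κ 0 = p κ := by
  have h := q_eq_gaussian_prod (ρ := -1) (by norm_num) κ
  norm_num at h
  rw [h]
  have : {z : ℝ × ℝ | |z.1| ≤ κ} = {z : ℝ | |z| ≤ κ} ×ˢ Set.univ := by ext; simp
  rw [this, measureReal_prod_prod]
  simp [p]

lemma sq_p_le_q {κ β : ℝ} (hκ : 0 < κ) (h0 : 0 ≤ β) (h1 : β ≤ 1) : p κ ^ 2 ≤ q κ β := by
  have hp : p κ ^ 2 ≤ p κ := by nlinarith [p_pos hκ, p_le_one κ]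
  wlog h : 1 / 2 ≤ β generalizing β
  · rw [← q_one_sub κ β h0 h1]
    exact this (by linarith) (by linarith) (by linarith)
  rcases h1.eq_or_lt with rfl | h1
  · have := q_one_sub κ 1 zero_le_one le_rfl
    rw [sub_self, q_zero] at this
    rw [← this]
    exact hp
  rw [q_eq_qInt' hκ (by linarith) h1]
  exact sq_p_le_qInt hκ (by linarith) (by linarith)

lemma q_pos {κ β : ℝ} (hκ : 0 < κ) (h0 : 0 ≤ β) (h1 : β ≤ 1) : 0 < q κ β :=
  lt_of_lt_of_le (pow_pos (p_pos hκ) 2) (sq_p_le_q hκ h0 h1)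

/-- The pair correlation is quadratic in the overlap. -/
lemma q_le_sq_p_add {κ β : ℝ} (hκ : 0 < κ) (h0 : 0 ≤ β) (h1 : β ≤ 1) :
    q κ β ≤ p κ ^ 2 + (κ ^ 2 + 4) * (2 * β - 1) ^ 2 := by
  wlog h : 1 / 2 ≤ β generalizing β
  · rw [← q_one_sub κ β h0 h1]
    refine (this (by linarith) (by linarith) (by linarith)).trans (le_of_eq ?_)
    ring
  rcases le_or_gt (2 * β - 1) (1 / 2) with h2 | h2
  · rw [q_eq_qInt' hκ (by linarith) (by linarith)]
    have := qInt_le hκ (by linarith) h2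
    nlinarith [sq_nonneg (2 * β - 1)]
  -- Once `2β - 1 > 1/2`, the term `4 (2β - 1)²` alone exceeds `1`.
  · have h3 := q_le_p h0 h1 κ
    have h4 := p_le_one κ
    nlinarith [sq_nonneg (p κ), sq_nonneg κ, sq_nonneg (κ * (2 * β - 1))]

lemma q_half {κ : ℝ} (hκ : 0 < κ) : q κ (1 / 2) = p κ ^ 2 := by
  rw [q_eq_qInt' hκ (by norm_num) (by norm_num), ← qInt_zero hκ.le]
  norm_num

lemma hasDerivAt_q {κ β : ℝ} (hκ : 0 < κ) (h0 : 0 < β) (h1 : β < 1) :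
    HasDerivAt (q κ) (2 * qDer κ (2 * β - 1)) β := by
  have h := (hasDerivAt_qInt hκ.le (ρ := 2 * β - 1) (by nlinarith)).comp β
    (((hasDerivAt_id β).const_mul 2).sub_const 1)
  rw [mul_one, mul_comm] at h
  refine h.congr_of_eventuallyEq ?_
  filter_upwards [Ioo_mem_nhds h0 h1] with b hb
  exact q_eq_qInt' hκ hb.1 hb.2

/-- The derivative of `F`. -/
def FDer (κ α β : ℝ) : ℝ :=
  Real.log (1 - β) - Real.log β + α * (2 * qDer κ (2 * β - 1) / q κ β)

lemma hasDerivAt_F {κ β : ℝ} (α : ℝ) (hκ : 0 < κ) (h0 : 0 < β) (h1 : β < 1) :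
    HasDerivAt (F κ α) (FDer κ α β) β :=
  (Real.hasDerivAt_binEntropy h0.ne' h1.ne).add
    (((hasDerivAt_q hκ h0 h1).log (q_pos hκ h0.le h1.le).ne').const_mul α)

lemma hasDerivAt_qDer_zero (κ : ℝ) :
    HasDerivAt (qDer κ) (4 * κ ^ 2 * phi κ ^ 2) 0 := by
  have hpi := Real.pi_pos
  have h1 : HasDerivAt (fun ρ : ℝ => (Real.pi * √(1 - ρ ^ 2))⁻¹) 0 0 := by
    have := ((((hasDerivAt_pow 2 (0:ℝ)).const_sub 1).sqrt (by norm_num)).const_mul Real.pi).inv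
      (by simp [hpi.ne'])
    refine this.congr_deriv ?_
    simp
  have h2 : HasDerivAt (fun ρ : ℝ => Real.exp (-κ ^ 2 / (1 + ρ))) (Real.exp (-κ ^ 2) * κ ^ 2) 0 := by
    have := ((hasDerivAt_const (0:ℝ) (-κ ^ 2)).div ((hasDerivAt_id (0:ℝ)).const_add 1)
      (by norm_num)).exp
    refine this.congr_deriv ?_
    simp
  have h3 : HasDerivAt (fun ρ : ℝ => Real.exp (-κ ^ 2 / (1 - ρ)))
      (-(Real.exp (-κ ^ 2) * κ ^ 2)) 0 := by
    have := ((hasDerivAt_const (0:ℝ) (-κ ^ 2)).div ((hasDerivAt_id (0:ℝ)).const_sub 1)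
      (by norm_num)).exp
    refine this.congr_deriv ?_
    simp
  refine (h1.mul (h2.sub h3)).congr_deriv ?_
  rw [pow_two (phi κ), phi_mul_phi]
  simp only [ne_eq, OfNat.ofNat_ne_zero, not_false_eq_true, zero_pow, sub_zero, Real.sqrt_one,
    mul_one, zero_mul, zero_add, add_zero, Pi.sub_apply]
  rw [show -(κ ^ 2 + κ ^ 2) / 2 = -κ ^ 2 by ring]
  field_simp
  ring

lemma qDer_zero (κ : ℝ) : qDer κ 0 = 0 := by simp [qDer]

lemma FDer_half (κ α : ℝ) : FDer κ α (1 / 2) = 0 := by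
  rw [FDer]
  norm_num [qDer_zero]

lemma hasDerivAt_FDer_half {κ : ℝ} (α : ℝ) (hκ : 0 < κ) :
    HasDerivAt (FDer κ α) (-4 + α * (16 * κ ^ 2 * phi κ ^ 2 / p κ ^ 2)) (1 / 2) := by
  have hp := p_pos hκ
  have hq : HasDerivAt (fun β : ℝ => 2 * qDer κ (2 * β - 1)) (16 * κ ^ 2 * phi κ ^ 2) (1 / 2) := by
    have h0 : HasDerivAt (qDer κ) (4 * κ ^ 2 * phi κ ^ 2) (2 * (1 / 2) - 1) := by
      norm_num
      exact hasDerivAt_qDer_zero κ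
    refine ((h0.comp (1 / 2 : ℝ)
      (((hasDerivAt_id (1 / 2 : ℝ)).const_mul 2).sub_const 1)).const_mul 2).congr_deriv ?_
    ring
  have h := (((hasDerivAt_id (1 / 2 : ℝ)).const_sub 1).log (by norm_num)).sub
    (Real.hasDerivAt_log (x := (1 / 2 : ℝ)) (by norm_num))
  refine (h.add ((hq.div (hasDerivAt_q hκ (by norm_num) (by norm_num))
    (q_pos hκ (by norm_num) (by norm_num)).ne').const_mul α)).congr_deriv ?_
  rw [q_half hκ]
  norm_num [qDer_zero]
  field_simp
  left
  trivial

lemma p_lt_one {κ : ℝ} (hκ : 0 < κ) : p κ < 1 := by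
  have := mul_phi_div_le_one_sub hκ
  have hp := phi_pos κ
  have : 0 < 2 * (κ * phi κ / (κ ^ 2 + 1)) := by positivity
  rw [p_eq_gint hκ.le]
  linarith

lemma log_p_neg {κ : ℝ} (hκ : 0 < κ) : Real.log (p κ) < 0 := Real.log_neg (p_pos hκ) (p_lt_one hκ)

section

variable {κ α : ℝ}

lemma mul_neg_log_p_lt (hκ : 0 < κ) (hαc : α < alphaC κ) : α * -Real.log (p κ) < Real.log 2 := by
  have hl := log_p_neg hκ
  rw [alphaC, neg_div, ← div_neg, lt_div_iff₀ (by linarith)] at hαc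
  exact hαc

/-- With `s` the squared logarithmic slope of `p`, the quantity is `4 (α s - 1)`. Since `α (-log p)
< log 2`, the slope inequality forces `α s < 1`. -/
lemma hasDerivAt_FDer_half_neg (hκ : 0 < κ) (hα : 0 < α) (hαc : α < alphaC κ) :
    -4 + α * (16 * κ ^ 2 * phi κ ^ 2 / p κ ^ 2) < 0 := by
  have h1 := mul_neg_log_p_lt hκ hαc
  have h2 := log_two_mul_slope_sq_le hκ
  have hg := gint_pos hκ
  rw [p_eq_gint hκ.le] at h1 ⊢
  set s := (κ * phi κ / gint κ) ^ 2 with hs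
  have h3 : 16 * κ ^ 2 * phi κ ^ 2 / (2 * gint κ) ^ 2 = 4 * s := by
    rw [hs]; field_simp; ring
  rw [h3]
  have hl2 : 0 < Real.log 2 := Real.log_pos (by norm_num)
  have h4 : α * (Real.log 2 * s) < Real.log 2 := lt_of_le_of_lt (by gcongr) h1
  have h5 : Real.log 2 * (α * s) < Real.log 2 * 1 := by linarith
  have := lt_of_mul_lt_mul_left h5 hl2.le
  linarith

lemma iteratedDeriv_two_F_neg (hκ : 0 < κ) (hα : 0 < α) (hαc : α < alphaC κ) :
    iteratedDeriv 2 (F κ α) (1 / 2) < 0 := by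
  rw [iteratedDeriv_succ, iteratedDeriv_one]
  have : deriv (F κ α) =ᶠ[𝓝 (1 / 2)] FDer κ α := by
    filter_upwards [Ioo_mem_nhds (show (0 : ℝ) < 1 / 2 by norm_num)
      (show (1 / 2 : ℝ) < 1 by norm_num)] with b hb
    exact (hasDerivAt_F α hκ hb.1 hb.2).deriv
  rw [this.deriv_eq, (hasDerivAt_FDer_half α hκ).deriv]
  exact hasDerivAt_FDer_half_neg hκ hα hαc

lemma F_half (hκ : 0 < κ) : F κ α (1 / 2) = Real.log 2 + 2 * α * Real.log (p κ) := by
  rw [F, q_half hκ, Real.log_pow, one_div, Real.binEntropy_two_inv]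
  push_cast
  ring

lemma F_le (hκ : 0 < κ) (hα : 0 < α) {β : ℝ} (h0 : 0 ≤ β) (h1 : β ≤ 1) :
    F κ α β ≤ Real.binEntropy β + α * Real.log (p κ) := by
  rw [F]
  have := Real.log_le_log (q_pos hκ h0 h1) (q_le_p h0 h1 κ)
  gcongr

/-- Near `1/2` the function `F` lies below a downward parabola. -/
lemma exists_F_le_near_half (hκ : 0 < κ) (hα : 0 < α) (hαc : α < alphaC κ) :
    ∃ δ c : ℝ, 0 < δ ∧ δ < 1 / 2 ∧ 0 < c ∧ ∀ β ∈ Set.Icc (1 / 2 - δ) (1 / 2),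
      F κ α β ≤ F κ α (1 / 2) - c * (2 * β - 1) ^ 2 := by
  set d := -4 + α * (16 * κ ^ 2 * phi κ ^ 2 / p κ ^ 2) with hd
  have hneg : d < 0 := hasDerivAt_FDer_half_neg hκ hα hαc
  have hder : HasDerivAt (FDer κ α) d (1 / 2) := hasDerivAt_FDer_half α hκ
  have hlim := (hasDerivAt_iff_tendsto_slope.1 hder).eventually
    (eventually_lt_nhds (show d < d / 2 by linarith))
  rw [eventually_nhdsWithin_iff, Metric.eventually_nhds_iff] at hlim
  obtain ⟨ε, hε, hlim⟩ := hlim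
  set δ := min (ε / 2) (1 / 4) with hδ
  have hδ0 : 0 < δ := by positivity
  have hδ1 : δ ≤ 1 / 4 := min_le_right _ _
  have hδ2 : δ ≤ ε / 2 := min_le_left _ _
  refine ⟨δ, -d / 16, hδ0, by linarith, by linarith, fun β hβ => ?_⟩
  have hD : ∀ y ∈ Set.Icc β (1 / 2), HasDerivAt (fun y => F κ α y - d / 4 * (y - 1 / 2) ^ 2)
      (FDer κ α y - d / 2 * (y - 1 / 2)) y := fun y hy =>
    ((hasDerivAt_F α hκ (by linarith [hy.1, hβ.1]) (by linarith [hy.2])).sub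
      ((((hasDerivAt_id y).sub_const (1 / 2)).pow 2).const_mul (d / 4))).congr_deriv
      (by simp; ring)
  have := monotoneOn_of_deriv_nonneg (convex_Icc β (1 / 2))
    (fun y hy => (hD y hy).continuousAt.continuousWithinAt)
    (fun y hy => (hD y (interior_subset hy)).differentiableAt.differentiableWithinAt)
    (fun y hy => by
      rw [(hD y (interior_subset hy)).deriv]
      rw [interior_Icc] at hy
      have h1 := @hlim y (by
        rw [Real.dist_eq, abs_of_neg (by linarith [hy.2])]
        linarith [hy.1, hβ.1]) (by simpa using hy.2.ne)
      rw [slope_def_field, FDer_half, sub_zero, div_lt_iff_of_neg (by linarith [hy.2])] at h1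
      linarith)
    (Set.left_mem_Icc.2 hβ.2) (Set.right_mem_Icc.2 hβ.2) hβ.2
  simp only [sub_self] at this
  nlinarith

/-- `F` is at most the entropy plus `α log p`, and `α < α_c` says exactly that `α log p < log 2 + 2
α log p = F(1/2)`. Continuity of the entropy at `0` leaves a margin. -/
lemma eventually_F_lt (hκ : 0 < κ) (hα : 0 < α) (hαc : α < alphaC κ) :
    ∃ ε η : ℝ, 0 < ε ∧ 0 < η ∧ ∀ β ∈ Set.Icc 0 ε, β ≤ 1 → F κ α β ≤ F κ α (1 / 2) - η := by
  have h1 := mul_neg_log_p_lt hκ hαc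
  set η := (F κ α (1 / 2) - α * Real.log (p κ)) / 2 with hη
  have hη0 : 0 < η := by
    rw [hη, F_half hκ]
    linarith
  have hc : ∀ᶠ β in 𝓝 (0 : ℝ), Real.binEntropy β < η :=
    (Real.binEntropy_continuous.tendsto 0).eventually (gt_mem_nhds (by simpa using hη0))
  rw [Metric.eventually_nhds_iff] at hc
  obtain ⟨ε, hε, hc⟩ := hc
  refine ⟨ε / 2, η, by linarith, hη0, fun β hβ hβ1 => ?_⟩
  have h2 := @hc β (by rw [Real.dist_eq, sub_zero, abs_of_nonneg hβ.1]; linarith [hβ.2])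
  have h3 := F_le hκ hα hβ.1 hβ1
  linarith

/-- `F` lies below `F(1/2)` near `0` and just left of `1/2`. A point in between reaching `F(1/2)`
would force an interior minimum to its right and an interior maximum left of that minimum: two
critical points. -/
lemma F_lt_F_half (hκ : 0 < κ) (hα : 0 < α) (hαc : α < alphaC κ) (hF : SingleCriticalPoint κ α)
    {β : ℝ} (h0 : 0 < β) (h1 : β < 1 / 2) : F κ α β < F κ α (1 / 2) := by
  obtain ⟨z, -, hz⟩ := hF (iteratedDeriv_two_F_neg hκ hα hαc)
  obtain ⟨δ, c, hδ0, hδ1, hc, hδ⟩ := exists_F_le_near_half hκ hα hαc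
  obtain ⟨ε, η, hε0, hη, hε⟩ := eventually_F_lt hκ hα hαc
  have hcont : ContinuousOn (F κ α) (Set.Ioo 0 1) := fun y hy =>
    (hasDerivAt_F α hκ hy.1 hy.2).continuousAt.continuousWithinAt
  by_contra! hge
  have hnear : ∀ y, 1 / 2 - δ ≤ y → y < 1 / 2 → F κ α y < F κ α (1 / 2) := by
    intro y hy1 hy2
    have := hδ y ⟨hy1, hy2.le⟩
    have : 0 < c * (2 * y - 1) ^ 2 := mul_pos hc (sq_pos_of_neg (by linarith))
    linarith
  have hβδ : β < 1 / 2 - δ := by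
    by_contra! h
    exact absurd (hnear β h h1) (not_lt.2 hge)
  have hmid : F κ α (1 / 2 - δ) < F κ α (1 / 2) := hnear _ le_rfl (by linarith)
  obtain ⟨x, hx, hxmin⟩ := isCompact_Icc.exists_isMinOn (Set.nonempty_Icc.2 h1.le)
    (hcont.mono (show Set.Icc β (1 / 2) ⊆ Set.Ioo 0 1 from fun y hy =>
      ⟨h0.trans_le hy.1, by linarith [hy.2]⟩))
  have hxlt : F κ α x < F κ α (1 / 2) :=
    lt_of_le_of_lt (hxmin ⟨hβδ.le, by linarith⟩) hmid
  have hx1 : β < x := lt_of_le_of_ne hx.1 (by rintro rfl; linarith)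
  have hx2 : x < 1 / 2 := lt_of_le_of_ne hx.2 (by rintro rfl; exact lt_irrefl _ hxlt)
  have hxcrit : HasDerivAt (F κ α) 0 x := by
    have hd := hasDerivAt_F α hκ (h0.trans hx1) (by linarith : x < 1)
    rwa [(hxmin.isLocalMin (Icc_mem_nhds hx1 hx2)).hasDerivAt_eq_zero hd] at hd
  set e := min ε (β / 2) with he
  have he0 : 0 < e := by positivity
  have heβ : e < β := lt_of_le_of_lt (min_le_right _ _) (by linarith)
  have hFe : F κ α e < F κ α (1 / 2) := by
    have := hε e ⟨he0.le, min_le_left _ _⟩ (by linarith)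
    linarith
  obtain ⟨y, hy, hymax⟩ := isCompact_Icc.exists_isMaxOn
    (Set.nonempty_Icc.2 (heβ.trans hx1).le)
    (hcont.mono (show Set.Icc e x ⊆ Set.Ioo 0 1 from fun y hy =>
      ⟨he0.trans_le hy.1, by linarith [hy.2]⟩))
  have hyge : F κ α β ≤ F κ α y := hymax ⟨heβ.le, hx1.le⟩
  have hy1 : e < y := lt_of_le_of_ne hy.1 (by rintro rfl; linarith)
  have hy2 : y < x := lt_of_le_of_ne hy.2 (by rintro rfl; linarith)
  have hycrit : HasDerivAt (F κ α) 0 y := by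
    have hd := hasDerivAt_F α hκ (he0.trans hy1) (by linarith : y < 1)
    rwa [(hymax.isLocalMax (Icc_mem_nhds hy1 hy2)).hasDerivAt_eq_zero hd] at hd
  have hzx := hz x ⟨⟨h0.trans hx1, hx2⟩, hxcrit⟩
  have hzy := hz y ⟨⟨he0.trans hy1, hy2.trans hx2⟩, hycrit⟩
  linarith

lemma F_one_sub {β : ℝ} (h0 : 0 ≤ β) (h1 : β ≤ 1) : F κ α (1 - β) = F κ α β := by
  rw [F, F, Real.binEntropy_one_sub, q_one_sub κ β h0 h1]

/-- A parabola near `1/2`, compactness in the middle, and a uniform gap near `0`; since `(2β - 1)² ≤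
1`, constant gaps are quadratic ones. Symmetry gives the other half. -/
lemma exists_F_le (hκ : 0 < κ) (hα : 0 < α) (hαc : α < alphaC κ) (hF : SingleCriticalPoint κ α) :
    ∃ c : ℝ, 0 < c ∧ ∀ β, 0 ≤ β → β ≤ 1 → F κ α β ≤ F κ α (1 / 2) - c * (2 * β - 1) ^ 2 := by
  obtain ⟨δ, c, hδ0, hδ1, hc, hδ⟩ := exists_F_le_near_half hκ hα hαc
  obtain ⟨ε, η, hε0, hη, hε⟩ := eventually_F_lt hκ hα hαc
  set e := min ε (1 / 2 - δ) with he
  have he0 : 0 < e := lt_min hε0 (by linarith)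
  have he1 : e ≤ 1 / 2 - δ := min_le_right _ _
  have hcont : ContinuousOn (F κ α) (Set.Icc e (1 / 2 - δ)) := fun y hy =>
    (hasDerivAt_F α hκ (he0.trans_le hy.1) (by linarith [hy.2])).continuousAt.continuousWithinAt
  obtain ⟨y, hy, hymax⟩ := isCompact_Icc.exists_isMaxOn (Set.nonempty_Icc.2 he1) hcont
  have hgap := F_lt_F_half hκ hα hαc hF (he0.trans_le hy.1) (by linarith [hy.2])
  set g := F κ α (1 / 2) - F κ α y with hg
  have hg0 : 0 < g := sub_pos.2 hgap
  set C := min c (min η g) with hC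
  have hC0 : 0 < C := by positivity
  have hCc : C ≤ c := min_le_left _ _
  have hCη : C ≤ η := (min_le_right _ _).trans (min_le_left _ _)
  have hCg : C ≤ g := (min_le_right _ _).trans (min_le_right _ _)
  refine ⟨C, hC0, fun β h0 h1 => ?_⟩
  wlog h : β ≤ 1 / 2 generalizing β
  · rw [← F_one_sub h0 h1]
    refine (this (1 - β) (by linarith) (by linarith) (by linarith)).trans (le_of_eq ?_)
    ring
  have hsq : (2 * β - 1) ^ 2 ≤ 1 := by nlinarith
  have hsq0 := sq_nonneg (2 * β - 1)
  rcases le_or_gt (1 / 2 - δ) β with h2 | h2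
  · have := hδ β ⟨h2, h⟩
    nlinarith
  rcases le_or_gt e β with h3 | h3
  · have : F κ α β ≤ F κ α y := hymax ⟨h3, h2.le⟩
    nlinarith
  · have := hε β ⟨h0, h3.le.trans (min_le_left _ _)⟩ h1
    nlinarith

end

lemma binEntropy_le {β : ℝ} (h0 : 0 ≤ β) (h1 : β ≤ 1) :
    Real.binEntropy β ≤ Real.log 2 - 1 / 4 * (2 * β - 1) ^ 2 := by
  wlog h : β ≤ 1 / 2 generalizing β
  · rw [← Real.binEntropy_one_sub]
    refine (this (β := 1 - β) (by linarith) (by linarith) (by linarith)).trans (le_of_eq ?_)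
    ring
  have hD : ∀ y ∈ Set.Ioo β (1 / 2), HasDerivAt (fun y => Real.binEntropy y + (y - 1 / 2) ^ 2)
      (Real.log (1 - y) - Real.log y + 2 * (y - 1 / 2)) y := fun y hy =>
    ((Real.hasDerivAt_binEntropy (by linarith [hy.1]) (by linarith [hy.2])).add
      (((hasDerivAt_id y).sub_const (1 / 2)).pow 2)).congr_deriv (by simp)
  have := monotoneOn_of_deriv_nonneg (convex_Icc β (1 / 2))
    (f := fun y => Real.binEntropy y + (y - 1 / 2) ^ 2)
    (Continuous.continuousOn (by fun_prop))
    (fun y hy => by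
      rw [interior_Icc] at hy
      exact (hD y hy).differentiableAt.differentiableWithinAt)
    (fun y hy => by
      rw [interior_Icc] at hy
      rw [(hD y hy).deriv]
      have hy0 : 0 < y := h0.trans_lt hy.1
      have hy1 : 0 < 1 - y := by linarith [hy.2]
      rw [← Real.log_div hy1.ne' hy0.ne']
      have h3 := Real.one_sub_inv_le_log_of_pos (div_pos hy1 hy0)
      rw [inv_div] at h3
      have h4 : y / (1 - y) ≤ 2 * y := by
        rw [div_le_iff₀ hy1]
        nlinarith [hy.2]
      linarith)
    (Set.left_mem_Icc.2 h) (Set.right_mem_Icc.2 h) h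
  simp only [sub_self] at this
  rw [one_div, Real.binEntropy_two_inv] at this
  nlinarith

/-- The exponential rate of pairs of solutions with a given overlap, uniformly in the density. -/
lemma exists_pair_rate {κ α : ℝ} (hκ : 0 < κ) (hα : 0 < α) (hαc : α < alphaC κ)
    (hF : SingleCriticalPoint κ α) :
    ∃ c : ℝ, 0 < c ∧ ∀ β, 0 ≤ β → β ≤ 1 → ∀ t, 0 ≤ t → t ≤ α →
      Real.binEntropy β + t * (Real.log (q κ β) - 2 * Real.log (p κ)) + c * (2 * β - 1) ^ 2
        ≤ Real.log 2 := by
  obtain ⟨c, hc, h⟩ := exists_F_le hκ hα hαc hF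
  have hcm : 0 < min c (1 / 4) := by positivity
  refine ⟨min c (1 / 4), hcm, fun β h0 h1 t ht0 ht1 => ?_⟩
  have e0 := binEntropy_le h0 h1
  have e1 := h β h0 h1
  rw [F_half hκ, F] at e1
  have hsq := sq_nonneg (2 * β - 1)
  have m1 := mul_le_mul_of_nonneg_right (min_le_left c (1 / 4)) hsq
  have m2 := mul_le_mul_of_nonneg_right (min_le_right c (1 / 4)) hsq
  -- The bound is affine in `t`, so by the sign of the slope it reduces to `t = α`, the bound on
  -- `F`, or to `t = 0`, the bound on the entropy.
  rcases le_or_gt 0 (Real.log (q κ β) - 2 * Real.log (p κ)) with hs | hs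
  · have := mul_le_mul_of_nonneg_right ht1 hs
    linarith
  · have := mul_nonpos_of_nonneg_of_nonpos ht0 hs.le
    linarith

/-! ### Overlaps and the fraction of a set kept by one constraint -/

/-- A point of the cube, normalized to be a unit vector. -/
def unitVec {N : ℕ} (σ : Cube N) : EuclideanSpace ℝ (Fin N) := (√(N : ℝ))⁻¹ • toVec σ

/-- The overlap of two points of the cube. -/
def overlap {N : ℕ} (σ τ : Cube N) : ℝ := inner ℝ (unitVec σ) (unitVec τ)

/-- The law of one constraint vector. -/
abbrev gauss (N : ℕ) : Measure (EuclideanSpace ℝ (Fin N)) := stdGaussian (EuclideanSpace ℝ (Fin N))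

section

variable {N : ℕ}

lemma overlap_eq (σ τ : Cube N) :
    overlap σ τ = (∑ i, ((σ i : ℤ) : ℝ) * ((τ i : ℤ) : ℝ)) / N := by
  rw [overlap, unitVec, unitVec, inner_smul_left, inner_smul_right]
  simp only [toVec, PiLp.inner_apply, RCLike.inner_apply, conj_trivial]
  rw [← mul_assoc, ← mul_inv, Real.mul_self_sqrt (by positivity), inv_mul_eq_div]
  congr 1
  exact Finset.sum_congr rfl fun i _ => mul_comm _ _

lemma cast_units_sq (a : ℤˣ) : ((a : ℤ) : ℝ) * ((a : ℤ) : ℝ) = 1 := by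
  rcases Int.units_eq_one_or a with rfl | rfl <;> simp

lemma overlap_self (hN : N ≠ 0) (σ : Cube N) : overlap σ σ = 1 := by
  simp [overlap_eq, cast_units_sq, hN]

lemma norm_unitVec (hN : N ≠ 0) (σ : Cube N) : ‖unitVec σ‖ = 1 := by
  have h : ‖unitVec σ‖ ^ 2 = 1 := by
    rw [← real_inner_self_eq_norm_sq]
    exact overlap_self hN σ
  nlinarith [norm_nonneg (unitVec σ)]

lemma abs_overlap_le (hN : N ≠ 0) (σ τ : Cube N) : |overlap σ τ| ≤ 1 := by
  have := abs_real_inner_le_norm (unitVec σ) (unitVec τ)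
  rwa [norm_unitVec hN, norm_unitVec hN, mul_one] at this

lemma mem_slab_iff (hN : N ≠ 0) (κ : ℝ) (g : EuclideanSpace ℝ (Fin N)) (σ : Cube N) :
    σ ∈ slab κ g ↔ |inner ℝ g (unitVec σ)| ≤ κ := by
  have hs : 0 < √(N : ℝ) := Real.sqrt_pos.2 (by positivity)
  rw [slab, Set.mem_ofPred_eq, unitVec, inner_smul_right, abs_mul, abs_of_pos (inv_pos.2 hs),
    inv_mul_le_iff₀ hs, mul_comm]

lemma gauss_slab (hN : N ≠ 0) (κ : ℝ) (σ : Cube N) :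
    (gauss N).real {g | σ ∈ slab κ g} = p κ := by
  simp_rw [mem_slab_iff hN]
  exact (p_eq_stdGaussian (norm_unitVec hN σ) κ).symm

lemma gauss_slab_pair (hN : N ≠ 0) (κ : ℝ) (σ τ : Cube N) :
    (gauss N).real {g | σ ∈ slab κ g ∧ τ ∈ slab κ g} = q κ ((1 + overlap σ τ) / 2) := by
  simp_rw [mem_slab_iff hN]
  exact (q_eq_stdGaussian (norm_unitVec hN σ) (norm_unitVec hN τ) rfl κ).symm

lemma measurableSet_mem_slab (κ : ℝ) (σ : Cube N) : MeasurableSet {g | σ ∈ slab κ g} := by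
  have h : Measurable fun g : EuclideanSpace ℝ (Fin N) => |inner ℝ g (toVec σ)| := by fun_prop
  exact measurableSet_le h measurable_const

/-- The indicator of membership. -/
def ind (U : Set (Cube N)) (σ : Cube N) : ℝ := U.indicator 1 σ

lemma ind_nonneg (U : Set (Cube N)) (σ : Cube N) : 0 ≤ ind U σ :=
  Set.indicator_nonneg (fun _ _ => zero_le_one) σ

lemma ind_of_mem {U : Set (Cube N)} {σ : Cube N} (h : σ ∈ U) : ind U σ = 1 := by simp [ind, h]

lemma ind_inter (U V : Set (Cube N)) (σ : Cube N) : ind (U ∩ V) σ = ind U σ * ind V σ := by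
  by_cases h1 : σ ∈ U <;> by_cases h2 : σ ∈ V <;> simp [ind, h1, h2]

lemma measurable_ind_slab (κ : ℝ) (σ : Cube N) :
    Measurable fun g : EuclideanSpace ℝ (Fin N) => ind (slab κ g) σ := by
  have : (fun g : EuclideanSpace ℝ (Fin N) => ind (slab κ g) σ) =
      {g | σ ∈ slab κ g}.indicator 1 := by
    ext g
    by_cases h : σ ∈ slab κ g <;> simp [ind, h]
  rw [this]
  exact measurable_one.indicator (measurableSet_mem_slab κ σ)

lemma integral_ind_slab (hN : N ≠ 0) (κ : ℝ) (σ : Cube N) :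
    ∫ g, ind (slab κ g) σ ∂(gauss N) = p κ := by
  have : (fun g : EuclideanSpace ℝ (Fin N) => ind (slab κ g) σ) =
      {g | σ ∈ slab κ g}.indicator 1 := by
    ext g
    by_cases h : σ ∈ slab κ g <;> simp [ind, h]
  rw [this, integral_indicator_one (measurableSet_mem_slab κ σ), gauss_slab hN]

lemma integral_ind_slab_mul (hN : N ≠ 0) (κ : ℝ) (σ τ : Cube N) :
    ∫ g, ind (slab κ g) σ * ind (slab κ g) τ ∂(gauss N) = q κ ((1 + overlap σ τ) / 2) := by
  have : (fun g : EuclideanSpace ℝ (Fin N) => ind (slab κ g) σ * ind (slab κ g) τ) =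
      {g | σ ∈ slab κ g ∧ τ ∈ slab κ g}.indicator 1 := by
    ext g
    by_cases h : σ ∈ slab κ g <;> by_cases h' : τ ∈ slab κ g <;> simp [ind, h, h']
  have hm : MeasurableSet {g : EuclideanSpace ℝ (Fin N) | σ ∈ slab κ g ∧ τ ∈ slab κ g} :=
    (measurableSet_mem_slab κ σ).inter (measurableSet_mem_slab κ τ)
  rw [this, integral_indicator_one hm, gauss_slab_pair hN]

lemma ind_le_one (U : Set (Cube N)) (σ : Cube N) : ind U σ ≤ 1 := by
  by_cases h : σ ∈ U <;> simp [ind, h]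

lemma integrable_ind_slab (κ : ℝ) (σ : Cube N) :
    Integrable (fun g => ind (slab κ g) σ) (gauss N) :=
  Integrable.of_bound (measurable_ind_slab κ σ).aestronglyMeasurable 1 (ae_of_all _ fun g => by
    rw [Real.norm_eq_abs, abs_of_nonneg (ind_nonneg _ _)]
    exact ind_le_one _ _)

lemma integrable_ind_slab_mul (κ : ℝ) (σ τ : Cube N) :
    Integrable (fun g => ind (slab κ g) σ * ind (slab κ g) τ) (gauss N) :=
  Integrable.of_bound
    ((measurable_ind_slab κ σ).mul (measurable_ind_slab κ τ)).aestronglyMeasurable 1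
    (ae_of_all _ fun g => by
      rw [Real.norm_eq_abs, abs_of_nonneg (mul_nonneg (ind_nonneg _ _) (ind_nonneg _ _))]
      exact mul_le_one₀ (ind_le_one _ _) (ind_nonneg _ _) (ind_le_one _ _))

/-- The number of elements of a subset of the cube. -/
def cnt (U : Set (Cube N)) : ℝ := ∑ σ, ind U σ

lemma cnt_nonneg (U : Set (Cube N)) : 0 ≤ cnt U := Finset.sum_nonneg fun σ _ => ind_nonneg U σ

lemma one_le_cnt {U : Set (Cube N)} (h : U.Nonempty) : 1 ≤ cnt U := by
  obtain ⟨σ, hσ⟩ := h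
  rw [← ind_of_mem hσ]
  exact Finset.single_le_sum (fun τ _ => ind_nonneg U τ) (Finset.mem_univ σ)

lemma cnt_empty : cnt (∅ : Set (Cube N)) = 0 := by simp [cnt, ind]

lemma cnt_inter_le (U V : Set (Cube N)) : cnt (U ∩ V) ≤ cnt U :=
  Finset.sum_le_sum fun σ _ => by
    rw [ind_inter]
    exact mul_le_of_le_one_right (ind_nonneg _ _) (ind_le_one _ _)

/-- The Gibbs average over pairs of elements of `U`. -/
def pairAvg (U : Set (Cube N)) (f : Cube N → Cube N → ℝ) : ℝ :=
  (∑ σ, ∑ τ, ind U σ * ind U τ * f σ τ) / cnt U ^ 2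

lemma sum_ind_mul_ind (U : Set (Cube N)) : ∑ σ, ∑ τ, ind U σ * ind U τ = cnt U ^ 2 := by
  rw [cnt, sq, Finset.sum_mul_sum]

lemma pairAvg_mono {U : Set (Cube N)} {f g : Cube N → Cube N → ℝ} (h : ∀ σ τ, f σ τ ≤ g σ τ) :
    pairAvg U f ≤ pairAvg U g := by
  unfold pairAvg
  gcongr with σ _ τ _
  · exact mul_nonneg (ind_nonneg _ _) (ind_nonneg _ _)
  · exact h σ τ

lemma pairAvg_const {U : Set (Cube N)} (hU : U.Nonempty) (c : ℝ) : pairAvg U (fun _ _ => c) = c := by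
  have := one_le_cnt hU
  rw [pairAvg]
  simp_rw [← Finset.sum_mul]
  rw [sum_ind_mul_ind]
  field_simp

lemma pairAvg_const_mul (U : Set (Cube N)) (c : ℝ) (f : Cube N → Cube N → ℝ) :
    pairAvg U (fun σ τ => c * f σ τ) = c * pairAvg U f := by
  unfold pairAvg
  rw [← mul_div_assoc, Finset.mul_sum]
  congr 1
  refine Finset.sum_congr rfl fun σ _ => ?_
  rw [Finset.mul_sum]
  exact Finset.sum_congr rfl fun τ _ => by ring

lemma pairAvg_add (U : Set (Cube N)) (f g : Cube N → Cube N → ℝ) :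
    pairAvg U (fun σ τ => f σ τ + g σ τ) = pairAvg U f + pairAvg U g := by
  unfold pairAvg
  rw [← add_div]
  congr 1
  simp_rw [mul_add, Finset.sum_add_distrib]

lemma pairAvg_nonneg {U : Set (Cube N)} {f : Cube N → Cube N → ℝ} (h : ∀ σ τ, 0 ≤ f σ τ) :
    0 ≤ pairAvg U f := by
  unfold pairAvg
  have := fun σ τ => mul_nonneg (mul_nonneg (ind_nonneg U σ) (ind_nonneg U τ)) (h σ τ)
  exact div_nonneg (Finset.sum_nonneg fun σ _ => Finset.sum_nonneg fun τ _ => this σ τ)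
    (sq_nonneg _)

lemma exp_pairAvg_le {U : Set (Cube N)} (hU : U.Nonempty) (f : Cube N → Cube N → ℝ) :
    Real.exp (pairAvg U f) ≤ pairAvg U (fun σ τ => Real.exp (f σ τ)) := by
  set m := pairAvg U f with hm
  have h : ∀ σ τ, Real.exp m * (1 - m) + Real.exp m * f σ τ ≤ Real.exp (f σ τ) := by
    intro σ τ
    have := Real.add_one_le_exp (f σ τ - m)
    have h2 : Real.exp (f σ τ) = Real.exp m * Real.exp (f σ τ - m) := by
      rw [← Real.exp_add]; ring_nf
    rw [h2]
    nlinarith [Real.exp_pos m]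
  refine le_trans (le_of_eq ?_) (pairAvg_mono h)
  rw [pairAvg_add, pairAvg_const hU, pairAvg_const_mul, ← hm]
  ring

lemma sq_pairAvg_abs_le {U : Set (Cube N)} (hU : U.Nonempty) (f : Cube N → Cube N → ℝ) :
    pairAvg U (fun σ τ => |f σ τ|) ^ 2 ≤ pairAvg U (fun σ τ => f σ τ ^ 2) := by
  set m := pairAvg U (fun σ τ => |f σ τ|) with hm
  have h : ∀ σ τ, -m ^ 2 + 2 * m * |f σ τ| ≤ f σ τ ^ 2 := by
    intro σ τ
    nlinarith [sq_nonneg (|f σ τ| - m), sq_abs (f σ τ)]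
  refine le_trans (le_of_eq ?_) (pairAvg_mono h)
  rw [pairAvg_add, pairAvg_const hU, pairAvg_const_mul, ← hm]
  ring

/-- The fraction of `U` that satisfies the constraint `g`. -/
def frac (κ : ℝ) (U : Set (Cube N)) (g : EuclideanSpace ℝ (Fin N)) : ℝ :=
  cnt (U ∩ slab κ g) / cnt U

lemma frac_eq (κ : ℝ) (U : Set (Cube N)) (g : EuclideanSpace ℝ (Fin N)) :
    frac κ U g = ∑ σ, ind U σ / cnt U * ind (slab κ g) σ := by
  rw [frac, cnt, Finset.sum_div]
  exact Finset.sum_congr rfl fun σ _ => by rw [ind_inter]; ring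

lemma sum_ind_div_cnt {U : Set (Cube N)} (hU : U.Nonempty) : ∑ σ, ind U σ / cnt U = 1 := by
  have := one_le_cnt hU
  rw [← Finset.sum_div, ← cnt, div_self (by linarith)]

lemma measurable_frac (κ : ℝ) (U : Set (Cube N)) : Measurable (frac κ U) := by
  simp_rw [funext (frac_eq κ U)]
  exact Finset.measurable_sum _ fun σ _ => (measurable_ind_slab κ σ).const_mul _

lemma frac_nonneg (κ : ℝ) (U : Set (Cube N)) (g : EuclideanSpace ℝ (Fin N)) : 0 ≤ frac κ U g :=
  div_nonneg (cnt_nonneg _) (cnt_nonneg _)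

lemma frac_le_one (κ : ℝ) (U : Set (Cube N)) (g : EuclideanSpace ℝ (Fin N)) : frac κ U g ≤ 1 :=
  div_le_one_of_le₀ (cnt_inter_le _ _) (cnt_nonneg _)

lemma integrable_frac (κ : ℝ) (U : Set (Cube N)) : Integrable (frac κ U) (gauss N) :=
  Integrable.of_bound (measurable_frac κ U).aestronglyMeasurable 1 (ae_of_all _ fun g => by
    rw [Real.norm_eq_abs, abs_of_nonneg (frac_nonneg _ _ _)]
    exact frac_le_one _ _ _)

lemma integral_frac (hN : N ≠ 0) (κ : ℝ) {U : Set (Cube N)} (hU : U.Nonempty) :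
    ∫ g, frac κ U g ∂(gauss N) = p κ := by
  simp_rw [frac_eq κ U]
  rw [integral_finsetSum _ fun σ _ => (integrable_ind_slab κ σ).const_mul _]
  simp_rw [integral_const_mul, integral_ind_slab hN]
  rw [← Finset.sum_mul, sum_ind_div_cnt hU, one_mul]

lemma frac_sq_eq (κ : ℝ) (U : Set (Cube N)) (g : EuclideanSpace ℝ (Fin N)) :
    frac κ U g ^ 2 = pairAvg U fun σ τ => ind (slab κ g) σ * ind (slab κ g) τ := by
  rw [frac, div_pow, pairAvg]
  congr 1
  rw [cnt, sq, Finset.sum_mul_sum]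
  refine Finset.sum_congr rfl fun σ _ => Finset.sum_congr rfl fun τ _ => ?_
  rw [ind_inter, ind_inter]
  ring

lemma integral_frac_sq (hN : N ≠ 0) (κ : ℝ) (U : Set (Cube N)) :
    ∫ g, frac κ U g ^ 2 ∂(gauss N) = pairAvg U fun σ τ => q κ ((1 + overlap σ τ) / 2) := by
  simp_rw [frac_sq_eq, pairAvg]
  rw [integral_div, integral_finsetSum _ fun σ _ => integrable_finsetSum _ fun τ _ =>
    (integrable_ind_slab_mul κ σ τ).const_mul _]
  congr 1
  refine Finset.sum_congr rfl fun σ _ => ?_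
  rw [integral_finsetSum _ fun τ _ => (integrable_ind_slab_mul κ σ τ).const_mul _]
  simp_rw [integral_const_mul, integral_ind_slab_mul hN]

lemma integrable_frac_sq (κ : ℝ) (U : Set (Cube N)) :
    Integrable (fun g => frac κ U g ^ 2) (gauss N) :=
  Integrable.of_bound ((measurable_frac κ U).pow_const 2).aestronglyMeasurable 1
    (ae_of_all _ fun g => by
      rw [Real.norm_eq_abs, abs_of_nonneg (sq_nonneg _)]
      exact pow_le_one₀ (frac_nonneg _ _ _) (frac_le_one _ _ _))

/-- The mean square overlap of pairs of elements of `U`. -/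
def meanSqOverlap (U : Set (Cube N)) : ℝ := pairAvg U fun σ τ => overlap σ τ ^ 2

lemma meanSqOverlap_nonneg (U : Set (Cube N)) : 0 ≤ meanSqOverlap U :=
  pairAvg_nonneg fun _ _ => sq_nonneg _

lemma meanSqOverlap_pos (hN : N ≠ 0) {U : Set (Cube N)} (hU : U.Nonempty) :
    0 < meanSqOverlap U := by
  have h1 := one_le_cnt hU
  obtain ⟨σ, hσ⟩ := hU
  refine div_pos (lt_of_lt_of_le zero_lt_one ?_) (by positivity)
  have hnn : ∀ σ τ : Cube N, 0 ≤ ind U σ * ind U τ * overlap σ τ ^ 2 := fun σ τ =>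
    mul_nonneg (mul_nonneg (ind_nonneg U σ) (ind_nonneg U τ)) (sq_nonneg _)
  calc (1 : ℝ) = ind U σ * ind U σ * overlap σ σ ^ 2 := by
        rw [ind_of_mem hσ, overlap_self hN]; norm_num
    _ ≤ ∑ τ, ind U σ * ind U τ * overlap σ τ ^ 2 :=
        Finset.single_le_sum (fun τ _ => hnn σ τ) (Finset.mem_univ σ)
    _ ≤ _ := Finset.single_le_sum (fun σ _ => Finset.sum_nonneg fun τ _ => hnn σ τ)
        (Finset.mem_univ σ)

/-- The relative variance of the fraction of `U` kept by a random constraint. -/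
lemma integral_sq_frac_div_sub_one_le (hN : N ≠ 0) {κ : ℝ} (hκ : 0 < κ) {U : Set (Cube N)}
    (hU : U.Nonempty) :
    ∫ g, (frac κ U g / p κ - 1) ^ 2 ∂(gauss N) ≤ (κ ^ 2 + 4) / p κ ^ 2 * meanSqOverlap U := by
  have hp := p_pos hκ
  have h1 : ∀ g, (frac κ U g / p κ - 1) ^ 2 =
      (p κ ^ 2)⁻¹ * frac κ U g ^ 2 - 2 * (p κ)⁻¹ * frac κ U g + 1 := by
    intro g
    field_simp
    ring
  simp_rw [h1]
  have hi : Integrable (fun g => (p κ ^ 2)⁻¹ * frac κ U g ^ 2 - 2 * (p κ)⁻¹ * frac κ U g)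
      (gauss N) := ((integrable_frac_sq κ U).const_mul _).sub ((integrable_frac κ U).const_mul _)
  rw [integral_add hi (integrable_const _), integral_sub ((integrable_frac_sq κ U).const_mul _)
    ((integrable_frac κ U).const_mul _), integral_const_mul, integral_const_mul,
    integral_frac hN κ hU, integral_frac_sq hN]
  have h2 : pairAvg U (fun σ τ => q κ ((1 + overlap σ τ) / 2)) ≤
      p κ ^ 2 + (κ ^ 2 + 4) * meanSqOverlap U := by
    rw [meanSqOverlap, ← pairAvg_const_mul, ← pairAvg_const hU (p κ ^ 2), ← pairAvg_add]
    refine pairAvg_mono fun σ τ => ?_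
    have hab := abs_le.1 (abs_overlap_le hN σ τ)
    have := q_le_sq_p_add hκ (β := (1 + overlap σ τ) / 2) (by linarith) (by linarith)
    rw [show 2 * ((1 + overlap σ τ) / 2) - 1 = overlap σ τ by ring] at this
    exact this
  have h3 : (p κ ^ 2)⁻¹ * pairAvg U (fun σ τ => q κ ((1 + overlap σ τ) / 2)) ≤
      (p κ ^ 2)⁻¹ * (p κ ^ 2 + (κ ^ 2 + 4) * meanSqOverlap U) := by gcongr
  have h4 : (p κ ^ 2)⁻¹ * (p κ ^ 2 + (κ ^ 2 + 4) * meanSqOverlap U) =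
      1 + (κ ^ 2 + 4) / p κ ^ 2 * meanSqOverlap U := by field_simp
  have h5 : 2 * (p κ)⁻¹ * p κ = 2 := by field_simp
  simp only [integral_const, probReal_univ, one_smul]
  linarith

end

/-! ### Constraints that keep too small a fraction -/

lemma map_inner_unitVec {N : ℕ} (hN : N ≠ 0) (σ : Cube N) :
    (gauss N).map (fun g => inner ℝ g (unitVec σ)) = gaussianReal 0 1 := by
  have hmap := IsGaussian.map_eq_gaussianReal (μ := gauss N) (innerSL ℝ (unitVec σ))
  rw [integral_strongDual_stdGaussian, variance_dual_stdGaussian, innerSL_apply_norm,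
    norm_unitVec hN] at hmap
  simp only [one_pow, Real.toNNReal_one] at hmap
  rw [← hmap]
  congr 1
  ext g
  simp [real_inner_comm]

/-- A smooth function below the indicator of `[-κ, κ]`. -/
lemma exists_smooth_minorant {κ : ℝ} (hκ : 0 < κ) :
    ∃ (h h' : ℝ → ℝ) (L : ℝ), (∀ z, HasDerivAt h (h' z) z) ∧ Continuous h' ∧ 0 < L ∧
      (∀ z, |h' z| ≤ L) ∧ (∀ z, 0 ≤ h z) ∧ (∀ z, h z ≤ 1) ∧ (∀ z, κ < |z| → h z = 0) ∧
      0 < ∫ z, h z ∂(gaussianReal 0 1) := by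
  let f : ContDiffBump (0 : ℝ) := ⟨κ / 2, κ, by positivity, by linarith⟩
  have hc : ContDiff ℝ 1 f := f.contDiff
  have hd : Continuous (deriv f) := hc.continuous_deriv le_rfl
  obtain ⟨C, hC⟩ := hd.bounded_above_of_compact_support f.hasCompactSupport.deriv
  refine ⟨f, deriv f, |C| + 1, fun z => (hc.differentiable one_ne_zero z).hasDerivAt, hd,
    by positivity, fun z => (hC z).trans ((le_abs_self C).trans (by linarith)), fun z => f.nonneg,
    fun z => f.le_one, fun z hz => f.zero_of_le_dist ?_, ?_⟩
  · simpa [f] using hz.le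
  · have hint : Integrable f (gaussianReal 0 1) :=
      Integrable.of_bound hc.continuous.aestronglyMeasurable 1 (ae_of_all _ fun z => by
        rw [Real.norm_eq_abs, abs_of_nonneg f.nonneg]
        exact f.le_one)
    have h1 : p (κ / 2) ≤ ∫ z, f z ∂(gaussianReal 0 1) := by
      have hms : MeasurableSet {z : ℝ | |z| ≤ κ / 2} :=
        measurableSet_le measurable_norm measurable_const
      rw [p, ← integral_indicator_one hms]
      refine integral_mono ((integrable_const 1).indicator hms) hint fun z => ?_
      by_cases hz : |z| ≤ κ / 2
      · have : f z = 1 := f.one_of_mem_closedBall (by simpa [f] using hz)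
        rw [this]
        exact Set.indicator_le_self' (fun _ _ => zero_le_one) z
      · rw [Set.indicator_of_notMem (by simpa using hz)]
        exact f.nonneg
    exact (p_pos (by positivity)).trans_le h1

/-- The eighth power turns a gradient bound of order `r^(1/4)` into a probability of order `r²`;
`40320 = 8!`. -/
lemma exp_neg_le_inv_pow {x : ℝ} (hx : 0 < x) : Real.exp (-x) ≤ 40320 / x ^ 8 := by
  have h := Real.pow_div_factorial_le_exp x hx.le 8
  rw [Real.exp_neg, inv_le_comm₀ (Real.exp_pos x) (by positivity), inv_div]
  norm_num [Nat.factorial] at h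
  exact h

/-- A random constraint keeps a constant fraction of `U`, except with a probability which is
quadratic in the mean square overlap. -/
lemma exists_frac_small_le {κ : ℝ} (hκ : 0 < κ) :
    ∃ c K : ℝ, 0 < c ∧ 0 < K ∧ ∀ N : ℕ, N ≠ 0 → ∀ U : Set (Cube N), U.Nonempty →
      (gauss N).real {g | frac κ U g ≤ c} ≤ K * meanSqOverlap U ^ 2 := by
  obtain ⟨h, h', M, hd, hc', hM0, hM, hnn, h1, hsupp, hint⟩ := exists_smooth_minorant hκ
  set m := ∫ z, h z ∂(gaussianReal 0 1) with hm
  have hc : Continuous h := continuous_iff_continuousAt.2 fun z => (hd z).continuousAt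
  refine ⟨m / 2, Real.exp (Real.pi ^ 2 / 8) * (40320 * (2 * M / m) ^ 8), by positivity,
    by positivity, fun N hN U hU => ?_⟩
  have hcnt := one_le_cnt hU
  have hr := meanSqOverlap_pos hN hU
  set r := meanSqOverlap U with hrdef
  set w : Cube N → ℝ := fun σ => ind U σ / cnt U with hw
  have hw0 : ∀ σ, 0 ≤ w σ := fun σ => div_nonneg (ind_nonneg _ _) (cnt_nonneg _)
  have hw1 : ∑ σ, w σ = 1 := sum_ind_div_cnt hU
  -- The squared gradient norm of `G` below is at most `M²` times the mean absolute overlap, which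
  -- is at most `√r` by Cauchy–Schwarz.
  set L := M * √(√r) with hL
  have hL0 : 0 < L := by positivity
  -- A smooth minorant of the fraction kept, whose mean `m` does not depend on `U`.
  set G : EuclideanSpace ℝ (Fin N) → ℝ := fun g => ∑ σ, w σ * h (inner ℝ g (unitVec σ)) with hG
  set G' : EuclideanSpace ℝ (Fin N) → StrongDual ℝ (EuclideanSpace ℝ (Fin N)) := fun g =>
    innerSL ℝ (∑ σ, (w σ * h' (inner ℝ g (unitVec σ))) • unitVec σ) with hG'
  have hGd : ∀ g, HasFDerivAt G (G' g) g := by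
    intro g
    have hs : ∀ σ : Cube N, HasFDerivAt (fun g => w σ * h (inner ℝ g (unitVec σ)))
        ((w σ * h' (inner ℝ g (unitVec σ))) • innerSL ℝ (unitVec σ)) g := by
      intro σ
      have hi : HasFDerivAt (fun g => inner ℝ g (unitVec σ)) (innerSL ℝ (unitVec σ)) g := by
        have := (innerSL ℝ (unitVec σ)).hasFDerivAt (x := g)
        refine this.congr_of_eventuallyEq (Eventually.of_forall fun x => ?_)
        simp [real_inner_comm]
      have := ((hd (inner ℝ g (unitVec σ))).comp_hasFDerivAt g hi).const_mul (w σ)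
      rwa [smul_smul] at this
    refine (HasFDerivAt.fun_sum (u := Finset.univ) fun σ _ => hs σ).congr_fderiv ?_
    simp [hG', map_sum]
  have hG'c : Continuous G' := by
    refine (innerSL ℝ).continuous.comp ?_
    fun_prop
  have hGL : ∀ g, ‖G' g‖ ≤ L := by
    intro g
    rw [hG', innerSL_apply_norm]
    refine (sq_le_sq₀ (norm_nonneg _) hL0.le).1 ?_
    rw [← real_inner_self_eq_norm_sq, sum_inner]
    simp_rw [inner_sum, inner_smul_left, inner_smul_right, conj_trivial]
    have hLsq : L ^ 2 = M ^ 2 * √r := by rw [hL, mul_pow, Real.sq_sqrt (Real.sqrt_nonneg _)]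
    rw [hLsq]
    calc _ ≤ ∑ σ, ∑ τ, M ^ 2 * (w σ * w τ * |overlap σ τ|) := by
          refine Finset.sum_le_sum fun σ _ => Finset.sum_le_sum fun τ _ => ?_
          refine (le_abs_self _).trans ?_
          rw [abs_mul, abs_mul, abs_mul, abs_mul, abs_of_nonneg (hw0 σ), abs_of_nonneg (hw0 τ)]
          have e1 := hM (inner ℝ g (unitVec σ))
          have e2 := hM (inner ℝ g (unitVec τ))
          change w σ * |h' (inner ℝ g (unitVec σ))| * (w τ * |h' (inner ℝ g (unitVec τ))| *
            |overlap σ τ|) ≤ _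
          calc _ = |h' (inner ℝ g (unitVec σ))| * |h' (inner ℝ g (unitVec τ))| *
                (w σ * w τ * |overlap σ τ|) := by ring
            _ ≤ M * M * (w σ * w τ * |overlap σ τ|) := by
                have := mul_nonneg (mul_nonneg (hw0 σ) (hw0 τ)) (abs_nonneg (overlap σ τ))
                gcongr
            _ = _ := by ring
      _ = M ^ 2 * pairAvg U (fun σ τ => |overlap σ τ|) := by
          simp_rw [← Finset.mul_sum]
          rw [pairAvg, Finset.sum_div]
          congr 1
          refine Finset.sum_congr rfl fun σ _ => ?_
          rw [Finset.sum_div]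
          refine Finset.sum_congr rfl fun τ _ => ?_
          simp only [hw]
          field_simp
      _ ≤ M ^ 2 * √r := by
          gcongr
          exact Real.le_sqrt_of_sq_le (sq_pairAvg_abs_le hU _)
  have hGabs : ∀ g, |G g| ≤ 1 := by
    intro g
    rw [abs_of_nonneg (Finset.sum_nonneg fun σ _ => mul_nonneg (hw0 σ) (hnn _)), ← hw1]
    exact Finset.sum_le_sum fun σ _ => mul_le_of_le_one_right (hw0 σ) (h1 _)
  have hGint : ∫ g, G g ∂(gauss N) = m := by
    have hi : ∀ σ : Cube N, Integrable (fun g => h (inner ℝ g (unitVec σ))) (gauss N) := fun σ =>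
      Integrable.of_bound (Continuous.aestronglyMeasurable (by fun_prop)) 1
        (ae_of_all _ fun g => by
          rw [Real.norm_eq_abs, abs_of_nonneg (hnn _)]
          exact h1 _)
    rw [hG, integral_finsetSum _ fun σ _ => (hi σ).const_mul _]
    have hσ : ∀ σ : Cube N, ∫ g, h (inner ℝ g (unitVec σ)) ∂(gauss N) = m := by
      intro σ
      rw [hm, ← map_inner_unitVec hN σ, integral_map (by fun_prop) hc.aestronglyMeasurable]
    simp_rw [integral_const_mul, hσ]
    rw [← Finset.sum_mul, hw1, one_mul]
  have hGle : ∀ g, G g ≤ frac κ U g := by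
    intro g
    rw [frac_eq]
    refine Finset.sum_le_sum fun σ _ => mul_le_mul_of_nonneg_left ?_ (hw0 σ)
    by_cases hσ : σ ∈ slab κ g
    · rw [ind_of_mem hσ]
      exact h1 _
    · rw [hsupp _ (by rwa [mem_slab_iff hN, not_le] at hσ)]
      exact ind_nonneg _ _
  -- Dividing by `L` makes the gradient bound `1`; falling to half the mean is then a deviation of
  -- `m / (2L)`.
  have htail := stdGaussian_lower_tail (F := fun g => L⁻¹ * G g) (F' := fun g => L⁻¹ • G' g)
    (fun g => (hGd g).const_mul _) (by fun_prop) (L := 1) (C := L⁻¹)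
    (fun g => by
      rw [norm_smul, norm_inv, Real.norm_of_nonneg hL0.le, inv_mul_le_iff₀ hL0, mul_one]
      exact hGL g)
    (fun g => by
      rw [abs_mul, abs_of_pos (inv_pos.2 hL0)]
      exact mul_le_of_le_one_right (inv_nonneg.2 hL0.le) (hGabs g)) (L⁻¹ * (m / 2))
  rw [integral_const_mul, hGint] at htail
  calc (gauss N).real {g | frac κ U g ≤ m / 2}
      ≤ (gauss N).real {g | L⁻¹ * G g ≤ L⁻¹ * m - L⁻¹ * (m / 2)} := by
        refine measureReal_mono fun g hg => ?_
        rw [Set.mem_ofPred_eq] at hg ⊢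
        rw [← mul_sub, mul_le_mul_iff_right₀ (inv_pos.2 hL0)]
        linarith [hGle g]
    _ ≤ _ := htail
    _ = Real.exp (Real.pi ^ 2 / 8) * Real.exp (-(m / (2 * L))) := by
        rw [← Real.exp_add]
        congr 1
        field_simp
        ring
    _ ≤ Real.exp (Real.pi ^ 2 / 8) * (40320 / (m / (2 * L)) ^ 8) := by
        gcongr
        exact exp_neg_le_inv_pow (by positivity)
    _ = _ := by
        have h8 : √(√r) ^ 8 = r ^ 2 := by
          calc √(√r) ^ 8 = ((√(√r) ^ 2) ^ 2) ^ 2 := by ring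
            _ = r ^ 2 := by rw [Real.sq_sqrt (Real.sqrt_nonneg _), Real.sq_sqrt hr.le]
        rw [← h8, hL]
        field_simp

/-! ### The truncated logarithmic potential -/

/-- A truncated version of `-log w`. -/
def potential (η w : ℝ) : ℝ := Real.log ((1 + w) / (w + η))

section Potential

variable {η w : ℝ}

lemma potential_nonneg (h0 : 0 < η) (h1 : η ≤ 1) (hw : 0 ≤ w) : 0 ≤ potential η w :=
  Real.log_nonneg (by rw [le_div_iff₀ (by linarith)]; linarith)

lemma potential_le (h0 : 0 < η) (h1 : η ≤ 1) (hw : 0 ≤ w) : potential η w ≤ -Real.log η := by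
  rw [← Real.log_inv]
  refine Real.log_le_log (by positivity) ?_
  rw [div_le_iff₀ (by linarith), inv_mul_eq_div, le_div_iff₀ h0]
  nlinarith

lemma le_potential (h0 : 0 < η) (hw : 0 ≤ w) (hwη : w ≤ η) :
    -Real.log η - Real.log 2 ≤ potential η w := by
  rw [← Real.log_inv, ← Real.log_div (by positivity) two_ne_zero]
  refine Real.log_le_log (by positivity) ?_
  rw [le_div_iff₀ (by linarith)]
  have : η⁻¹ / 2 * (w + η) ≤ η⁻¹ / 2 * (η + η) := by gcongr
  have h2 : η⁻¹ / 2 * (η + η) = 1 := by field_simp; norm_num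
  linarith

/-- A second order expansion from `log t ≤ t - 1`, whose linear term will average to zero. The
denominator `1 + b (y - 1)` stays above `c` unless `y ≤ c` and `w ≥ η`, since `w < η` gives `b <
1/2`; in the exceptional case the trivial bound `-log η` is paid. -/
lemma potential_mul_le (h0 : 0 < η) (h1 : η ≤ 1) (hw : 0 < w) {y c : ℝ} (hy : 0 ≤ y) (hc0 : 0 < c)
    (hc : c ≤ 1 / 2) :
    potential η (w * y) ≤ potential η w - (w / (w + η) - w / (1 + w)) * (y - 1)
      + (w / (w + η)) ^ 2 / c * (y - 1) ^ 2
      + if y ≤ c ∧ η ≤ w then -Real.log η else 0 := by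
  set a := w / (1 + w) with ha
  set b := w / (w + η) with hb
  have hb0 : 0 < b := by positivity
  have hb1 : b < 1 := by rw [hb, div_lt_one (by positivity)]; linarith
  have ha0 : 0 < a := by positivity
  have ha1 : a < 1 := by rw [ha, div_lt_one (by positivity)]; linarith
  have hab : a ≤ b := by
    rw [ha, hb]
    gcongr w / ?_
    linarith
  have hMnn : 0 ≤ -Real.log η := by linarith [Real.log_nonpos h0.le h1]
  have hquad : 0 ≤ b ^ 2 / c * (y - 1) ^ 2 := by positivity
  by_cases hcase : y ≤ c ∧ η ≤ w
  · rw [if_pos hcase]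
    have h2 := potential_le h0 h1 (w := w * y) (by positivity)
    have h3 := potential_nonneg h0 h1 hw.le
    have h4 : 0 ≤ (b - a) * (1 - y) := mul_nonneg (by linarith) (by linarith [hcase.1])
    linarith
  · rw [if_neg hcase, add_zero]
    have hden : c ≤ 1 + b * (y - 1) := by
      rw [not_and_or, not_le, not_le] at hcase
      rcases hcase with h | h
      · rcases le_total 1 y with h' | h'
        · have := mul_nonneg hb0.le (sub_nonneg.2 h')
          linarith
        · nlinarith
      · have hbh : b < 1 / 2 := by
          rw [hb, div_lt_iff₀ (by linarith)]
          linarith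
        nlinarith
    have hden0 : 0 < 1 + b * (y - 1) := hc0.trans_le hden
    have hnum0 : 0 < 1 + a * (y - 1) := by nlinarith
    have hratio : potential η (w * y) = potential η w +
        Real.log ((1 + a * (y - 1)) / (1 + b * (y - 1))) := by
      rw [potential, potential, ← Real.log_mul (by positivity) (by positivity)]
      congr 1
      have e1 : 1 + w * y = (1 + w) * (1 + a * (y - 1)) := by rw [ha]; field_simp; ring
      have e2 : w * y + η = (w + η) * (1 + b * (y - 1)) := by rw [hb]; field_simp; ring
      rw [e1, e2]
      field_simp
    have hlog := Real.log_le_sub_one_of_pos (div_pos hnum0 hden0)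
    have hbound : (1 + a * (y - 1)) / (1 + b * (y - 1)) - 1 ≤
        -(b - a) * (y - 1) + b ^ 2 / c * (y - 1) ^ 2 := by
      have e : (1 + a * (y - 1)) / (1 + b * (y - 1)) - 1 =
          -(b - a) * (y - 1) + (b - a) * b / (1 + b * (y - 1)) * (y - 1) ^ 2 := by
        clear_value a b
        rw [div_sub_one hden0.ne', div_mul_eq_mul_div, div_eq_iff hden0.ne', add_mul,
          div_mul_cancel₀ _ hden0.ne']
        ring
      rw [e]
      gcongr
      nlinarith
    rw [hratio]
    linarith

/-- The overlap estimate involves `-log w`, unbounded below the truncation level. The prefactor of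
the quadratic term compensates: with `b = w/(w + η)`, split `-log w = -log (w + η) - log b` and use
`-b² log b ≤ 1`. -/
lemma sq_mul_neg_log_le (h0 : 0 < η) (h1 : η ≤ 1) (hw : 0 < w) :
    (w / (w + η)) ^ 2 * -Real.log w ≤ potential η w + 1 := by
  set b := w / (w + η) with hb
  have hb0 : 0 < b := by positivity
  have hb1 : b < 1 := by rw [hb, div_lt_one (by positivity)]; linarith
  have hψ := potential_nonneg h0 h1 hw.le
  have hsplit : -Real.log w = -Real.log (w + η) + -Real.log b := by
    rw [hb, Real.log_div (by positivity) (by positivity)]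
    ring
  have h2 : -Real.log (w + η) ≤ potential η w := by
    rw [potential, Real.log_div (by positivity) (by positivity)]
    have := Real.log_nonneg (show 1 ≤ 1 + w by linarith)
    linarith
  have h3 : b ^ 2 * -Real.log b ≤ 1 := by
    have := Real.one_sub_inv_le_log_of_pos hb0
    have h4 : b ^ 2 * -Real.log b ≤ b ^ 2 * (b⁻¹ - 1) := by gcongr; linarith
    have h5 : b ^ 2 * (b⁻¹ - 1) = b - b ^ 2 := by field_simp
    nlinarith
  have h4 : b ^ 2 * -Real.log (w + η) ≤ potential η w := by
    have hb2 : b ^ 2 ≤ 1 := pow_le_one₀ hb0.le hb1.le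
    calc _ ≤ b ^ 2 * potential η w := by gcongr
      _ ≤ _ := mul_le_of_le_one_left hψ hb2
  rw [hsplit, mul_add]
  linarith

end Potential

/-! ### One-step drift of the potential -/

section

variable {N : ℕ}

/-- The number of elements of `U`, normalized by the mean number of solutions of `k` constraints. -/
def weight (κ : ℝ) (k : ℕ) (U : Set (Cube N)) : ℝ := cnt U / (2 ^ N * p κ ^ k)

/-- The normalized exponential moment of the square overlap over pairs of elements of `U`. -/
def pairMoment (c κ : ℝ) (k : ℕ) (U : Set (Cube N)) : ℝ :=
  (∑ σ, ∑ τ, ind U σ * ind U τ * Real.exp (c * N * overlap σ τ ^ 2)) / (2 ^ N * p κ ^ k) ^ 2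

lemma weight_nonneg {κ : ℝ} (hκ : 0 < κ) (k : ℕ) (U : Set (Cube N)) : 0 ≤ weight κ k U := by
  have := p_pos hκ
  have := cnt_nonneg U
  unfold weight
  positivity

lemma pairMoment_nonneg {κ : ℝ} (hκ : 0 < κ) (c : ℝ) (k : ℕ) (U : Set (Cube N)) :
    0 ≤ pairMoment c κ k U := by
  have := p_pos hκ
  refine div_nonneg (Finset.sum_nonneg fun σ _ => Finset.sum_nonneg fun τ _ => ?_) (by positivity)
  exact mul_nonneg (mul_nonneg (ind_nonneg _ _) (ind_nonneg _ _)) (Real.exp_pos _).le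

lemma weight_pos {κ : ℝ} (hκ : 0 < κ) (k : ℕ) {U : Set (Cube N)} (hU : U.Nonempty) :
    0 < weight κ k U := by
  have := p_pos hκ
  have := one_le_cnt hU
  unfold weight
  positivity

lemma weight_inter_slab {κ : ℝ} (hκ : 0 < κ) (k : ℕ) {U : Set (Cube N)} (hU : U.Nonempty)
    (g : EuclideanSpace ℝ (Fin N)) :
    weight κ (k + 1) (U ∩ slab κ g) = weight κ k U * (frac κ U g / p κ) := by
  have := p_pos hκ
  have := one_le_cnt hU
  rw [weight, weight, frac, pow_succ]
  field_simp

/-- Jensen's inequality for the uniform average over pairs in `U`, whose exponential moment is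
`pairMoment` divided by the squared weight. -/
lemma mul_meanSqOverlap_le {κ : ℝ} (hκ : 0 < κ) (c : ℝ) (k : ℕ) {U : Set (Cube N)}
    (hU : U.Nonempty) :
    c * N * meanSqOverlap U ≤ Real.log (1 + pairMoment c κ k U) - 2 * Real.log (weight κ k U) := by
  have hp := p_pos hκ
  have hcnt := one_le_cnt hU
  have hw := weight_pos hκ k hU
  have hB := pairMoment_nonneg hκ c k U
  have h1 := exp_pairAvg_le hU (fun σ τ => c * N * overlap σ τ ^ 2)
  have h2 : pairAvg U (fun σ τ => Real.exp (c * N * overlap σ τ ^ 2)) =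
      pairMoment c κ k U / weight κ k U ^ 2 := by
    rw [pairAvg, pairMoment, weight]
    field_simp
  rw [pairAvg_const_mul, h2] at h1
  have h3 : Real.exp (c * N * meanSqOverlap U) ≤
      (1 + pairMoment c κ k U) / weight κ k U ^ 2 := by
    refine h1.trans ?_
    gcongr
    linarith
  have h4 := (Real.le_log_iff_exp_le (by positivity)).2 h3
  rwa [Real.log_div (by positivity) (by positivity), Real.log_pow] at h4

/-- Averaging the expansion: the linear term vanishes because the fraction kept has mean `p κ`, the
quadratic term is its relative variance, and the exceptional term is the small-fraction probability.
-/
lemma integral_potential_le (hN : N ≠ 0) {κ c₀ K : ℝ} (hκ : 0 < κ) (hc₀ : 0 < c₀)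
    (hfrac : ∀ U : Set (Cube N), U.Nonempty →
      (gauss N).real {g | frac κ U g ≤ c₀} ≤ K * meanSqOverlap U ^ 2)
    {η : ℝ} (h0 : 0 < η) (h1 : η ≤ 1) (k : ℕ) {U : Set (Cube N)} (hU : U.Nonempty) :
    ∫ g, potential η (weight κ (k + 1) (U ∩ slab κ g)) ∂(gauss N) ≤
      potential η (weight κ k U)
      + (weight κ k U / (weight κ k U + η)) ^ 2 / (min c₀ (1 / 2))
        * ((κ ^ 2 + 4) / p κ ^ 2 * meanSqOverlap U)
      + if η ≤ weight κ k U then -Real.log η * (K * meanSqOverlap U ^ 2) else 0 := by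
  have hp := p_pos hκ
  have hp1 := p_le_one κ
  have hw := weight_pos hκ k hU
  set w := weight κ k U with hwdef
  set c := min c₀ (1 / 2) with hc
  have hcpos : 0 < c := by positivity
  set b := w / (w + η) with hb
  set a := w / (1 + w) with ha
  have hMnn : 0 ≤ -Real.log η := by linarith [Real.log_nonpos h0.le h1]
  have hmf := measurable_frac κ U
  have hi1 : Integrable (fun g => frac κ U g / p κ - 1) (gauss N) :=
    ((integrable_frac κ U).div_const _).sub (integrable_const _)
  have hi2 : Integrable (fun g => (frac κ U g / p κ - 1) ^ 2) (gauss N) := by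
    have : (fun g => (frac κ U g / p κ - 1) ^ 2) = fun g =>
        (p κ ^ 2)⁻¹ * frac κ U g ^ 2 - 2 * (p κ)⁻¹ * frac κ U g + 1 := by
      ext g
      field_simp
      ring
    rw [this]
    exact (((integrable_frac_sq κ U).const_mul _).sub ((integrable_frac κ U).const_mul _)).add
      (integrable_const _)
  set S : Set (EuclideanSpace ℝ (Fin N)) := {g | frac κ U g / p κ ≤ c ∧ η ≤ w} with hS
  have hSm : MeasurableSet S :=
    (measurableSet_le (hmf.div_const _) measurable_const).inter (MeasurableSet.const _)
  have hi3 : Integrable (S.indicator fun _ => -Real.log η) (gauss N) :=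
    (integrable_const _).indicator hSm
  have hpt : ∀ g, potential η (weight κ (k + 1) (U ∩ slab κ g)) ≤
      potential η w - (b - a) * (frac κ U g / p κ - 1)
        + b ^ 2 / c * (frac κ U g / p κ - 1) ^ 2 + S.indicator (fun _ => -Real.log η) g := by
    intro g
    rw [weight_inter_slab hκ k hU]
    refine (potential_mul_le h0 h1 hw (div_nonneg (frac_nonneg κ U g) hp.le) hcpos
      (min_le_right _ _)).trans (le_of_eq ?_)
    congr 1
    by_cases hg : frac κ U g / p κ ≤ c ∧ η ≤ w
    · rw [if_pos hg, Set.indicator_of_mem (show g ∈ S from hg)]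
    · rw [if_neg hg, Set.indicator_of_notMem (show g ∉ S from hg)]
  have hpi : Integrable (fun g => potential η (weight κ (k + 1) (U ∩ slab κ g))) (gauss N) := by
    refine Integrable.of_bound (C := -Real.log η) ?_ (ae_of_all _ fun g => ?_)
    · simp_rw [weight_inter_slab hκ k hU, potential]
      apply Measurable.aestronglyMeasurable
      fun_prop
    · have hwn := weight_nonneg hκ (k + 1) (U ∩ slab κ g)
      rw [Real.norm_eq_abs, abs_of_nonneg (potential_nonneg h0 h1 hwn)]
      exact potential_le h0 h1 hwn
  have hi12 : Integrable (fun g => potential η w - (b - a) * (frac κ U g / p κ - 1)) (gauss N) :=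
    (integrable_const _).sub (hi1.const_mul _)
  have hi123 : Integrable (fun g => potential η w - (b - a) * (frac κ U g / p κ - 1)
      + b ^ 2 / c * (frac κ U g / p κ - 1) ^ 2) (gauss N) := hi12.add (hi2.const_mul _)
  refine (integral_mono hpi (hi123.add hi3) hpt).trans ?_
  have hmean : ∫ g, (frac κ U g / p κ - 1) ∂(gauss N) = 0 := by
    rw [integral_sub ((integrable_frac κ U).div_const _) (integrable_const _), integral_div,
      integral_frac hN κ hU, div_self hp.ne']
    simp
  simp only [Pi.add_apply]
  rw [integral_add hi123 hi3, integral_add hi12 (hi2.const_mul _),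
    integral_sub (integrable_const _) (hi1.const_mul _), integral_const_mul, integral_const_mul,
    hmean, integral_indicator_const _ hSm]
  have hvar := integral_sq_frac_div_sub_one_le hN hκ hU
  simp only [integral_const, probReal_univ, mul_zero, sub_zero, smul_eq_mul]
  have hbad : (gauss N).real S * -Real.log η ≤
      if η ≤ w then -Real.log η * (K * meanSqOverlap U ^ 2) else 0 := by
    split_ifs with hηw
    · rw [mul_comm]
      gcongr
      refine (measureReal_mono fun g hg => ?_).trans (hfrac U hU)
      have h2 : frac κ U g / p κ ≤ c := hg.1
      rw [div_le_iff₀ hp] at h2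
      have h3 : c * p κ ≤ c₀ :=
        (mul_le_of_le_one_right hcpos.le hp1).trans (min_le_left _ _)
      exact h2.trans h3
    · have : S = ∅ := by
        ext g
        simp [hS, hηw]
      simp [this]
  have h5 : 0 ≤ b ^ 2 / c := by positivity
  have := mul_le_mul_of_nonneg_left hvar h5
  linarith

/-- One-step drift of the potential. -/
lemma exists_drift_bound {κ c : ℝ} (hκ : 0 < κ) (hc : 0 < c) :
    ∃ A : ℝ, 0 < A ∧ ∀ N : ℕ, N ≠ 0 → ∀ η : ℝ, 0 < η → η ≤ 1 → ∀ (k : ℕ) (U : Set (Cube N)),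
      ∫ g, potential η (weight κ (k + 1) (U ∩ slab κ g)) ∂(gauss N) ≤
        potential η (weight κ k U)
        + A / N * (Real.log (1 + pairMoment c κ k U) + 2 * potential η (weight κ k U) + 2)
        + A / N ^ 2 * -Real.log η * (Real.log (1 + pairMoment c κ k U) + 2 * -Real.log η) ^ 2 := by
  obtain ⟨c₀, K, hc₀, hK, hfrac⟩ := exists_frac_small_le hκ
  have hp := p_pos hκ
  set A₁ := (min c₀ (1 / 2))⁻¹ * ((κ ^ 2 + 4) / p κ ^ 2) / c with hA₁
  set A₂ := K / c ^ 2 with hA₂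
  have hm : 0 < min c₀ (1 / 2) := by positivity
  have hA₁0 : 0 < A₁ := by positivity
  have hA₂0 : 0 < A₂ := by positivity
  refine ⟨A₁ + A₂, by positivity, fun N hN η h0 h1 k U => ?_⟩
  have hN0 : (0 : ℝ) < N := by positivity
  have hB := pairMoment_nonneg hκ c k U
  have hlogB : 0 ≤ Real.log (1 + pairMoment c κ k U) := Real.log_nonneg (by linarith)
  have hw0 := weight_nonneg hκ k U
  have hψ := potential_nonneg h0 h1 hw0
  have hMnn : 0 ≤ -Real.log η := by linarith [Real.log_nonpos h0.le h1]
  rcases U.eq_empty_or_nonempty with rfl | hU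
  · have hz : ∀ k, weight κ k (∅ : Set (Cube N)) = 0 := fun k => by simp [weight, cnt_empty]
    simp only [Set.empty_inter, hz, integral_const, probReal_univ, one_smul]
    rw [hz] at hψ
    rw [add_assoc, le_add_iff_nonneg_right]
    positivity
  have hw := weight_pos hκ k hU
  have hstep := integral_potential_le hN hκ hc₀ (hfrac N hN) h0 h1 k hU
  have hr := mul_meanSqOverlap_le hκ c k hU
  have hr0 := meanSqOverlap_nonneg U
  set w := weight κ k U with hwdef
  set B := Real.log (1 + pairMoment c κ k U) with hBdef
  set r := meanSqOverlap U with hrdef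
  set M := -Real.log η with hM
  set ψ := potential η w with hψdef
  set b := w / (w + η) with hb
  have hb1 : b ^ 2 ≤ 1 :=
    pow_le_one₀ (by positivity) (by rw [hb, div_le_one (by positivity)]; linarith)
  have hbr : b ^ 2 * (c * N * r) ≤ B + 2 * ψ + 2 := by
    have h2 := sq_mul_neg_log_le h0 h1 hw
    have h3 := mul_le_mul_of_nonneg_left hr (sq_nonneg b)
    have h4 := mul_le_of_le_one_left hlogB hb1
    linarith
  have hdrift : b ^ 2 / min c₀ (1 / 2) * ((κ ^ 2 + 4) / p κ ^ 2 * r) ≤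
      (A₁ + A₂) / N * (B + 2 * ψ + 2) := by
    have e : b ^ 2 / min c₀ (1 / 2) * ((κ ^ 2 + 4) / p κ ^ 2 * r) =
        A₁ / N * (b ^ 2 * (c * N * r)) := by
      rw [hA₁]
      field_simp
    rw [e]
    have : 0 ≤ B + 2 * ψ + 2 := by positivity
    calc _ ≤ A₁ / N * (B + 2 * ψ + 2) := by gcongr
      _ ≤ _ := by
        gcongr
        linarith
  -- Here `w ≥ η`, so `-log w ≤ M` holds without the help of the prefactor `b²`.
  have hjump : (if η ≤ w then M * (K * r ^ 2) else 0) ≤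
      (A₁ + A₂) / N ^ 2 * M * (B + 2 * M) ^ 2 := by
    split_ifs with hηw
    · have h2 : c * N * r ≤ B + 2 * M := by
        have := Real.log_le_log h0 hηw
        linarith
      have e : M * (K * r ^ 2) = A₂ / N ^ 2 * M * (c * N * r) ^ 2 := by
        rw [hA₂]
        field_simp
      rw [e]
      calc _ ≤ A₂ / N ^ 2 * M * (B + 2 * M) ^ 2 := by gcongr
        _ ≤ _ := by
          gcongr
          linarith
    · positivity
  linarith

end

/-! ### Second moment of the number of solutions -/

instance instIsProbabilityMeasureDisorder (N k : ℕ) : IsProbabilityMeasure (disorder N k) := by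
  unfold disorder
  infer_instance

section

variable {N : ℕ}

lemma integrable_comp_sol (κ : ℝ) (k : ℕ) (φ : Set (Cube N) → ℝ) :
    Integrable (fun X : Config N k => φ (sol κ X)) (disorder N k) := by
  obtain ⟨C, hC⟩ := (Set.finite_range fun U => |φ U|).bddAbove
  refine Integrable.of_bound (C := C) ?_ (ae_of_all _ fun X => hC ⟨sol κ X, rfl⟩)
  exact ((Measurable.of_discrete (f := φ)).comp (measurable_sol κ N k)).aestronglyMeasurable

lemma sol_eq_inter (κ : ℝ) {k : ℕ} (X : Config N (k + 1)) :
    sol κ X = sol κ (fun j : Fin k => X j.succ) ∩ slab κ (X 0) := by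
  ext σ
  simp only [sol, Set.mem_iInter, Set.mem_inter_iff, Fin.forall_fin_succ]
  exact and_comm

lemma integral_comp_sol_succ (κ : ℝ) (k : ℕ) (φ : Set (Cube N) → ℝ) :
    ∫ X, φ (sol κ X) ∂(disorder N (k + 1)) =
      ∫ X, ∫ g, φ (sol κ X ∩ slab κ g) ∂(gauss N) ∂(disorder N k) := by
  have hmp := measurePreserving_piFinSuccAbove (fun _ : Fin (k + 1) => gauss N) 0
  set e := MeasurableEquiv.piFinSuccAbove (fun _ : Fin (k + 1) => EuclideanSpace ℝ (Fin N)) 0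
  set ψ : EuclideanSpace ℝ (Fin N) × Config N k → ℝ := fun z => φ (sol κ z.2 ∩ slab κ z.1) with hψ
  have hcomp : (fun X : Config N (k + 1) => φ (sol κ X)) = fun X => ψ (e X) := by
    ext X
    rw [sol_eq_inter]
    rfl
  have hint : Integrable ψ ((gauss N).prod (disorder N k)) := by
    have := integrable_comp_sol κ (k + 1) φ
    rw [hcomp] at this
    exact (hmp.integrable_comp_emb e.measurableEmbedding).1 this
  rw [hcomp]
  change ∫ X, ψ (e X) ∂(Measure.pi fun _ : Fin (k + 1) => gauss N) = _
  rw [hmp.integral_comp e.measurableEmbedding]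
  exact integral_prod_symm ψ hint

lemma disorder_real_pair (hN : N ≠ 0) (κ : ℝ) (k : ℕ) (σ τ : Cube N) :
    (disorder N k).real {X | σ ∈ sol κ X ∧ τ ∈ sol κ X} = q κ ((1 + overlap σ τ) / 2) ^ k := by
  have : {X : Config N k | σ ∈ sol κ X ∧ τ ∈ sol κ X} =
      Set.univ.pi fun _ => {g | σ ∈ slab κ g ∧ τ ∈ slab κ g} := by
    ext X
    simp [sol, forall_and]
  rw [this, disorder, measureReal_def, Measure.pi_pi, ENNReal.toReal_prod]
  simp only [Finset.prod_const, Finset.card_univ, Fintype.card_fin]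
  rw [← measureReal_def, gauss_slab_pair hN]

lemma integral_ind_mul_ind_sol (hN : N ≠ 0) (κ : ℝ) (k : ℕ) (σ τ : Cube N) :
    ∫ X, ind (sol κ X) σ * ind (sol κ X) τ ∂(disorder N k) =
      q κ ((1 + overlap σ τ) / 2) ^ k := by
  have : (fun X : Config N k => ind (sol κ X) σ * ind (sol κ X) τ) =
      {X | σ ∈ sol κ X ∧ τ ∈ sol κ X}.indicator 1 := by
    ext X
    by_cases h : σ ∈ sol κ X <;> by_cases h' : τ ∈ sol κ X <;> simp [ind, h, h']
  have hm : MeasurableSet {X : Config N k | σ ∈ sol κ X ∧ τ ∈ sol κ X} :=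
    (measurableSet_mem_sol κ σ).inter (measurableSet_mem_sol κ τ)
  rw [this, integral_indicator_one hm, disorder_real_pair hN]

lemma pow_eq_exp_mul_log {x : ℝ} (hx : 0 ≤ x) (j : ℕ) (h : x = 0 → j = 0) :
    x ^ j = Real.exp (j * Real.log x) := by
  rcases hx.eq_or_lt with rfl | hx
  · simp [h rfl]
  · rw [mul_comm, Real.exp_mul, Real.exp_log hx, Real.rpow_natCast]

/-- The right side is the probability of one point with `j` agreements when coordinates agree
independently with probability `j/N`; `0 ^ 0 = 1` covers `j = 0` and `j = N`. -/
lemma exp_neg_mul_binEntropy (hN : N ≠ 0) {j : ℕ} (hj : j ≤ N) :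
    Real.exp (-(N * Real.binEntropy (j / N))) =
      ((j : ℝ) / N) ^ j * (1 - (j : ℝ) / N) ^ (N - j) := by
  have hN0 : (0 : ℝ) < N := by positivity
  have hj' : (j : ℝ) ≤ N := by exact_mod_cast hj
  have h1 : (j : ℝ) / N ≤ 1 := div_le_one_of_le₀ hj' hN0.le
  rw [pow_eq_exp_mul_log (by positivity) j (fun h => by simpa [hN] using h),
    pow_eq_exp_mul_log (by linarith) (N - j) (fun h => by
      rw [sub_eq_zero, eq_comm, div_eq_one_iff_eq hN0.ne'] at h
      have : j = N := by exact_mod_cast h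
      omega), ← Real.exp_add, Nat.cast_sub hj, Real.binEntropy, Real.log_inv, Real.log_inv]
  congr 1
  field_simp
  ring

/-- The number of coordinates on which two points of the cube agree. -/
def agree (σ τ : Cube N) : ℕ := (Finset.univ.filter fun i => τ i = σ i).card

lemma agree_le (σ τ : Cube N) : agree σ τ ≤ N := by
  unfold agree
  simpa using Finset.card_le_univ (Finset.univ.filter fun i => τ i = σ i)

lemma overlap_eq_agree (hN : N ≠ 0) (σ τ : Cube N) : (1 + overlap σ τ) / 2 = agree σ τ / N := by
  have h : ∑ i, ((σ i : ℤ) : ℝ) * ((τ i : ℤ) : ℝ) = 2 * agree σ τ - N := by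
    have h1 : ∀ i, ((σ i : ℤ) : ℝ) * ((τ i : ℤ) : ℝ) = 2 * (if τ i = σ i then 1 else 0) - 1 := by
      intro i
      rcases Int.units_eq_one_or (σ i) with h | h <;> rcases Int.units_eq_one_or (τ i) with h' | h' <;>
        norm_num [h, h']
    simp_rw [h1]
    rw [Finset.sum_sub_distrib, ← Finset.mul_sum, Finset.sum_boole]
    simp [agree]
  rw [overlap_eq, h]
  field_simp
  ring

lemma prod_ite_agree (σ τ : Cube N) (x : ℝ) :
    ∏ i, (if τ i = σ i then x else 1 - x) = x ^ agree σ τ * (1 - x) ^ (N - agree σ τ) := by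
  rw [Finset.prod_ite, Finset.prod_const, Finset.prod_const]
  congr 2
  have := Finset.card_filter_add_card_filter_not (s := Finset.univ) fun i => τ i = σ i
  simp only [Finset.card_univ, Fintype.card_fin] at this
  rw [agree]
  omega

lemma sum_prod_ite (σ : Cube N) (x : ℝ) :
    ∑ τ : Cube N, ∏ i, (if τ i = σ i then x else 1 - x) = 1 := by
  have h := Finset.prod_univ_sum (fun _ : Fin N => (Finset.univ : Finset ℤˣ))
    (fun i a => if a = σ i then x else 1 - x)
  rw [Fintype.piFinset_univ] at h
  rw [← h]
  refine Finset.prod_eq_one fun i _ => ?_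
  have hu : (Finset.univ : Finset ℤˣ) = {1, -1} := by decide
  rw [hu, Finset.sum_pair (by decide)]
  rcases Int.units_eq_one_or (σ i) with h | h <;> rw [h] <;> norm_num

/-- Each summand is dominated by a sum over all `j ≤ N` of product probabilities, and each of these
`N + 1` laws has total mass one. -/
lemma sum_exp_neg_mul_binEntropy_le (hN : N ≠ 0) (σ : Cube N) :
    ∑ τ : Cube N, Real.exp (-(N * Real.binEntropy ((1 + overlap σ τ) / 2))) ≤ N + 1 := by
  have hN0 : (0 : ℝ) < N := by positivity
  calc _ ≤ ∑ τ : Cube N, ∑ j ∈ Finset.range (N + 1),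
        ∏ i, (if τ i = σ i then (j : ℝ) / N else 1 - (j : ℝ) / N) := by
        refine Finset.sum_le_sum fun τ _ => ?_
        rw [overlap_eq_agree hN, exp_neg_mul_binEntropy hN (agree_le σ τ), ← prod_ite_agree]
        refine Finset.single_le_sum (f := fun j : ℕ =>
          ∏ i, (if τ i = σ i then (j : ℝ) / N else 1 - (j : ℝ) / N)) (fun j hj => ?_)
          (Finset.mem_range.2 (Nat.lt_succ_of_le (agree_le σ τ)))
        refine Finset.prod_nonneg fun i _ => ?_
        have : (j : ℝ) ≤ N := by exact_mod_cast Nat.lt_succ_iff.1 (Finset.mem_range.1 hj)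
        have h1 : (j : ℝ) / N ≤ 1 := div_le_one_of_le₀ this hN0.le
        split_ifs
        · positivity
        · linarith
    _ = N + 1 := by
        rw [Finset.sum_comm]
        simp_rw [sum_prod_ite]
        simp

/-- The rate bound leaves `exp(-N H)` for each pair after normalization, and the entropy sum costs
only `N + 1`. It must hold for every density `k/N ≤ α`, as all intermediate steps are used. -/
lemma integral_pairMoment_le (hN : N ≠ 0) {κ c α : ℝ} (hκ : 0 < κ)
    (hrate : ∀ β, 0 ≤ β → β ≤ 1 → ∀ t, 0 ≤ t → t ≤ α →
      Real.binEntropy β + t * (Real.log (q κ β) - 2 * Real.log (p κ)) + c * (2 * β - 1) ^ 2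
        ≤ Real.log 2) {k : ℕ} (hk : (k : ℝ) ≤ α * N) :
    ∫ X, pairMoment c κ k (sol κ X) ∂(disorder N k) ≤ N + 1 := by
  have hN0 : (0 : ℝ) < N := by positivity
  have hp := p_pos hκ
  have hcard : (Fintype.card (Cube N) : ℝ) = 2 ^ N := by
    have : Fintype.card ℤˣ = 2 := by decide
    simp [Cube, this]
  have hint : ∀ σ τ : Cube N, Integrable (fun X : Config N k => ind (sol κ X) σ * ind (sol κ X) τ)
      (disorder N k) := fun σ τ => integrable_comp_sol κ k fun U => ind U σ * ind U τ
  have h1 : ∫ X, pairMoment c κ k (sol κ X) ∂(disorder N k) =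
      (∑ σ : Cube N, ∑ τ : Cube N, q κ ((1 + overlap σ τ) / 2) ^ k *
        Real.exp (c * N * overlap σ τ ^ 2)) / (2 ^ N * p κ ^ k) ^ 2 := by
    simp_rw [pairMoment]
    rw [integral_div, integral_finsetSum _ fun σ _ => integrable_finsetSum _ fun τ _ =>
      (hint σ τ).mul_const _]
    congr 1
    refine Finset.sum_congr rfl fun σ _ => ?_
    rw [integral_finsetSum _ fun τ _ => (hint σ τ).mul_const _]
    refine Finset.sum_congr rfl fun τ _ => ?_
    rw [integral_mul_const, integral_ind_mul_ind_sol hN]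
  have h2 : ∀ σ τ : Cube N, q κ ((1 + overlap σ τ) / 2) ^ k *
      Real.exp (c * N * overlap σ τ ^ 2) ≤
      2 ^ N * (p κ ^ k) ^ 2 * Real.exp (-(N * Real.binEntropy ((1 + overlap σ τ) / 2))) := by
    intro σ τ
    have hab := abs_le.1 (abs_overlap_le hN σ τ)
    have hβ0 : 0 ≤ (1 + overlap σ τ) / 2 := by linarith
    have hβ1 : (1 + overlap σ τ) / 2 ≤ 1 := by linarith
    have hr := hrate _ hβ0 hβ1 (k / N) (by positivity) (by rwa [div_le_iff₀ hN0])
    have hq := q_pos hκ hβ0 hβ1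
    rw [show 2 * ((1 + overlap σ τ) / 2) - 1 = overlap σ τ by ring] at hr
    set Q := q κ ((1 + overlap σ τ) / 2)
    set H := Real.binEntropy ((1 + overlap σ τ) / 2)
    have e1 : Q ^ k = Real.exp (k * Real.log Q) := pow_eq_exp_mul_log hq.le k (by simp [hq.ne'])
    have e2 : (p κ ^ k) ^ 2 = Real.exp (2 * (k * Real.log (p κ))) := by
      rw [pow_eq_exp_mul_log hp.le k (by simp [hp.ne']), ← Real.exp_nat_mul]
      simp
    have e3 : (2 : ℝ) ^ N = Real.exp (N * Real.log 2) :=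
      pow_eq_exp_mul_log (by norm_num) N (by norm_num)
    rw [e1, e2, e3, ← Real.exp_add, ← Real.exp_add, ← Real.exp_add, Real.exp_le_exp]
    have h3 := mul_le_mul_of_nonneg_left hr hN0.le
    have h4 : (N : ℝ) * (H + k / N * (Real.log Q - 2 * Real.log (p κ)) + c * overlap σ τ ^ 2) =
        N * H + k * (Real.log Q - 2 * Real.log (p κ)) + c * N * overlap σ τ ^ 2 := by
      field_simp
    rw [h4] at h3
    linarith
  rw [h1, div_le_iff₀ (by positivity)]
  calc _ ≤ ∑ σ : Cube N, ∑ τ : Cube N,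
        2 ^ N * (p κ ^ k) ^ 2 * Real.exp (-(N * Real.binEntropy ((1 + overlap σ τ) / 2))) :=
        Finset.sum_le_sum fun σ _ => Finset.sum_le_sum fun τ _ => h2 σ τ
    _ ≤ ∑ σ : Cube N, 2 ^ N * (p κ ^ k) ^ 2 * ((N : ℝ) + 1) := by
        refine Finset.sum_le_sum fun σ _ => ?_
        rw [← Finset.mul_sum]
        gcongr
        exact sum_exp_neg_mul_binEntropy_le hN σ
    _ = _ := by
        rw [Finset.sum_const, Finset.card_univ, nsmul_eq_mul, hcard]
        ring

end

/-! ### Logarithmic growth of the mean potential -/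

lemma le_mul_exp_of_step {v : ℕ → ℝ} {r : ℝ} {n : ℕ} (hr : 0 ≤ r)
    (hv : ∀ k < n, v (k + 1) ≤ (1 + r) * v k) (h0 : 0 ≤ v 0) : v n ≤ Real.exp (r * n) * v 0 := by
  have h : ∀ k ≤ n, v k ≤ (1 + r) ^ k * v 0 := by
    intro k
    induction k with
    | zero => simp
    | succ k ih =>
      intro hk
      calc v (k + 1) ≤ (1 + r) * v k := hv k hk
        _ ≤ (1 + r) * ((1 + r) ^ k * v 0) := by
            gcongr
            exact ih (by omega)
        _ = _ := by ring
  refine (h n le_rfl).trans ?_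
  gcongr
  rw [mul_comm, Real.exp_nat_mul]
  gcongr
  linarith [Real.add_one_le_exp r]

lemma eventually_log_pow_le :
    ∀ᶠ N : ℕ in atTop, 1 ≤ Real.log (N + 2) ∧ 28 * Real.log ((N : ℝ) + 2) ^ 6 ≤ N := by
  have ht : Tendsto (fun N : ℕ => (N : ℝ) + 2) atTop atTop :=
    tendsto_atTop_add_const_right _ _ tendsto_natCast_atTop_atTop
  have h1 := (Real.tendsto_log_atTop.comp ht).eventually_ge_atTop 1
  have h2 := ht.eventually ((Real.isLittleO_pow_log_id_atTop (n := 6)).bound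
    (show (0 : ℝ) < 1 / 56 by norm_num))
  filter_upwards [h1, h2, eventually_ge_atTop 2] with N h1 h2 h3
  refine ⟨h1, ?_⟩
  have h1' : 0 ≤ Real.log ((N : ℝ) + 2) := le_trans zero_le_one h1
  have h3' : (2 : ℝ) ≤ N := by exact_mod_cast h3
  rw [Real.norm_of_nonneg (by positivity), id, Real.norm_of_nonneg (by positivity)] at h2
  linarith

lemma sq_log_one_add_le {B n : ℝ} (hB : 0 ≤ B) (hn : 1 ≤ n) :
    Real.log (1 + B) ^ 2 ≤ 2 * Real.log n ^ 2 + 8 * ((1 + B) / n) := by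
  have hn0 : 0 < n := by linarith
  set t := (1 + B) / n with ht
  have ht0 : 0 < t := by positivity
  have hL : Real.log (1 + B) = Real.log n + Real.log t := by
    rw [ht, Real.log_div (by positivity) (by positivity)]
    ring
  have hL0 : 0 ≤ Real.log (1 + B) := Real.log_nonneg (by linarith)
  have hlt : Real.log t ≤ 2 * √t := by
    have h1 : Real.log t = 2 * Real.log √t := by rw [Real.log_sqrt ht0.le]; ring
    have := Real.log_le_sub_one_of_pos (Real.sqrt_pos.2 ht0)
    linarith
  have hle : Real.log (1 + B) ≤ Real.log n + 2 * √t := by linarith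
  have hsq : √t ^ 2 = t := Real.sq_sqrt ht0.le
  calc _ ≤ (Real.log n + 2 * √t) ^ 2 := by gcongr
    _ ≤ _ := by nlinarith [sq_nonneg (Real.log n - 2 * √t)]

/-- The tangent form of Jensen: with `n = N + 2` and a pair moment of mean at most `N + 1`, the
remainder averages to at most `1`. -/
lemma log_one_add_le {B n : ℝ} (hB : 0 ≤ B) (hn : 1 ≤ n) :
    Real.log (1 + B) ≤ Real.log n + (1 + B) / n := by
  have hn0 : 0 < n := by linarith
  have h := Real.log_le_sub_one_of_pos (show 0 < (1 + B) / n by positivity)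
  rw [Real.log_div (by positivity) (by positivity)] at h
  linarith

/-- The mean potential of the solution space grows at most logarithmically. -/
lemma exists_potential_bound {κ α : ℝ} (hκ : 0 < κ) (hα : 0 < α) (hαc : α < alphaC κ)
    (hF : SingleCriticalPoint κ α) :
    ∃ C : ℝ, 0 < C ∧ ∀ᶠ N : ℕ in atTop, ∀ η : ℝ, 0 < η → η ≤ 1 →
      -Real.log η ≤ Real.log (N + 2) ^ 2 →
      ∫ X, potential η (weight κ ⌊α * N⌋₊ (sol κ X)) ∂(disorder N ⌊α * N⌋₊) ≤
        C * (Real.log (N + 2) + 5) := by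
  obtain ⟨c, hc, hrate⟩ := exists_pair_rate hκ hα hαc hF
  obtain ⟨A, hA, hdrift⟩ := exists_drift_bound hκ hc
  refine ⟨Real.exp (2 * A * α), Real.exp_pos _, ?_⟩
  filter_upwards [eventually_log_pow_le, eventually_ne_atTop 0] with N hlog hN η h0 h1 hM
  obtain ⟨hℓ1, hℓN⟩ := hlog
  have hN0 : (0 : ℝ) < N := by positivity
  set ℓ := Real.log ((N : ℝ) + 2) with hℓ
  set M := -Real.log η with hMdef
  have hM0 : 0 ≤ M := by linarith [Real.log_nonpos h0.le h1]
  set n := ⌊α * (N : ℝ)⌋₊ with hn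
  have hnα : (n : ℝ) ≤ α * N := Nat.floor_le (by positivity)
  set u : ℕ → ℝ := fun k => ∫ X, potential η (weight κ k (sol κ X)) ∂(disorder N k) with hu
  have hu0 : u 0 ≤ 1 := by
    have hw : ∀ X : Config N 0, weight κ 0 (sol κ X) = 1 := by
      intro X
      have : sol κ X = Set.univ := by simp [sol]
      have hcard : (Fintype.card (Cube N) : ℝ) = 2 ^ N := by
        have : Fintype.card ℤˣ = 2 := by decide
        simp [Cube, this]
      rw [weight, this, cnt]
      simp only [ind, Set.indicator_univ, Pi.one_apply, Finset.sum_const, Finset.card_univ,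
        nsmul_eq_mul, mul_one, pow_zero, hcard]
      field_simp
    simp only [hu, hw, integral_const, probReal_univ, one_smul, potential]
    have := Real.log_le_sub_one_of_pos (show 0 < (1 + 1) / (1 + η) by positivity)
    have h3 : (1 + 1) / (1 + η) ≤ 2 := by
      rw [div_le_iff₀ (by linarith)]
      linarith
    linarith
  have hu0' : 0 ≤ u 0 := integral_nonneg fun X =>
    potential_nonneg h0 h1 (weight_nonneg hκ _ _)
  have hstep : ∀ k < n, u (k + 1) ≤ (1 + 2 * A / N) * u k + A / N * (ℓ + 4) := by
    intro k hk
    have hkα : (k : ℝ) ≤ α * N := le_trans (by exact_mod_cast hk.le) hnα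
    set t : Config N k → ℝ := fun X => (1 + pairMoment c κ k (sol κ X)) / ((N : ℝ) + 2) with ht
    have hti : Integrable t (disorder N k) :=
      integrable_comp_sol κ k fun U => (1 + pairMoment c κ k U) / ((N : ℝ) + 2)
    have ht1 : ∫ X, t X ∂(disorder N k) ≤ 1 := by
      have hpm : Integrable (fun X => pairMoment c κ k (sol κ X)) (disorder N k) :=
        integrable_comp_sol κ k fun U => pairMoment c κ k U
      rw [ht, integral_div, integral_add (integrable_const _) hpm, integral_const, probReal_univ,
        one_smul, div_le_one (by positivity)]
      have := integral_pairMoment_le hN hκ hrate hkα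
      linarith
    have hψi : Integrable (fun X => potential η (weight κ k (sol κ X))) (disorder N k) :=
      integrable_comp_sol κ k fun U => potential η (weight κ k U)
    have hpt : ∀ X : Config N k,
        ∫ g, potential η (weight κ (k + 1) (sol κ X ∩ slab κ g)) ∂(gauss N) ≤
        (1 + 2 * A / N) * potential η (weight κ k (sol κ X)) +
          (A / N + 16 * (A / N ^ 2 * M)) * t X + (A / N * (ℓ + 2) +
          A / N ^ 2 * M * (4 * ℓ ^ 2 + 8 * M ^ 2)) := by
      intro X
      have hB := pairMoment_nonneg hκ c k (sol κ X)
      refine (hdrift N hN η h0 h1 k (sol κ X)).trans ?_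
      have hn1 : (1 : ℝ) ≤ (N : ℝ) + 2 := by linarith
      have h2 := log_one_add_le hB hn1
      have h3 := sq_log_one_add_le hB hn1
      rw [← hℓ] at h2 h3
      change _ ≤ ℓ + t X at h2
      change _ ≤ 2 * ℓ ^ 2 + 8 * t X at h3
      set L := Real.log (1 + pairMoment c κ k (sol κ X))
      have h4 : (L + 2 * M) ^ 2 ≤ 4 * ℓ ^ 2 + 16 * t X + 8 * M ^ 2 := by
        nlinarith [sq_nonneg (L - 2 * M)]
      have h5 : A / N * L ≤ A / N * (ℓ + t X) := by gcongr
      have h6 : A / N ^ 2 * M * (L + 2 * M) ^ 2 ≤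
          A / N ^ 2 * M * (4 * ℓ ^ 2 + 16 * t X + 8 * M ^ 2) := by gcongr
      have e : 2 * A / N = 2 * (A / N) := by ring
      rw [← hMdef, e]
      linarith
    have hLi : Integrable (fun X : Config N k =>
        ∫ g, potential η (weight κ (k + 1) (sol κ X ∩ slab κ g)) ∂(gauss N)) (disorder N k) :=
      integrable_comp_sol κ k fun U =>
        ∫ g, potential η (weight κ (k + 1) (U ∩ slab κ g)) ∂(gauss N)
    have hi1 : Integrable (fun X => (1 + 2 * A / N) * potential η (weight κ k (sol κ X)) +
          (A / N + 16 * (A / N ^ 2 * M)) * t X) (disorder N k) :=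
      (hψi.const_mul _).add (hti.const_mul _)
    have hmain := integral_mono hLi (hi1.add (integrable_const _)) hpt
    rw [← integral_comp_sol_succ κ k fun U => potential η (weight κ (k + 1) U)] at hmain
    simp only [Pi.add_apply] at hmain
    rw [integral_add hi1 (integrable_const _), integral_add (hψi.const_mul _) (hti.const_mul _),
      integral_const_mul, integral_const_mul, integral_const, probReal_univ, one_smul] at hmain
    have hcoef : 0 ≤ A / N + 16 * (A / N ^ 2 * M) := by positivity
    have h7 := mul_le_mul_of_nonneg_left ht1 hcoef
    -- The quadratic small-fraction bound matters here: it yields `1/N²` against a sixth power of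
    -- the logarithm, with `28 = 4 + 16 + 8` after `M ≤ ℓ²`.
    have h8 : A / N ^ 2 * M * (4 * ℓ ^ 2 + 16 + 8 * M ^ 2) ≤ A / N := by
      have h9 : M * (4 * ℓ ^ 2 + 16 + 8 * M ^ 2) ≤ N := by
        refine le_trans ?_ hℓN
        have hℓ2 : 1 ≤ ℓ ^ 2 := one_le_pow₀ hℓ1
        calc _ ≤ ℓ ^ 2 * (4 * ℓ ^ 2 + 16 + 8 * (ℓ ^ 2) ^ 2) := by gcongr
          _ ≤ _ := by
            have h10 : ℓ ^ 2 ≤ (ℓ ^ 2) ^ 2 := by nlinarith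
            have h11 : 1 ≤ (ℓ ^ 2) ^ 2 := one_le_pow₀ hℓ2
            have : 28 * ℓ ^ 6 = ℓ ^ 2 * (28 * (ℓ ^ 2) ^ 2) := by ring
            rw [this]
            gcongr
            linarith
      calc _ = A / N ^ 2 * (M * (4 * ℓ ^ 2 + 16 + 8 * M ^ 2)) := by ring
        _ ≤ A / N ^ 2 * N := by gcongr
        _ = A / N := by field_simp
    change u (k + 1) ≤ _ at hmain
    change u (k + 1) ≤ (1 + 2 * A / N) * u k + _ + _ at hmain
    linarith
  -- Adding `(ℓ + 4)/2` absorbs the constant term of the affine recursion and makes it homogeneous.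
  have hfinal := le_mul_exp_of_step (v := fun k => u k + (ℓ + 4) / 2) (r := 2 * A / N) (n := n)
    (by positivity) (fun k hk => by
      have := hstep k hk
      have e : (1 + 2 * A / N) * (u k + (ℓ + 4) / 2) =
        (1 + 2 * A / N) * u k + A / N * (ℓ + 4) + (ℓ + 4) / 2 := by ring
      rw [e]
      linarith) (by linarith)
  have hexp : Real.exp (2 * A / N * n) ≤ Real.exp (2 * A * α) := by
    rw [Real.exp_le_exp, div_mul_eq_mul_div, div_le_iff₀ hN0]
    nlinarith
  calc u n ≤ u n + (ℓ + 4) / 2 := by linarith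
    _ ≤ Real.exp (2 * A / N * n) * (u 0 + (ℓ + 4) / 2) := hfinal
    _ ≤ Real.exp (2 * A * α) * (ℓ + 5) := by
        have : u 0 + (ℓ + 4) / 2 ≤ ℓ + 5 := by linarith
        gcongr

/-! ### From the planted to the random model -/

lemma pi_cond {E : Type*} [MeasurableSpace E] (ν : Measure E) [IsProbabilityMeasure ν] {s : Set E}
    (hs : MeasurableSet s) (k : ℕ) :
    (Measure.pi fun _ : Fin k => ν[|s]) =
      (Measure.pi fun _ : Fin k => ν)[|Set.univ.pi fun _ => s] := by
  refine Measure.pi_eq fun t _ => ?_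
  rw [cond_apply (MeasurableSet.univ_pi fun _ => hs), ← Set.pi_inter_distrib, Measure.pi_pi,
    Measure.pi_pi]
  simp_rw [cond_apply hs]
  rw [Finset.prod_mul_distrib, Finset.prod_const, Finset.prod_const, ENNReal.inv_pow]

section

variable {N : ℕ}

lemma count_eq_sum (T : Set (Cube N)) : Measure.count T = ∑ σ, T.indicator (1 : Cube N → ENNReal) σ := by
  rw [← lintegral_indicator_one (MeasurableSet.of_discrete (s := T)), lintegral_count, tsum_fintype]

lemma ofReal_cnt (U : Set (Cube N)) : ENNReal.ofReal (cnt U) = Measure.count U := by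
  rw [count_eq_sum, cnt, ENNReal.ofReal_sum_of_nonneg fun σ _ => ind_nonneg U σ]
  refine Finset.sum_congr rfl fun σ _ => ?_
  by_cases h : σ ∈ U <;> simp [ind, h]

lemma card_cube : Fintype.card (Cube N) = 2 ^ N := by
  have : Fintype.card ℤˣ = 2 := by decide
  simp [Cube, this]

lemma measurableSet_sol_preimage (κ : ℝ) (k : ℕ) (𝒰 : Set (Set (Cube N))) :
    MeasurableSet {X : Config N k | sol κ X ∈ 𝒰} :=
  measurable_sol κ N k (MeasurableSet.of_discrete (s := 𝒰))

lemma measurableSet_pair_mem (κ : ℝ) (k : ℕ) (A : Set (Cube N × Set (Cube N))) :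
    MeasurableSet {ω : Cube N × Config N k | (ω.1, sol κ ω.2) ∈ A} := by
  have h : Measurable fun ω : Cube N × Config N k => (ω.1, sol κ ω.2) :=
    measurable_fst.prodMk ((measurable_sol κ N k).comp measurable_snd)
  exact h (MeasurableSet.of_discrete (s := A))

lemma disorder_sol (hN : N ≠ 0) {κ : ℝ} (k : ℕ) (σ : Cube N) :
    disorder N k {X | σ ∈ sol κ X} = ENNReal.ofReal (p κ ^ k) := by
  have h : {X : Config N k | σ ∈ sol κ X} = Set.univ.pi fun _ => {g | σ ∈ slab κ g} := by
    ext X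
    simp [sol]
  rw [h, disorder, Measure.pi_pi, Finset.prod_const, Finset.card_univ, Fintype.card_fin,
    ← gauss_slab hN κ σ, ENNReal.ofReal_pow measureReal_nonneg, ofReal_measureReal]

lemma plantedConfig_eq (κ : ℝ) (k : ℕ) (σ : Cube N) :
    plantedConfig κ N k σ = (disorder N k)[|{X | σ ∈ sol κ X}] := by
  have h : {X : Config N k | σ ∈ sol κ X} = Set.univ.pi fun _ => {g | σ ∈ slab κ g} := by
    ext X
    simp [sol]
  rw [h]
  exact pi_cond (gauss N) (measurableSet_mem_slab κ σ) k

/-- The mean number of solutions in an event is the planted probability, up to normalization. -/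
lemma lintegral_count_eq (hN : N ≠ 0) {κ : ℝ} (hκ : 0 < κ) (k : ℕ)
    {A : Set (Cube N × Set (Cube N))} (hA : ∀ a ∈ A, a.1 ∈ a.2) :
    ∫⁻ X, Measure.count {σ | (σ, sol κ X) ∈ A} ∂(disorder N k) =
      ENNReal.ofReal (2 ^ N * p κ ^ k) *
        plantedModel κ N k {ω | (ω.1, sol κ ω.2) ∈ A} := by
  have hp := p_pos hκ
  have hp0 : ENNReal.ofReal (p κ ^ k) ≠ 0 := by
    rw [ENNReal.ofReal_ne_zero_iff]
    positivity
  have hpl : ∀ σ : Cube N, ENNReal.ofReal (p κ ^ k) *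
      plantedConfig κ N k σ {X | (σ, sol κ X) ∈ A} = disorder N k {X | (σ, sol κ X) ∈ A} := by
    intro σ
    have hsub : {X : Config N k | (σ, sol κ X) ∈ A} ⊆ {X | σ ∈ sol κ X} := fun X hX => hA _ hX
    rw [plantedConfig_eq, cond_apply (measurableSet_mem_sol κ σ),
      Set.inter_eq_self_of_subset_right hsub, disorder_sol hN, ← mul_assoc,
      ENNReal.mul_inv_cancel hp0 ENNReal.ofReal_ne_top, one_mul]
  have hunif : ∀ σ : Cube N, uniformOn (Set.univ : Set (Cube N)) {σ} = ((2 : ENNReal) ^ N)⁻¹ := by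
    intro σ
    rw [uniformOn_univ, Measure.count_singleton, card_cube, one_div]
    norm_cast
  rw [plantedModel, Measure.compProd_apply (measurableSet_pair_mem κ k A),
    lintegral_fintype (α := Cube N)]
  simp_rw [hunif, count_eq_sum]
  rw [lintegral_finsetSum _ fun σ _ => ?_, ← Finset.sum_mul, mul_comm (Finset.sum _ _), mul_comm (2 ^ N),
    ENNReal.ofReal_mul (by positivity), ENNReal.ofReal_pow zero_le_two,
    ENNReal.ofReal_ofNat, mul_assoc, ENNReal.mul_inv_cancel_left (a := 2 ^ N) (by positivity) (by simp), Finset.mul_sum]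
  · refine Finset.sum_congr rfl fun σ _ => ?_
    refine Eq.trans ?_ (hpl σ).symm
    exact lintegral_indicator_one (measurableSet_sol_preimage κ k {U | (σ, U) ∈ A})
  · exact (Measurable.of_discrete
      (f := fun U : Set (Cube N) => ({σ | (σ, U) ∈ A} : Set (Cube N)).indicator 1 σ)).comp
      (measurable_sol κ N k)

/-- Transfer from the planted to the random model, outside the event of few solutions. -/
lemma randomModel_le (hN : N ≠ 0) {κ : ℝ} (hκ : 0 < κ) (k : ℕ)
    {A : Set (Cube N × Set (Cube N))} (hA : ∀ a ∈ A, a.1 ∈ a.2) {η : ℝ} (h0 : 0 < η) :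
    (disorder N k).real {X | (sol κ X).Nonempty} *
        (randomModel κ N k).real {ω | (ω.1, sol κ ω.2) ∈ A} ≤
      (disorder N k).real {X | weight κ k (sol κ X) ≤ η} +
        η⁻¹ * (plantedModel κ N k).real {ω | (ω.1, sol κ ω.2) ∈ A} := by
  have hp := p_pos hκ
  set Z := {X : Config N k | (sol κ X).Nonempty} with hZ
  set L := {X : Config N k | weight κ k (sol κ X) ≤ η} with hL
  set n := 2 ^ N * p κ ^ k with hn
  have hn0 : 0 < n := by positivity
  have hZm : MeasurableSet Z := measurableSet_sol_preimage κ k {U | U.Nonempty}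
  have hLm : MeasurableSet L := measurableSet_sol_preimage κ k {U | weight κ k U ≤ η}
  -- Outside `L` there are more than `η n` solutions, so uniform mass is at most count divided by `η
  -- n`; inside `L`, which contains the case of no solutions, mass at most one suffices.
  have hpt : ∀ X : Config N k, uniformOn (sol κ X) {σ | (σ, sol κ X) ∈ A} ≤
      L.indicator 1 X +
        (ENNReal.ofReal (η * n))⁻¹ * Measure.count {σ | (σ, sol κ X) ∈ A} := by
    intro X
    by_cases hX : X ∈ L
    · rw [Set.indicator_of_mem hX]
      exact prob_le_one.trans le_self_add
    · rw [Set.indicator_of_notMem hX, zero_add, uniformOn, cond_apply (Set.toFinite _).measurableSet,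
        ← ofReal_cnt]
      have hX' : η < weight κ k (sol κ X) := not_le.1 hX
      rw [weight, lt_div_iff₀ hn0] at hX'
      gcongr
      exact Set.inter_subset_right
  have hrand : disorder N k Z * randomModel κ N k {ω | (ω.1, sol κ ω.2) ∈ A} ≤
      ∫⁻ X, uniformOn (sol κ X) {σ | (σ, sol κ X) ∈ A} ∂(disorder N k) := by
    rw [randomModel, Measure.map_apply measurable_swap (measurableSet_pair_mem κ k A),
      Measure.compProd_apply (measurable_swap (measurableSet_pair_mem κ k A)),
      ProbabilityTheory.cond,
      lintegral_smul_measure, smul_eq_mul, ← mul_assoc]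
    -- Only `P(Z) · P(Z)⁻¹ ≤ 1` is needed, so `P(Z) = 0` needs no separate treatment.
    refine le_trans (mul_le_of_le_one_left' (ENNReal.mul_inv_le_one _)) ?_
    exact setLIntegral_le_lintegral _ _
  have hmeasc : Measurable fun X : Config N k => Measure.count {σ | (σ, sol κ X) ∈ A} :=
    (Measurable.of_discrete
      (f := fun U : Set (Cube N) => Measure.count {σ | (σ, U) ∈ A})).comp (measurable_sol κ N k)
  have hmain : disorder N k Z * randomModel κ N k {ω | (ω.1, sol κ ω.2) ∈ A} ≤
      disorder N k L +
        ENNReal.ofReal η⁻¹ * plantedModel κ N k {ω | (ω.1, sol κ ω.2) ∈ A} := by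
    refine hrand.trans ((lintegral_mono hpt).trans (le_of_eq ?_))
    rw [lintegral_add_right _ (hmeasc.const_mul _), lintegral_indicator_one hLm,
      lintegral_const_mul _ hmeasc, lintegral_count_eq hN hκ k hA, ← mul_assoc,
      ← ENNReal.ofReal_inv_of_pos (by positivity), ← ENNReal.ofReal_mul (by positivity)]
    congr 3
    rw [← hn]
    field_simp
  have hfin : plantedModel κ N k {ω | (ω.1, sol κ ω.2) ∈ A} ≠ ⊤ := by
    rw [plantedModel]
    exact measure_ne_top _ _
  have := ENNReal.toReal_mono (ENNReal.add_ne_top.2 ⟨measure_ne_top _ _,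
    ENNReal.mul_ne_top ENNReal.ofReal_ne_top hfin⟩) hmain
  rwa [ENNReal.toReal_mul, ENNReal.toReal_add (measure_ne_top _ _)
    (ENNReal.mul_ne_top ENNReal.ofReal_ne_top hfin), ENNReal.toReal_mul,
    ENNReal.toReal_ofReal (by positivity)] at this

lemma randomModel_real_le_one (κ : ℝ) (k : ℕ) (E : Set (Cube N × Config N k)) :
    (randomModel κ N k).real E ≤ 1 := by
  refine ENNReal.toReal_le_of_le_ofReal zero_le_one ?_
  rw [ENNReal.ofReal_one]
  refine (measure_mono (Set.subset_univ E)).trans ?_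
  rw [randomModel, Measure.map_apply measurable_swap MeasurableSet.univ, Set.preimage_univ,
    Measure.compProd_apply MeasurableSet.univ]
  refine (lintegral_mono (g := fun _ => 1) fun X => prob_le_one (μ := uniformOn (sol κ X))).trans ?_
  rw [lintegral_one]
  exact prob_le_one

/-- Markov's inequality for the potential. -/
lemma real_weight_le (κ : ℝ) (hκ : 0 < κ) (k : ℕ) {η : ℝ} (h0 : 0 < η) (h1 : η ≤ 1) :
    (-Real.log η - Real.log 2) * (disorder N k).real {X | weight κ k (sol κ X) ≤ η} ≤
      ∫ X, potential η (weight κ k (sol κ X)) ∂(disorder N k) := by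
  rcases le_total (-Real.log η - Real.log 2) 0 with h | h
  · exact (mul_nonpos_of_nonpos_of_nonneg h measureReal_nonneg).trans
      (integral_nonneg fun X => potential_nonneg h0 h1 (weight_nonneg hκ _ _))
  refine le_trans ?_ (mul_meas_ge_le_integral_of_nonneg (ae_of_all _ fun X =>
    potential_nonneg h0 h1 (weight_nonneg hκ _ _))
    (integrable_comp_sol κ k fun U => potential η (weight κ k U)) (-Real.log η - Real.log 2))
  exact mul_le_mul_of_nonneg_left (measureReal_mono fun X hX =>
    le_potential h0 (weight_nonneg hκ _ _) hX) h

lemma one_sub_real_weight_le_nonempty (κ : ℝ) (k : ℕ) {η : ℝ} (h0 : 0 < η) :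
    1 - (disorder N k).real {X | weight κ k (sol κ X) ≤ η} ≤
      (disorder N k).real {X | (sol κ X).Nonempty} := by
  have hm : MeasurableSet {X : Config N k | (sol κ X).Nonempty} :=
    measurableSet_sol_preimage κ k {U | U.Nonempty}
  have h := probReal_compl_eq_one_sub (μ := disorder N k) hm
  have h2 : (disorder N k).real {X | (sol κ X).Nonempty}ᶜ ≤
      (disorder N k).real {X | weight κ k (sol κ X) ≤ η} := by
    refine measureReal_mono fun X hX => ?_
    have hX' : sol κ X = ∅ := Set.not_nonempty_iff_eq_empty.1 hX
    change weight κ k (sol κ X) ≤ η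
    rw [hX', weight, cnt_empty, zero_div]
    exact h0.le
  linarith

end

/-! ### Lower bound on the number of solutions, and conclusion -/

/-- If `s N → ∞` not faster than `log N`, then at least `N ^ (-s N) * 2 ^ N * p ^ m` solutions exist
with high probability. -/
lemma tendsto_real_weight_le {κ α : ℝ} (hκ : 0 < κ) (hα : 0 < α) (hαc : α < alphaC κ)
    (hF : SingleCriticalPoint κ α) {s : ℕ → ℝ} (hs : Tendsto s atTop atTop)
    (hsle : ∀ N, s N ≤ Real.log N) :
    Tendsto (fun N : ℕ => (disorder N ⌊α * N⌋₊).real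
      {X | weight κ ⌊α * N⌋₊ (sol κ X) ≤ (N : ℝ) ^ (-s N)}) atTop (𝓝 0) := by
  obtain ⟨C, hC, hbound⟩ := exists_potential_bound hκ hα hαc hF
  -- For `N ≥ 3`, `log (N + 2) + 5 ≤ 7 log N`, and the `-1` absorbs the `log 2` lost in the
  -- truncation.
  have hlim : Tendsto (fun N => 7 * C / (s N - 1)) atTop (𝓝 0) :=
    tendsto_const_nhds.div_atTop (tendsto_atTop_add_const_right _ (-1) hs)
  refine squeeze_zero' (Eventually.of_forall fun N => measureReal_nonneg) ?_ hlim
  filter_upwards [hbound, hs.eventually_ge_atTop 2, eventually_ge_atTop 3] with N hN hs2 hN3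
  have hN3' : (3 : ℝ) ≤ N := by exact_mod_cast hN3
  have hN0 : (0 : ℝ) < N := by linarith
  set l := Real.log (N : ℝ) with hl
  have hl1 : 1 ≤ l := by
    rw [hl, Real.le_log_iff_exp_le hN0]
    linarith [Real.exp_one_lt_d9]
  have hl2 : Real.log 2 ≤ l := Real.log_le_log two_pos (by linarith)
  have hle : l ≤ Real.log ((N : ℝ) + 2) := Real.log_le_log hN0 (by linarith)
  have hle2 : Real.log ((N : ℝ) + 2) ≤ 2 * l := by
    have : 2 * l = Real.log ((N : ℝ) ^ 2) := by rw [Real.log_pow]; simp [hl]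
    rw [this]
    exact Real.log_le_log (by linarith) (by nlinarith)
  set η := (N : ℝ) ^ (-s N) with hη
  have hη0 : 0 < η := Real.rpow_pos_of_pos hN0 _
  have hη1 : η ≤ 1 := Real.rpow_le_one_of_one_le_of_nonpos (by linarith) (by linarith)
  have hlogη : -Real.log η = s N * l := by rw [hη, Real.log_rpow hN0]; ring
  have h1 := real_weight_le κ hκ ⌊α * N⌋₊ (N := N) hη0 hη1
  have h2 := hN η hη0 hη1 (by
    rw [hlogη]
    calc s N * l ≤ l * l := by gcongr; exact hsle N
      _ = l ^ 2 := by ring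
      _ ≤ _ := by gcongr)
  rw [hlogη] at h1
  set a := (disorder N ⌊α * N⌋₊).real {X | weight κ ⌊α * N⌋₊ (sol κ X) ≤ η}
  have ha : 0 ≤ a := measureReal_nonneg
  rw [le_div_iff₀ (by linarith)]
  have h3 : (s N - 1) * l * a ≤ (s N * l - Real.log 2) * a := by
    gcongr
    linarith
  have h4 : C * (Real.log ((N : ℝ) + 2) + 5) ≤ C * (7 * l) := by
    gcongr
    linarith
  have h5 : a * (s N - 1) * l ≤ 7 * C * l := by linarith
  exact le_of_mul_le_mul_right h5 (by linarith)

end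
end SymPerceptron

theorem lemma4p1 (κ α : ℝ) (hκ : 0 < κ) (hα : 0 < α) (hαc : α < SymPerceptron.alphaC κ)
    (hF : SymPerceptron.SingleCriticalPoint κ α)
    (A : (N : ℕ) → Set (SymPerceptron.Cube N × Set (SymPerceptron.Cube N)))
    (hA : ∀ N, ∀ a ∈ A N, a.1 ∈ a.2)
    (m : ℕ → ℝ) (hm : Tendsto m atTop atTop)
    (hpl : ∀ᶠ N : ℕ in atTop,
      (SymPerceptron.plantedModel κ N ⌊α * N⌋₊).real
        {ω | (ω.1, SymPerceptron.sol κ ω.2) ∈ A N} ≤ (N : ℝ) ^ (-m N)) :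
    Tendsto (fun N : ℕ =>
      (SymPerceptron.randomModel κ N ⌊α * N⌋₊).real
        {ω | (ω.1, SymPerceptron.sol κ ω.2) ∈ A N}) atTop (𝓝 0) := by
  -- The bound `m N / 2` leaves half the planted decay after the loss `N^(s N)`; the bound `log N`
  -- keeps `-log η ≤ (log (N + 2))²`, as the potential estimate requires.
  set s : ℕ → ℝ := fun N => min (m N / 2) (Real.log N) with hsdef
  have hm2 : Tendsto (fun N => m N / 2) atTop atTop := hm.atTop_div_const two_pos
  have hs : Tendsto s atTop atTop :=
    tendsto_atTop_atTop.2 fun b => by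
      obtain ⟨i, hi⟩ := eventually_atTop.1 ((hm2.eventually_ge_atTop b).and
        ((Real.tendsto_log_atTop.comp tendsto_natCast_atTop_atTop).eventually_ge_atTop b))
      exact ⟨i, fun N hN => le_min (hi N hN).1 (hi N hN).2⟩
  have ha := SymPerceptron.tendsto_real_weight_le hκ hα hαc hF hs fun N => min_le_right _ _
  have hexp : Tendsto (fun N => Real.exp (-(m N / 2))) atTop (𝓝 0) :=
    Real.tendsto_exp_neg_atTop_nhds_zero.comp hm2
  -- With `a` the probability of few solutions, `R` the random probability and `e` the exponential
  -- term, `(1 - a) R ≤ a + e` and `R ≤ 1` give `R ≤ 2a + e`.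
  have hlim := (ha.const_mul 2).add hexp
  rw [mul_zero, add_zero] at hlim
  refine squeeze_zero' (Eventually.of_forall fun N => measureReal_nonneg) ?_ hlim
  filter_upwards [hpl, hm.eventually_ge_atTop 0, eventually_ge_atTop 3] with N hN hm0 hN3
  have hN3' : (3 : ℝ) ≤ N := by exact_mod_cast hN3
  have hN0 : (0 : ℝ) < N := by linarith
  have hl1 : 1 ≤ Real.log (N : ℝ) := by
    rw [Real.le_log_iff_exp_le hN0]
    linarith [Real.exp_one_lt_d9]
  have hη0 : 0 < (N : ℝ) ^ (-s N) := Real.rpow_pos_of_pos hN0 _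
  have h1 := SymPerceptron.randomModel_le (by omega) hκ ⌊α * N⌋₊ (hA N) hη0
  have h2 := SymPerceptron.one_sub_real_weight_le_nonempty (N := N) κ ⌊α * N⌋₊ hη0
  have h3 := SymPerceptron.randomModel_real_le_one κ ⌊α * N⌋₊
    {ω : SymPerceptron.Cube N × _ | (ω.1, SymPerceptron.sol κ ω.2) ∈ A N}
  have h4 : ((N : ℝ) ^ (-s N))⁻¹ * (SymPerceptron.plantedModel κ N ⌊α * N⌋₊).real
      {ω | (ω.1, SymPerceptron.sol κ ω.2) ∈ A N} ≤ Real.exp (-(m N / 2)) := by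
    calc _ ≤ ((N : ℝ) ^ (-s N))⁻¹ * (N : ℝ) ^ (-m N) := by gcongr
      _ = Real.exp (Real.log N * (s N - m N)) := by
        rw [← Real.rpow_neg hN0.le, ← Real.rpow_add hN0, Real.rpow_def_of_pos hN0]
        congr 2
        ring
      _ ≤ _ := by
        rw [Real.exp_le_exp]
        have : s N ≤ m N / 2 := min_le_left _ _
        nlinarith
  have h5 : 0 ≤ (SymPerceptron.randomModel κ N ⌊α * N⌋₊).real
    {ω : SymPerceptron.Cube N × _ | (ω.1, SymPerceptron.sol κ ω.2) ∈ A N} := measureReal_nonneg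
  have h6 : 0 ≤ (SymPerceptron.disorder N ⌊α * N⌋₊).real
    {X | SymPerceptron.weight κ ⌊α * N⌋₊ (SymPerceptron.sol κ X) ≤ (N : ℝ) ^ (-s N)} :=
    measureReal_nonneg
  nlinarith
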